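/- A polytope is the convex hull of finitely many points in some $\mathbb{R}^n$; its size is the number of its facets. A polytope $Q \subseteq \mathbb{R}^{n}$ is an extension of a polytope $P \subseteq \mathbb{R}^d$ ($n \ge d$) if the orthogonal projection of $Q$ onto the first $d$ coordinates equals $P$; it is a minimum size extension if no extension of $P$ (in any dimension) has fewer facets. Let $P \subseteq \mathbb{R}^2$ be a convex heptagon, that is, a polytope with exactly seven vertices, and write $\overline{uv}$ for the line through two distinct points $u, v$. Suppose that $P$ is in general position, meaning: 1. there are no four pairwise distinct vertices $u_1,\dots,u_4$ of $P$ such that the lines $\overline{u_1u_2}$ and $\overline{u_3u_4}$ are parallel; 2. there are no six pairwise distinct vertices $u_1,\dots,u_6$ of $P$ such that the lines $\overline{u_1u_2}$, $\overline{u_3u_4}$, $\overline{u_5u_6}$ have a common point; 3. there are no seven pairwise distinct vertices $u_1,\dots,u_7$ of $P$ such that the three intersection points $\overline{u_1u_2}\cap\overline{u_3u_4}$, $\overline{u_2u_5}\cap\overline{u_4u_6}$ and $\overline{u_3u_7}\cap\overline{u_1u_5}$ lie on one line. Then every minimum size extension $Q$ of $P$ has exactly $6$ facets, and it has a vertex that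 is not projected onto a vertex of $P$. -/

import Mathlib

/-- A polytope in `ℝⁿ` is the convex hull of a finite set of points. -/
def IsPolytope {n : ℕ} (Q : Set (Fin n → ℝ)) : Prop :=
  ∃ S : Set (Fin n → ℝ), S.Finite ∧ Q = convexHull ℝ S

/-- The vertices of a polytope are its extreme points. -/
def vertices {n : ℕ} (Q : Set (Fin n → ℝ)) : Set (Fin n → ℝ) :=
  Q.extremePoints ℝ

/-- A facet of `Q` is a nonempty face (the set of maximizers over `Q` of a linear functional) whose
dimension is one less than the dimension of `Q`. -/
def IsFacet {n : ℕ} (Q F : Set (Fin n → ℝ)) : Prop :=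
  F.Nonempty ∧ IsExposed ℝ Q F ∧
    Module.finrank ℝ (vectorSpan ℝ F) + 1 = Module.finrank ℝ (vectorSpan ℝ Q)

/-- The size of a polytope is the number of its facets. -/
noncomputable def polytopeSize {n : ℕ} (Q : Set (Fin n → ℝ)) : ℕ∞ :=
  {F | IsFacet Q F}.encard

/-- The orthogonal projection `ℝᵈ⁺ᵏ → ℝᵈ` onto the first `d` coordinates. -/
def firstCoords (d k : ℕ) (x : Fin (d + k) → ℝ) : Fin d → ℝ :=
  fun i => x (Fin.castAdd k i)

/-- The polytope `Q ⊆ ℝᵈ⁺ᵏ` is an extension of `P ⊆ ℝᵈ` if it is projected onto `P`. -/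
def IsExtension {d k : ℕ} (Q : Set (Fin (d + k) → ℝ)) (P : Set (Fin d → ℝ)) : Prop :=
  IsPolytope Q ∧ firstCoords d k '' Q = P

/-- An extension of `P` of minimum size among all extensions of `P`, in all dimensions. -/
def IsMinimumSizeExtension {d k : ℕ} (Q : Set (Fin (d + k) → ℝ)) (P : Set (Fin d → ℝ)) : Prop :=
  IsExtension Q P ∧
    ∀ (l : ℕ) (R : Set (Fin (d + l) → ℝ)), IsExtension R P → polytopeSize Q ≤ polytopeSize R

/-- A convex heptagon: a polytope in the plane with exactly seven vertices. -/
def IsConvexHeptagon (P : Set (Fin 2 → ℝ)) : Prop :=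
  IsPolytope P ∧ (vertices P).ncard = 7

/-- No two lines through disjoint pairs of vertices are parallel. -/
def NoParallelLines (P : Set (Fin 2 → ℝ)) : Prop :=
  ¬ ∃ u : Fin 4 → (Fin 2 → ℝ), Function.Injective u ∧ (∀ i, u i ∈ vertices P) ∧
    line[ℝ, u 0, u 1].Parallel line[ℝ, u 2, u 3]

/-- No three lines through disjoint pairs of vertices have a common point. -/
def NoConcurrentLines (P : Set (Fin 2 → ℝ)) : Prop :=
  ¬ ∃ u : Fin 6 → (Fin 2 → ℝ), Function.Injective u ∧ (∀ i, u i ∈ vertices P) ∧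
    ∃ p, p ∈ line[ℝ, u 0, u 1] ∧ p ∈ line[ℝ, u 2, u 3] ∧ p ∈ line[ℝ, u 4, u 5]

/-- There are no seven pairwise distinct vertices `u₁, …, u₇` (here indexed `0, …, 6`) such that
the intersection points `u₁u₂ ∩ u₃u₄`, `u₂u₅ ∩ u₄u₆` and `u₃u₇ ∩ u₁u₅` lie on one line. -/
def NoSpecialCollinearity (P : Set (Fin 2 → ℝ)) : Prop :=
  ¬ ∃ u : Fin 7 → (Fin 2 → ℝ), Function.Injective u ∧ (∀ i, u i ∈ vertices P) ∧
    ∃ p q r : Fin 2 → ℝ,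
      (p ∈ line[ℝ, u 0, u 1] ∧ p ∈ line[ℝ, u 2, u 3]) ∧
      (q ∈ line[ℝ, u 1, u 4] ∧ q ∈ line[ℝ, u 3, u 5]) ∧
      (r ∈ line[ℝ, u 2, u 6] ∧ r ∈ line[ℝ, u 0, u 4]) ∧
      Collinear ℝ {p, q, r}

/-- The general-position assumption on a convex heptagon. -/
def InGeneralPosition (P : Set (Fin 2 → ℝ)) : Prop :=
  NoParallelLines P ∧ NoConcurrentLines P ∧ NoSpecialCollinearity P

/-! Upper bound. In ℝ³ keep five vertices of the heptagon at height zero, raise two of them, and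
take the base plane together with five tilted side planes, each raised vertex lying on three side
planes. This polyhedron projects onto the heptagon as soon as two inequalities between products of
orientations hold (`IsGoodOrder`). If one of them failed for every rotation of the labels,
multiplying around the cycle would contradict a Plücker relation (`exists_shift_isGoodOrder`).

Lower bound and hidden vertex. The facet slacks of an extension with at most `M` facets identify the
cone over it with the nonnegative part of a subspace `K` of ℝᴹ, and a linear map `π` carries this
part to the cone over `P` (`exists_coneLift`). Facets become coordinates, vertices become extreme
rays, and the support of a ray is the set of facets missing the vertex. If `M = 6`, then `K` has
dimension at least four, since a heptagon is not cut out by six half-planes. So `K` is given by two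
equations: it is the space of dependencies of six plane vectors (Gale duality). These can be
normalised to `lam i • (1, t i)` with `t` monotone, and the supports of the extreme rays then depend
only on the signs of `lam` and the equalities in `t`.

Suppose that every vertex of the extension projects to a vertex of `P`. Then the rays map onto the
seven vertices. A finite check (`allClassified_eq_true`) leaves four possibilities. At most six rays
are too few. A prism gives three concurrent lines through pairs of rays, which the first two
general-position conditions exclude (`IsRayMap.false_of_prism`). A product of two triangles contains
such a prism (`IsRayMap.false_of_grid`). A cube, possibly with one edge contracted, has two opposite
facet planes whose common line carries three intersections of edge lines; this is the third excluded
condition (`IsRayMap.false_of_cube`).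

Five facets are excluded by the same check. Adding an unconstrained sixth coordinate leaves at most
six rays besides the trivial one, fewer than the vertices of `P` (`not_coneLift_five`). -/

/-! ### Orientations and the cyclic order of the vertices -/

/-- Twice the signed area of the triangle `a b c`. -/
def orient (a b c : Fin 2 → ℝ) : ℝ :=
  (b 0 - a 0) * (c 1 - a 1) - (b 1 - a 1) * (c 0 - a 0)

theorem orient_rotate (a b c : Fin 2 → ℝ) : orient b c a = orient a b c := by
  unfold orient; ring

theorem orient_swap (a b c : Fin 2 → ℝ) : orient a c b = -orient a b c := by
  unfold orient; ring

/-- A finite family of nonzero pairs is avoided by a generic linear form. -/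
theorem exists_generic_combination {ι : Type*} [Fintype ι] (α β : ι → ℝ) :
    ∃ τ : ℝ, ∀ i, α i + τ * β i = 0 → α i = 0 ∧ β i = 0 := by
  classical
  -- Only finitely many values of `τ` are bad. An index with `β i = 0` contributes the junk value
  -- `0`, which does no harm.
  obtain ⟨τ, hτ⟩ := Infinite.exists_notMem_finset (Finset.univ.image fun i => -α i / β i)
  refine ⟨τ, fun i hi => ?_⟩
  by_cases hb : β i = 0
  · simp_all
  · exact absurd (Finset.mem_image.2 ⟨i, Finset.mem_univ i, by field_simp; linarith⟩) hτ

theorem eq_of_mem_extremePoints_of_combination {E : Type*} [AddCommGroup E] [Module ℝ E]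
    {P : Set E} {v p q : E} (hv : v ∈ P.extremePoints ℝ) (hp : p ∈ P) (hq : q ∈ P) {a b : ℝ}
    (ha : 0 < a) (hb : 0 < b) (h : a • (p, (1 : ℝ)) + b • (q, (1 : ℝ)) = (v, (1 : ℝ))) :
    p = v ∧ q = v := by
  rw [mem_extremePoints] at hv
  simp only [Prod.smul_mk, smul_eq_mul, mul_one, Prod.mk_add_mk, Prod.mk.injEq] at h
  exact hv.2 p hp q hq ⟨a, b, ha, hb, h.2, h.1⟩

theorem not_mem_extremePoints_of_triangle {E : Type*} [AddCommGroup E] [Module ℝ E]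
    {P : Set E} (hP : Convex ℝ P) {v p q r : E} (hv : v ∈ P.extremePoints ℝ)
    (hp : p ∈ P) (hq : q ∈ P) (hr : r ∈ P) {a b c : ℝ} (ha : 0 < a) (hb : 0 < b) (hc : 0 < c)
    (habc : a + b + c = 1) (h : a • p + b • q + c • r = v) : p = v := by
  have hbc : 0 < b + c := by linarith
  refine (eq_of_mem_extremePoints_of_combination hv hp
    (hP hq hr (a := b / (b + c)) (b := c / (b + c)) (by positivity) (by positivity)
      (by field_simp)) ha hbc ?_).1
  have e1 : (b + c) * (b / (b + c)) = b := by field_simp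
  have e2 : (b + c) * (c / (b + c)) = c := by field_simp
  simp only [Prod.smul_mk, Prod.mk_add_mk, smul_add, smul_smul, e1, e2, smul_eq_mul, mul_one]
  rw [← h, ← add_assoc, ← add_assoc, habc]

/-- Of three collinear points one lies between the other two, which an extreme point cannot do. -/
theorem orient_ne_zero {P : Set (Fin 2 → ℝ)} {a b c : Fin 2 → ℝ}
    (ha : a ∈ vertices P) (hb : b ∈ vertices P) (hc : c ∈ vertices P)
    (hab : a ≠ b) (hac : a ≠ c) (hbc : b ≠ c) : orient a b c ≠ 0 := by
  intro h
  have key : ∀ x y z : Fin 2 → ℝ, x ∈ P → y ∈ vertices P → z ∈ P → y ≠ x → y ≠ z →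
      ¬ Wbtw ℝ x y z := by
    intro x y z hx hy hz h1 h2 hw
    have : y ∈ openSegment ℝ x z := by
      have := mem_segment_iff_wbtw.2 hw
      rw [← insert_endpoints_openSegment] at this
      simpa [h1, h2] using this
    exact h1 (((mem_extremePoints.1 hy).2 x hx z hz this).1).symm
  have hcol : Collinear ℝ {a, b, c} := by
    rw [collinear_iff_of_mem (p₀ := a) (by simp)]
    refine ⟨b - a, ?_⟩
    simp only [Set.mem_insert_iff, Set.mem_singleton_iff, forall_eq_or_imp, forall_eq]
    refine ⟨⟨0, by simp⟩, ⟨1, by simp⟩, ?_⟩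
    unfold orient at h
    by_cases h0 : b 0 = a 0
    · have h1 : b 1 - a 1 ≠ 0 := fun h1 => hab (by
        ext i; fin_cases i
        · exact h0.symm
        · show a 1 = b 1
          linarith)
      refine ⟨(c 1 - a 1) / (b 1 - a 1), ?_⟩
      have : c 0 - a 0 = 0 := by
        have : (b 1 - a 1) * (c 0 - a 0) = 0 := by rw [h0] at h; linarith
        simpa [h1] using this
      ext i; fin_cases i
      · simp [h0]; linarith
      · simp; field_simp; ring
    · have h1 : b 0 - a 0 ≠ 0 := sub_ne_zero.2 h0
      refine ⟨(c 0 - a 0) / (b 0 - a 0), ?_⟩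
      ext i; fin_cases i
      · simp; field_simp; ring
      · simp; field_simp; linarith
  rcases hcol.wbtw_or_wbtw_or_wbtw with h | h | h
  · exact key _ _ _ ha.1 hb hc.1 hab.symm hbc h
  · exact key _ _ _ hb.1 hc ha.1 hbc.symm hac.symm h
  · exact key _ _ _ hc.1 ha hb.1 hac hab h

/-- `p` lists the vertices of a convex heptagon in counterclockwise order. -/
def IsCyclicOrder (p : Fin 7 → Fin 2 → ℝ) : Prop :=
  ∀ i j k, i < j → j < k → 0 < orient (p i) (p j) (p k)

/-- Start at the vertex minimising a generic linear form and sort the others by their slope as seen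
from it. Triples through the starting vertex are then counterclockwise by construction, and the
remaining triples because no vertex lies inside a triangle. -/
theorem exists_cyclicOrder {P : Set (Fin 2 → ℝ)} (hP : Convex ℝ P)
    (h7 : (vertices P).ncard = 7) :
    ∃ p : Fin 7 → Fin 2 → ℝ, Function.Injective p ∧ Set.range p = vertices P ∧
      IsCyclicOrder p := by
  have hfin : (vertices P).Finite := Set.finite_of_ncard_ne_zero (by omega)
  have : Finite (vertices P) := hfin
  have : Fintype (vertices P) := Fintype.ofFinite _
  obtain ⟨τ, hτ⟩ := exists_generic_combination
    (fun x : vertices P × vertices P => (x.1 : Fin 2 → ℝ) 0 - (x.2 : Fin 2 → ℝ) 0)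
    (fun x : vertices P × vertices P => (x.1 : Fin 2 → ℝ) 1 - (x.2 : Fin 2 → ℝ) 1)
  set f : (Fin 2 → ℝ) → ℝ := fun x => x 0 + τ * x 1 with hf
  obtain ⟨a, ha, hmin⟩ := Set.exists_min_image (vertices P) f hfin
    (Set.nonempty_of_ncard_ne_zero (by omega))
  have hlt : ∀ b ∈ vertices P, b ≠ a → 0 < f b - f a := by
    intro b hb hba
    rcases (hmin b hb).lt_or_eq with h | h
    · linarith
    · have := hτ (⟨b, hb⟩, ⟨a, ha⟩) (by simp only [hf] at h; simp only; linarith)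
      simp only [sub_eq_zero] at this
      exact absurd (by ext i; fin_cases i; exacts [this.1, this.2]) hba
  set S := vertices P \ {a} with hS
  have hS6 : S.ncard = 6 := by
    exact Nat.succ_injective ((Set.ncard_sdiff_singleton_add_one ha hfin).trans h7)
  have hSfin : Finite S := hfin.subset Set.sdiff_subset
  have e : Fin 6 ≃ S := (Finite.equivFinOfCardEq (by rw [← hS6]; rfl)).symm
  set sl : (Fin 2 → ℝ) → ℝ := fun b => (b 1 - a 1) / (f b - f a) with hsl
  have hor : ∀ b c, b ∈ S → c ∈ S →
      orient a b c = (f b - f a) * (f c - f a) * (sl c - sl b) := by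
    intro b c hb hc
    have h1 := (hlt b hb.1 hb.2).ne'
    have h2 := (hlt c hc.1 hc.2).ne'
    simp only [hsl]
    have : (f b - f a) * (f c - f a) * ((c 1 - a 1) / (f c - f a) - (b 1 - a 1) / (f b - f a))
        = (f b - f a) * (c 1 - a 1) - (f c - f a) * (b 1 - a 1) := by
      field_simp
    rw [this]
    simp only [orient, hf]; ring
  set σ := Tuple.sort fun i => sl (e i) with hσ
  have hmono : Monotone ((fun i => sl (e i)) ∘ σ) := Tuple.monotone_sort _
  set q : Fin 6 → Fin 2 → ℝ := fun i => e (σ i) with hq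
  have hqS : ∀ i, q i ∈ S := fun i => (e (σ i)).2
  have hqinj : Function.Injective q := fun i j h =>
    σ.injective (e.injective (Subtype.ext h))
  have hpos0 : ∀ i j, i < j → 0 < orient a (q i) (q j) := by
    intro i j hij
    have hne : orient a (q i) (q j) ≠ 0 :=
      orient_ne_zero ha (hqS i).1 (hqS j).1 (fun h => (hqS i).2 h.symm)
        (fun h => (hqS j).2 h.symm) (fun h => hij.ne (hqinj h))
    have h1 := hlt _ (hqS i).1 (hqS i).2
    have h2 := hlt _ (hqS j).1 (hqS j).2
    have h3 : sl (q i) ≤ sl (q j) := hmono hij.le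
    rw [hor _ _ (hqS i) (hqS j)] at hne ⊢
    exact lt_of_le_of_ne (mul_nonneg (mul_pos h1 h2).le (by linarith)) hne.symm
  have hpos : ∀ i j k, i < j → j < k → 0 < orient (q i) (q j) (q k) := by
    intro i j k hij hjk
    by_contra hcon
    have hne : orient (q i) (q j) (q k) ≠ 0 :=
      orient_ne_zero (hqS i).1 (hqS j).1 (hqS k).1 (fun h => hij.ne (hqinj h))
        (fun h => (hij.trans hjk).ne (hqinj h)) (fun h => hjk.ne (hqinj h))
    have hneg : orient (q i) (q j) (q k) < 0 := lt_of_le_of_ne (not_lt.1 hcon) hne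
    have h1 := hpos0 i j hij
    have h2 := hpos0 j k hjk
    have h3 := hpos0 i k (hij.trans hjk)
    -- A clockwise triple would put `q j` in the interior of the triangle `a`, `q i`, `q k`; the
    -- weights are its barycentric coordinates.
    refine (hqS j).2 (Eq.symm (not_mem_extremePoints_of_triangle hP (hqS j).1 ha.1
      (hqS i).1.1 (hqS k).1.1
      (a := -orient (q i) (q j) (q k) / orient a (q i) (q k))
      (b := orient a (q j) (q k) / orient a (q i) (q k))
      (c := orient a (q i) (q j) / orient a (q i) (q k))
      (div_pos (by linarith) h3) (div_pos h2 h3) (div_pos h1 h3) ?_ ?_))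
    · rw [← add_div, ← add_div, div_eq_one_iff_eq h3.ne']
      unfold orient; ring
    · have h3' := h3.ne'
      ext l
      simp only [Pi.add_apply, Pi.smul_apply, smul_eq_mul]
      rw [div_mul_eq_mul_div, div_mul_eq_mul_div, div_mul_eq_mul_div, ← add_div, ← add_div,
        div_eq_iff h3']
      unfold orient
      fin_cases l <;> simp <;> ring
  refine ⟨Fin.cons a q, ?_, ?_, ?_⟩
  · rw [Fin.cons_injective_iff]
    refine ⟨?_, hqinj⟩
    rintro ⟨i, hi⟩
    exact (hqS i).2 hi
  · rw [Fin.range_cons]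
    ext x
    simp only [Set.mem_insert_iff, Set.mem_range]
    constructor
    · rintro (rfl | ⟨i, rfl⟩)
      · exact ha
      · exact (hqS i).1
    · intro hx
      by_cases hxa : x = a
      · exact Or.inl hxa
      · exact Or.inr ⟨σ.symm (e.symm ⟨x, hx, hxa⟩), by simp [hq]⟩
  · intro i j k hij hjk
    obtain ⟨j, rfl⟩ := Fin.exists_succ_eq.2 (Fin.ne_zero_of_lt hij)
    obtain ⟨k, rfl⟩ := Fin.exists_succ_eq.2 (Fin.ne_zero_of_lt hjk)
    rw [Fin.succ_lt_succ_iff] at hjk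
    refine Fin.cases (fun _ => ?_) (fun i hij => ?_) i hij
    · simpa using hpos0 j k hjk
    · simpa using hpos i j k (Fin.succ_lt_succ_iff.1 hij) hjk

/-! ### Polyhedra given by inequalities -/

open Filter Topology

theorem IsFacet.exists_functional {n : ℕ} {Q F : Set (Fin n → ℝ)} (hF : IsFacet Q F) :
    ∃ l : StrongDual ℝ (Fin n → ℝ), F = {x ∈ Q | ∀ y ∈ Q, l y ≤ l x} :=
  hF.2.1 hF.1

/-- A facet of a polyhedron is cut out by one of the defining inequalities. -/
theorem IsFacet.eq_inequality {n m : ℕ} {Q F : Set (Fin n → ℝ)} (s : Fin m → (Fin n → ℝ) →ᵃ[ℝ] ℝ)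
    (hQ : Q = {x | ∀ i, 0 ≤ s i x}) (hF : IsFacet Q F) :
    ∃ i, F = {x ∈ Q | s i x = 0} := by
  obtain ⟨l, hl⟩ := hF.exists_functional
  have hQc : Convex ℝ Q := by
    rw [hQ, Set.ofPred_forall]
    exact convex_iInter fun i => (convex_Ici (0 : ℝ)).affine_preimage (s i)
  have hFc : Convex ℝ F := hF.2.1.convex hQc
  have hFQ : F ⊆ Q := hF.2.1.subset
  obtain ⟨f₀, hf₀⟩ := hF.1
  have hne : ∃ q ∈ Q, q ∉ F := by
    by_contra! h
    have : F = Q := hFQ.antisymm h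
    have h3 := hF.2.2
    rw [this] at h3
    omega
  obtain ⟨q, hq, hqF⟩ := hne
  -- Otherwise averaging produces a point of `F` at which every inequality is strict or trivial on
  -- `Q`. The segment from `q` can then be prolonged past this point inside `Q`, which contradicts
  -- the maximality of `l` on `F`.
  have hex : ∃ i, (∀ x ∈ F, s i x = 0) ∧ ∃ x ∈ Q, s i x ≠ 0 := by
    by_contra! hcon
    have hind : ∀ I : Finset (Fin m), ∃ f ∈ F, ∀ i ∈ I, (∀ x ∈ Q, s i x = 0) ∨ 0 < s i f := by
      intro I
      induction I using Finset.induction_on with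
      | empty => exact ⟨f₀, hf₀, by simp⟩
      | insert i I _ ih =>
        obtain ⟨f, hf, hfI⟩ := ih
        by_cases hi : ∀ x ∈ F, s i x = 0
        · refine ⟨f, hf, fun j hj => ?_⟩
          rcases Finset.mem_insert.1 hj with rfl | hj
          · exact Or.inl (hcon j hi)
          · exact hfI j hj
        · push Not at hi
          obtain ⟨g, hg, hgi⟩ := hi
          have hnn : ∀ x ∈ F, ∀ j, 0 ≤ s j x := fun x hx j => by
            have := hFQ hx
            rw [hQ] at this
            exact this j
          have hmid : ∀ j, s j (midpoint ℝ f g) = (s j f + s j g) / 2 := fun j => by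
            rw [AffineMap.map_midpoint, midpoint_eq_smul_add, smul_eq_mul, invOf_eq_inv]; ring
          refine ⟨midpoint ℝ f g, hFc.midpoint_mem hf hg, fun j hj => ?_⟩
          rcases Finset.mem_insert.1 hj with rfl | hj
          · right
            have h1 := hnn f hf j
            have h2 := lt_of_le_of_ne (hnn g hg j) hgi.symm
            rw [hmid]; linarith
          · rcases hfI j hj with h | h
            · exact Or.inl h
            · right
              have h2 := hnn g hg j
              rw [hmid]; linarith
    obtain ⟨f, hf, hfI⟩ := hind Finset.univ
    have hev : ∀ᶠ δ in 𝓝[>] (1 : ℝ), ∀ i, 0 ≤ s i (AffineMap.lineMap q f δ) := by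
      rw [eventually_all]
      intro i
      rcases hfI i (Finset.mem_univ i) with h | h
      · refine Eventually.of_forall fun δ => ?_
        rw [AffineMap.apply_lineMap, h q hq, h f (hFQ hf)]
        simp
      · have hc : Continuous fun δ : ℝ => s i (AffineMap.lineMap q f δ) :=
          (s i).continuous_of_finiteDimensional.comp AffineMap.lineMap_continuous
        have := (hc.tendsto 1).eventually (lt_mem_nhds (a := (0 : ℝ)) (by simpa using h))
        exact (this.filter_mono nhdsWithin_le_nhds).mono fun δ h => le_of_lt h
    obtain ⟨δ, hδ, hδ1⟩ := (hev.and self_mem_nhdsWithin).exists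
    have hδ1 : 1 < δ := hδ1
    have hmem : AffineMap.lineMap q f δ ∈ Q := by rw [hQ]; exact hδ
    rw [hl] at hf hqF
    have h1 := hf.2 _ hmem
    have h2 : l (AffineMap.lineMap q f δ) = l q + δ * (l f - l q) := by
      rw [AffineMap.lineMap_apply]
      simp only [vsub_eq_sub, vadd_eq_add, map_add, map_smul, map_sub, smul_eq_mul]
      ring
    apply hqF
    refine ⟨hq, fun y hy => (hf.2 y hy).trans ?_⟩
    rw [h2] at h1
    nlinarith
  obtain ⟨i, hi0, x₁, hx₁, hx₁i⟩ := hex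
  refine ⟨i, ?_⟩
  set G := {x ∈ Q | s i x = 0} with hG
  have hFG : F ⊆ G := fun x hx => ⟨hFQ hx, hi0 x hx⟩
  have hGQ : G ⊆ Q := fun x hx => hx.1
  have hGker : vectorSpan ℝ G ≤ (s i).linear.ker := by
    rw [vectorSpan, Submodule.span_le]
    rintro _ ⟨x, hx, y, hy, rfl⟩
    simp only [SetLike.mem_coe, LinearMap.mem_ker, AffineMap.linearMap_vsub, hx.2, hy.2]
    simp
  have hlt : vectorSpan ℝ G < vectorSpan ℝ Q := by
    refine lt_of_le_of_ne (vectorSpan_mono ℝ hGQ) fun h => ?_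
    have h1 : x₁ -ᵥ f₀ ∈ vectorSpan ℝ Q := vsub_mem_vectorSpan ℝ hx₁ (hFQ hf₀)
    rw [← h] at h1
    have h2 := hGker h1
    rw [LinearMap.mem_ker, AffineMap.linearMap_vsub, hi0 f₀ hf₀] at h2
    exact hx₁i (by simpa using h2)
  have hfr := Submodule.finrank_lt_finrank_of_lt hlt
  -- `G` has smaller dimension than `Q` and contains the facet, so the two span the same directions
  -- and `l` is constant on `G`.
  have heq : vectorSpan ℝ F = vectorSpan ℝ G :=
    Submodule.eq_of_le_of_finrank_le (vectorSpan_mono ℝ hFG) (by have := hF.2.2; omega)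
  have hlker : vectorSpan ℝ F ≤ l.toLinearMap.ker := by
    rw [vectorSpan, Submodule.span_le]
    rintro _ ⟨x, hx, y, hy, rfl⟩
    rw [hl] at hx hy
    have := le_antisymm (hx.2 y hy.1) (hy.2 x hx.1)
    simp [this]
  refine hFG.antisymm fun x hx => ?_
  have h1 : x -ᵥ f₀ ∈ vectorSpan ℝ G := vsub_mem_vectorSpan ℝ hx (hFG hf₀)
  rw [← heq] at h1
  have h2 := hlker h1
  have h3 : l x = l f₀ := by
    have : l (x - f₀) = 0 := by simpa using h2
    rw [map_sub] at this; linarith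
  rw [hl] at hf₀ ⊢
  exact ⟨hx.1, fun y hy => by rw [h3]; exact hf₀.2 y hy⟩

theorem polytopeSize_le_of_inequalities {n m : ℕ} {Q : Set (Fin n → ℝ)}
    (s : Fin m → (Fin n → ℝ) →ᵃ[ℝ] ℝ) (hQ : Q = {x | ∀ i, 0 ≤ s i x}) :
    polytopeSize Q ≤ m := by
  have hsub : {F | IsFacet Q F} ⊆ (fun i => {x ∈ Q | s i x = 0}) '' (Set.univ : Set (Fin m)) := by
    intro F hF
    obtain ⟨i, hi⟩ := IsFacet.eq_inequality s hQ hF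
    exact ⟨i, trivial, hi.symm⟩
  calc polytopeSize Q ≤ _ := Set.encard_le_encard hsub
    _ ≤ (Set.univ : Set (Fin m)).encard := Set.encard_image_le _ _
    _ = m := by simp

/-- An extreme point is determined by its set of tight inequalities, so there are finitely many, and
Krein–Milman applies. -/
theorem isPolytope_of_isBounded_inequalities {n m : ℕ} {Q : Set (Fin n → ℝ)}
    (s : Fin m → (Fin n → ℝ) →ᵃ[ℝ] ℝ) (hQ : Q = {x | ∀ i, 0 ≤ s i x})
    (hb : Bornology.IsBounded Q) : IsPolytope Q := by
  have hQc : Convex ℝ Q := by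
    rw [hQ, Set.ofPred_forall]
    exact convex_iInter fun i => (convex_Ici (0 : ℝ)).affine_preimage (s i)
  have hcl : IsClosed Q := by
    rw [hQ, Set.ofPred_forall]
    exact isClosed_iInter fun i =>
      isClosed_Ici.preimage (s i).continuous_of_finiteDimensional
  have hcomp : IsCompact Q := Metric.isCompact_of_isClosed_isBounded hcl hb
  have hnn : ∀ x ∈ Q, ∀ i, 0 ≤ s i x := fun x hx => by rw [hQ] at hx; exact hx
  have hinj : Set.InjOn (fun x => {i | s i x = 0}) (Q.extremePoints ℝ) := by
    intro x hx y hy hxy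
    have hxy' : ∀ i, s i x = 0 ↔ s i y = 0 := fun i => Set.ext_iff.1 hxy i
    rw [mem_extremePoints] at hx
    -- With equal tight sets, the segment from `y` to `x` can be prolonged beyond `x` inside `Q`, so
    -- the extreme point `x` must equal `y`.
    have hev : ∀ᶠ δ in 𝓝[>] (1 : ℝ), ∀ i, 0 ≤ s i (AffineMap.lineMap y x δ) := by
      rw [eventually_all]
      intro i
      by_cases h : s i x = 0
      · refine Eventually.of_forall fun δ => ?_
        rw [AffineMap.apply_lineMap, h, (hxy' i).1 h]
        simp
      · have hc : Continuous fun δ : ℝ => s i (AffineMap.lineMap y x δ) :=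
          (s i).continuous_of_finiteDimensional.comp AffineMap.lineMap_continuous
        have := (hc.tendsto 1).eventually (lt_mem_nhds (a := (0 : ℝ))
          (by simpa using lt_of_le_of_ne (hnn x hx.1 i) (Ne.symm h)))
        exact (this.filter_mono nhdsWithin_le_nhds).mono fun δ h => le_of_lt h
    obtain ⟨δ, hδ, hδ1⟩ := (hev.and self_mem_nhdsWithin).exists
    have hδ1 : 1 < δ := hδ1
    have hmem : AffineMap.lineMap y x δ ∈ Q := by rw [hQ]; exact hδ
    refine ((hx.2 y hy.1 _ hmem ?_).1).symm
    refine ⟨1 - δ⁻¹, δ⁻¹, by simp [inv_lt_one_of_one_lt₀ hδ1], by positivity, by ring, ?_⟩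
    have : δ ≠ 0 := by positivity
    rw [AffineMap.lineMap_apply]
    ext j
    simp
    field_simp
    ring
  have hfin : (Q.extremePoints ℝ).Finite :=
    Set.Finite.of_finite_image (Set.toFinite _) hinj
  refine ⟨_, hfin, ?_⟩
  have := closure_convexHull_extremePoints hcomp hQc
  rw [(hfin.isCompact_convexHull ℝ).isClosed.closure_eq] at this
  exact this.symm

/-! ### An extension with at most six facets -/

theorem IsCyclicOrder.shift {p : Fin 7 → Fin 2 → ℝ} (hp : IsCyclicOrder p) (s : Fin 7) :
    IsCyclicOrder fun i => p (s + i) := by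
  intro i j k hij hjk
  have h : (s + i < s + j ∧ s + j < s + k) ∨ (s + j < s + k ∧ s + k < s + i) ∨
      (s + k < s + i ∧ s + i < s + j) := by
    revert s i j k; decide
  rcases h with h | h | h
  · exact hp _ _ _ h.1 h.2
  · rw [← orient_rotate]
    exact hp _ _ _ h.1 h.2
  · rw [← orient_rotate, ← orient_rotate]
    exact hp _ _ _ h.1 h.2

/-- The position of three lines through vertices that makes the truncated tetrahedron project
onto the heptagon. -/
def IsGoodOrder (q : Fin 7 → Fin 2 → ℝ) : Prop :=
  orient (q 0) (q 5) (q 6) * orient (q 2) (q 3) (q 4) ≤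
      orient (q 0) (q 2) (q 6) * orient (q 3) (q 4) (q 5) ∧
    orient (q 0) (q 1) (q 2) * orient (q 3) (q 4) (q 5) ≤
      orient (q 0) (q 1) (q 5) * orient (q 2) (q 3) (q 4)

/-- If every rotation fails, one and the same of the two inequalities fails for all rotations. The
product of these failures over the seven rotations is invariant under relabelling and contradicts a
product of three-term Plücker relations. -/
theorem exists_shift_isGoodOrder {p : Fin 7 → Fin 2 → ℝ} (hp : IsCyclicOrder p) :
    ∃ s : Fin 7, IsGoodOrder fun i => p (s + i) := by
  by_contra! hbad
  set b : Fin 7 → Fin 7 → Fin 7 → Fin 7 → ℝ :=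
    fun s i j k => orient (p (s + i)) (p (s + j)) (p (s + k)) with hb
  have pos : ∀ s i j k, i < j → j < k → 0 < b s i j k := fun s => hp.shift s
  have hbad' : ∀ s, b s 0 2 6 * b s 3 4 5 < b s 0 5 6 * b s 2 3 4 ∨
      b s 0 1 5 * b s 2 3 4 < b s 0 1 2 * b s 3 4 5 := by
    intro s
    have := hbad s
    unfold IsGoodOrder at this
    rw [not_and_or, not_le, not_le] at this
    exact this
  set X : Fin 7 → Fin 7 → Fin 7 → ℝ := fun i j k => ∏ s, b s i j k with hX
  have Xpos : ∀ i j k, i < j → j < k → 0 < X i j k := fun i j k h1 h2 =>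
    Finset.prod_pos fun s _ => pos s i j k h1 h2
  have Xrot : ∀ i j k, X j k i = X i j k := fun i j k =>
    Finset.prod_congr rfl fun s _ => orient_rotate _ _ _
  have Xshift : ∀ c i j k, X (c + i) (c + j) (c + k) = X i j k := by
    intro c i j k
    simp only [hX, hb, ← add_assoc]
    exact Fintype.prod_equiv (Equiv.addRight c) _ _ fun s => rfl
  have x234 : X 2 3 4 = X 0 1 2 := Xshift 2 0 1 2
  have x345 : X 3 4 5 = X 0 1 2 := Xshift 3 0 1 2
  have x056 : X 0 5 6 = X 0 1 2 := by rw [← Xrot, ← Xshift 5 0 1 2]; rfl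
  have x024 : X 0 2 5 = X 0 2 4 := by rw [← Xrot, ← Xshift 5 0 2 4, ← Xrot]; rfl
  have x035 : X 0 3 5 = X 0 2 5 := (Xrot 5 0 3).trans (Xshift 5 0 2 5)
  have x046 : X 0 4 6 = X 0 1 5 := by rw [← Xrot, ← Xshift 6 0 1 5, ← Xrot]; rfl
  have x026 : X 0 2 6 = X 0 1 3 := by rw [← Xrot, ← Xshift 6 0 1 3, ← Xrot]; rfl
  have p012 := Xpos 0 1 2 (by decide) (by decide)
  have p024 := Xpos 0 2 4 (by decide) (by decide)
  by_cases hA : ∃ s, b s 0 1 5 * b s 2 3 4 < b s 0 1 2 * b s 3 4 5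
  -- Failure of the second inequality at `s` and of the first at `s + 4` contradict the Plücker
  -- relations `q1` and `q2`, so failure of the second propagates.
  · have step : ∀ s, b s 0 1 5 * b s 2 3 4 < b s 0 1 2 * b s 3 4 5 →
        b (s + 4) 0 1 5 * b (s + 4) 2 3 4 < b (s + 4) 0 1 2 * b (s + 4) 3 4 5 := by
      intro s hs
      refine (hbad' (s + 4)).resolve_left fun h => ?_
      have e1 : b (s + 4) 0 2 6 = b s 3 4 6 := by
        simp only [hb, add_assoc]; exact orient_rotate (p (s + 3)) (p (s + 4)) (p (s + 6))
      have e2 : b (s + 4) 3 4 5 = b s 0 1 2 := by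
        simp only [hb, add_assoc]; rfl
      have e3 : b (s + 4) 0 5 6 = b s 2 3 4 := by
        simp only [hb, add_assoc]; rw [← orient_rotate]; rfl
      have e4 : b (s + 4) 2 3 4 = b s 0 1 6 := by
        simp only [hb, add_assoc]; rw [← orient_rotate]; rfl
      rw [e1, e2, e3, e4] at h
      have q1 : b s 0 4 5 * b s 3 4 6 = b s 4 5 6 * b s 0 3 4 + b s 3 4 5 * b s 0 4 6 := by
        simp only [hb, orient]; ring
      have q2 : b s 0 1 5 * b s 0 4 6 = b s 0 1 4 * b s 0 5 6 + b s 0 1 6 * b s 0 4 5 := by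
        simp only [hb, orient]; ring
      have h012 := pos s 0 1 2 (by decide) (by decide)
      have h234 := pos s 2 3 4 (by decide) (by decide)
      have h345 := pos s 3 4 5 (by decide) (by decide)
      have h016 := pos s 0 1 6 (by decide) (by decide)
      have h015 := pos s 0 1 5 (by decide) (by decide)
      have h045 := pos s 0 4 5 (by decide) (by decide)
      have h046 := pos s 0 4 6 (by decide) (by decide)
      have h346 := pos s 3 4 6 (by decide) (by decide)
      have r1 : b s 3 4 5 * b s 0 4 6 < b s 0 4 5 * b s 3 4 6 := by
        rw [q1]
        linarith [mul_pos (pos s 4 5 6 (by decide) (by decide))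
          (pos s 0 3 4 (by decide) (by decide))]
      have r2 : b s 0 1 6 * b s 0 4 5 < b s 0 1 5 * b s 0 4 6 := by
        rw [q2]
        linarith [mul_pos (pos s 0 1 4 (by decide) (by decide))
          (pos s 0 5 6 (by decide) (by decide))]
      have m1 := mul_lt_mul'' r1 r2 (by positivity) (by positivity)
      have m2 := mul_lt_mul'' h hs (by positivity) (by positivity)
      have m1' : b s 3 4 5 * b s 0 1 6 < b s 3 4 6 * b s 0 1 5 :=
        lt_of_mul_lt_mul_right (a := b s 0 4 6 * b s 0 4 5) (by linarith) (by positivity)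
      have m2' : b s 3 4 6 * b s 0 1 5 < b s 3 4 5 * b s 0 1 6 :=
        lt_of_mul_lt_mul_right (a := b s 0 1 2 * b s 2 3 4) (by linarith) (by positivity)
      linarith
    obtain ⟨s₀, hs₀⟩ := hA
    -- Steps of length four reach every rotation, since `2 * 4 = 1` modulo seven.
    have hmod : ∀ s s₁ : Fin 7, s = s₁ + ((s - s₁) * 2).val • 4 := by decide
    have hn : ∀ n : ℕ, ∀ s, s = s₀ + n • 4 →
        b s 0 1 5 * b s 2 3 4 < b s 0 1 2 * b s 3 4 5 := by
      intro n
      induction n with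
      | zero => rintro s rfl; simpa using hs₀
      | succ n ih =>
        rintro s rfl
        rw [succ_nsmul, ← add_assoc]
        exact step _ (ih _ rfl)
    have hall : ∀ s, b s 0 1 5 * b s 2 3 4 < b s 0 1 2 * b s 3 4 5 := fun s =>
      hn ((s - s₀) * 2).val s (hmod s s₀)
    have h1 : X 0 1 5 * X 2 3 4 < X 0 1 2 * X 3 4 5 := by
      simp only [hX, ← Finset.prod_mul_distrib]
      exact Finset.prod_lt_prod_of_nonempty
        (fun s _ => mul_pos (pos s _ _ _ (by decide) (by decide))
          (pos s _ _ _ (by decide) (by decide))) (fun s _ => hall s) Finset.univ_nonempty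
    have h2 : X 0 5 6 * X 0 2 4 < X 0 4 6 * X 0 2 5 := by
      simp only [hX, ← Finset.prod_mul_distrib]
      refine Finset.prod_lt_prod_of_nonempty
        (fun s _ => mul_pos (pos s _ _ _ (by decide) (by decide))
          (pos s _ _ _ (by decide) (by decide))) (fun s _ => ?_) Finset.univ_nonempty
      have : b s 0 4 6 * b s 0 2 5 = b s 0 5 6 * b s 0 2 4 + b s 0 2 6 * b s 0 4 5 := by
        simp only [hb, orient]; ring
      rw [this]
      linarith [mul_pos (pos s 0 2 6 (by decide) (by decide))
          (pos s 0 4 5 (by decide) (by decide))]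
    rw [x234, x345] at h1
    rw [x056, x046, x024] at h2
    have := lt_of_mul_lt_mul_right h1 p012.le
    have := lt_of_mul_lt_mul_right h2 p024.le
    linarith
  · push Not at hA
    have hall : ∀ s, b s 0 2 6 * b s 3 4 5 < b s 0 5 6 * b s 2 3 4 := fun s =>
      (hbad' s).resolve_right (not_lt.2 (hA s))
    have h1 : X 0 2 6 * X 3 4 5 < X 0 5 6 * X 2 3 4 := by
      simp only [hX, ← Finset.prod_mul_distrib]
      exact Finset.prod_lt_prod_of_nonempty
        (fun s _ => mul_pos (pos s _ _ _ (by decide) (by decide))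
          (pos s _ _ _ (by decide) (by decide))) (fun s _ => hall s) Finset.univ_nonempty
    have h2 : X 0 1 2 * X 0 3 5 < X 0 1 3 * X 0 2 5 := by
      simp only [hX, ← Finset.prod_mul_distrib]
      refine Finset.prod_lt_prod_of_nonempty
        (fun s _ => mul_pos (pos s _ _ _ (by decide) (by decide))
          (pos s _ _ _ (by decide) (by decide))) (fun s _ => ?_) Finset.univ_nonempty
      have : b s 0 1 3 * b s 0 2 5 = b s 0 1 2 * b s 0 3 5 + b s 0 1 5 * b s 0 2 3 := by
        simp only [hb, orient]; ring
      rw [this]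
      linarith [mul_pos (pos s 0 1 5 (by decide) (by decide))
          (pos s 0 2 3 (by decide) (by decide))]
    rw [x234, x345, x026, x056] at h1
    rw [x035, x024] at h2
    have := lt_of_mul_lt_mul_right h1 p012.le
    have := lt_of_mul_lt_mul_right h2 p024.le
    linarith

theorem mem_convexHull_triangle {a b c x : Fin 2 → ℝ} (h : 0 < orient a b c)
    (h1 : 0 ≤ orient a b x) (h2 : 0 ≤ orient b c x) (h3 : 0 ≤ orient c a x) {S : Set (Fin 2 → ℝ)}
    (ha : a ∈ S) (hb : b ∈ S) (hc : c ∈ S) : x ∈ convexHull ℝ S := by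
  have hS := convex_convexHull ℝ S
  have key := hS.sum_mem (t := Finset.univ)
    (w := ![orient b c x / orient a b c, orient c a x / orient a b c, orient a b x / orient a b c])
    (z := ![a, b, c]) (by
      intro i _
      fin_cases i
      exacts [div_nonneg h2 h.le, div_nonneg h3 h.le, div_nonneg h1 h.le]) (by
      simp only [Fin.sum_univ_three]
      simp only [Matrix.cons_val_zero, Matrix.cons_val_one, Matrix.cons_val]
      rw [← add_div, ← add_div, div_eq_one_iff_eq h.ne']
      unfold orient; ring) (by
      intro i _
      fin_cases i
      exacts [subset_convexHull ℝ S ha, subset_convexHull ℝ S hb, subset_convexHull ℝ S hc])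
  convert key using 1
  simp only [Fin.sum_univ_three, Matrix.cons_val_zero, Matrix.cons_val_one, Matrix.cons_val]
  ext l
  simp only [Pi.add_apply, Pi.smul_apply, smul_eq_mul]
  rw [div_mul_eq_mul_div, div_mul_eq_mul_div, div_mul_eq_mul_div, ← add_div, ← add_div,
    eq_div_iff h.ne']
  unfold orient
  fin_cases l <;> simp <;> ring

/-- Triangulate the heptagon by the diagonals from `p 0`; the point lies in the triangle at which
its side of the diagonal changes. -/
theorem IsCyclicOrder.mem_convexHull {p : Fin 7 → Fin 2 → ℝ} (hp : IsCyclicOrder p)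
    {x : Fin 2 → ℝ} (hx : ∀ i, 0 ≤ orient (p i) (p (i + 1)) x) :
    x ∈ convexHull ℝ (Set.range p) := by
  have tri : ∀ i : Fin 7, 0 < i → i < i + 1 → 0 ≤ orient (p 0) (p i) x →
      orient (p 0) (p (i + 1)) x ≤ 0 → x ∈ convexHull ℝ (Set.range p) := by
    intro i h0 h1 h2 h3
    refine mem_convexHull_triangle (hp 0 i (i + 1) h0 h1) h2 (hx i) ?_
      (Set.mem_range_self _) (Set.mem_range_self _) (Set.mem_range_self _)
    have : orient (p (i + 1)) (p 0) x = -orient (p 0) (p (i + 1)) x := by unfold orient; ring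
    linarith
  have h1 := hx 0
  have h6 : orient (p 0) (p 6) x ≤ 0 := by
    have h := hx 6
    have : orient (p 6) (p (6 + 1)) x = -orient (p 0) (p 6) x := by
      show orient (p 6) (p 0) x = _
      unfold orient; ring
    linarith
  by_cases h2 : orient (p 0) (p 2) x ≤ 0
  · exact tri 1 (by decide) (by decide) h1 h2
  by_cases h3 : orient (p 0) (p 3) x ≤ 0
  · exact tri 2 (by decide) (by decide) (not_le.1 h2).le h3
  by_cases h4 : orient (p 0) (p 4) x ≤ 0
  · exact tri 3 (by decide) (by decide) (not_le.1 h3).le h4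
  by_cases h5 : orient (p 0) (p 5) x ≤ 0
  · exact tri 4 (by decide) (by decide) (not_le.1 h4).le h5
  · exact tri 5 (by decide) (by decide) (not_le.1 h5).le h6

/-- The affine form `orient a b · + c h` on `ℝ² × ℝ`. -/
noncomputable def liftedForm (a b : Fin 2 → ℝ) (c : ℝ) : (Fin (2 + 1) → ℝ) →ᵃ[ℝ] ℝ :=
  ((b 0 - a 0) • LinearMap.proj (R := ℝ) (φ := fun _ : Fin (2 + 1) => ℝ) 1 -
    (b 1 - a 1) • LinearMap.proj (R := ℝ) (φ := fun _ : Fin (2 + 1) => ℝ) 0 +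
    c • LinearMap.proj (R := ℝ) (φ := fun _ : Fin (2 + 1) => ℝ) 2).toAffineMap +
  AffineMap.const ℝ _ ((b 1 - a 1) * a 0 - (b 0 - a 0) * a 1)

theorem liftedForm_apply (a b : Fin 2 → ℝ) (c : ℝ) (x : Fin (2 + 1) → ℝ) :
    liftedForm a b c x = orient a b (firstCoords 2 1 x) + c * x 2 := by
  simp only [liftedForm, orient, firstCoords, AffineMap.coe_add, Pi.add_apply,
    LinearMap.coe_toAffineMap, LinearMap.add_apply, LinearMap.sub_apply, LinearMap.smul_apply,
    LinearMap.proj_apply, smul_eq_mul, AffineMap.const_apply]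
  have e0 : (Fin.castAdd 1 (0 : Fin 2)) = (0 : Fin (2 + 1)) := rfl
  have e1 : (Fin.castAdd 1 (1 : Fin 2)) = (1 : Fin (2 + 1)) := rfl
  rw [e0, e1]
  ring

/-- The vertices 0, 1, 3, 4, 6 stay at height zero, while 2 and 5 are raised onto the plane over the
edge from 3 to 4. All incidences and inequalities for these lifts are automatic except two, and
those two are `IsGoodOrder`. -/
theorem exists_extension_of_isGoodOrder {q : Fin 7 → Fin 2 → ℝ} (hq : IsCyclicOrder q)
    (hg : IsGoodOrder q) :
    ∃ R : Set (Fin (2 + 1) → ℝ), IsExtension R (convexHull ℝ (Set.range q)) ∧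
      polytopeSize R ≤ 6 := by
  obtain ⟨g1, g2⟩ := hg
  have pos : ∀ i j k : Fin 7, i < j → j < k → 0 < orient (q i) (q j) (q k) := hq
  have d234 := pos 2 3 4 (by decide) (by decide)
  have d345 := pos 3 4 5 (by decide) (by decide)
  have d012 := pos 0 1 2 (by decide) (by decide)
  have d056 := pos 0 5 6 (by decide) (by decide)
  have d123 := pos 1 2 3 (by decide) (by decide)
  have d456 := pos 4 5 6 (by decide) (by decide)
  -- The constants `c3` and `c5` make the planes over `q 0 q 1` and `q 1 q 3` pass through the lift
  -- of `q 2`; `c4` and `c6` do the same for `q 5` with `q 6 q 0` and `q 4 q 6`.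
  set c3 := orient (q 0) (q 1) (q 2) / orient (q 2) (q 3) (q 4) with hc3
  set c4 := orient (q 0) (q 5) (q 6) / orient (q 3) (q 4) (q 5) with hc4
  set c5 := orient (q 1) (q 2) (q 3) / orient (q 2) (q 3) (q 4) with hc5
  set c6 := orient (q 4) (q 5) (q 6) / orient (q 3) (q 4) (q 5) with hc6
  have c3e : c3 * orient (q 2) (q 3) (q 4) = orient (q 0) (q 1) (q 2) := by
    rw [hc3]; field_simp
  have c4e : c4 * orient (q 3) (q 4) (q 5) = orient (q 0) (q 5) (q 6) := by
    rw [hc4]; field_simp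
  have c5e : c5 * orient (q 2) (q 3) (q 4) = orient (q 1) (q 2) (q 3) := by
    rw [hc5]; field_simp
  have c6e : c6 * orient (q 3) (q 4) (q 5) = orient (q 4) (q 5) (q 6) := by
    rw [hc6]; field_simp
  have c3p : 0 < c3 := div_pos d012 d234
  have c4p : 0 < c4 := div_pos d056 d345
  have c5p : 0 < c5 := div_pos d123 d234
  have c6p : 0 < c6 := div_pos d456 d345
  have k1 : c4 * orient (q 2) (q 3) (q 4) ≤ orient (q 0) (q 2) (q 6) := by
    rw [hc4, div_mul_eq_mul_div, div_le_iff₀ d345]; exact g1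
  have k2 : c3 * orient (q 3) (q 4) (q 5) ≤ orient (q 0) (q 1) (q 5) := by
    rw [hc3, div_mul_eq_mul_div, div_le_iff₀ d234]; exact g2
  set s : Fin 6 → (Fin (2 + 1) → ℝ) →ᵃ[ℝ] ℝ :=
    -- The repeated point makes the first form the height itself.
    ![liftedForm (q 0) (q 0) 1, liftedForm (q 3) (q 4) (-1), liftedForm (q 0) (q 1) (-c3),
      liftedForm (q 6) (q 0) (-c4), liftedForm (q 1) (q 3) c5, liftedForm (q 4) (q 6) c6] with hs
  set R : Set (Fin (2 + 1) → ℝ) := {x | ∀ i, 0 ≤ s i x} with hR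
  have memR : ∀ x, x ∈ R ↔ 0 ≤ x 2 ∧
      0 ≤ orient (q 3) (q 4) (firstCoords 2 1 x) - x 2 ∧
      0 ≤ orient (q 0) (q 1) (firstCoords 2 1 x) - c3 * x 2 ∧
      0 ≤ orient (q 6) (q 0) (firstCoords 2 1 x) - c4 * x 2 ∧
      0 ≤ orient (q 1) (q 3) (firstCoords 2 1 x) + c5 * x 2 ∧
      0 ≤ orient (q 4) (q 6) (firstCoords 2 1 x) + c6 * x 2 := by
    intro x
    have e0 : orient (q 0) (q 0) (firstCoords 2 1 x) = 0 := by unfold orient; ring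
    simp only [hR, Set.mem_ofPred_eq, hs, Fin.forall_fin_succ, Matrix.cons_val_zero,
      Matrix.cons_val_succ, liftedForm_apply, e0, zero_add, one_mul, neg_mul, IsEmpty.forall_iff,
      and_true, ← sub_eq_add_neg]
  have hsub : firstCoords 2 1 '' R ⊆ convexHull ℝ (Set.range q) := by
    rintro _ ⟨x, hx, rfl⟩
    rw [memR] at hx
    obtain ⟨t1, t2, t3, t4, t5, t6⟩ := hx
    set y := firstCoords 2 1 x
    set h := x 2
    apply hq.mem_convexHull
    -- Each of the four edges at `q 2` and `q 5` is a positive combination of two side planes in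
    -- which the height cancels.
    have id12 : orient (q 0) (q 1) (q 3) * orient (q 1) (q 2) y =
        orient (q 1) (q 2) (q 3) * orient (q 0) (q 1) y +
        orient (q 0) (q 1) (q 2) * orient (q 1) (q 3) y := by unfold orient; ring
    have id23 : orient (q 1) (q 3) (q 4) * orient (q 2) (q 3) y =
        orient (q 1) (q 2) (q 3) * orient (q 3) (q 4) y +
        orient (q 2) (q 3) (q 4) * orient (q 1) (q 3) y := by unfold orient; ring
    have id45 : orient (q 3) (q 4) (q 6) * orient (q 4) (q 5) y =
        orient (q 4) (q 5) (q 6) * orient (q 3) (q 4) y +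
        orient (q 3) (q 4) (q 5) * orient (q 4) (q 6) y := by unfold orient; ring
    have id56 : orient (q 0) (q 4) (q 6) * orient (q 5) (q 6) y =
        orient (q 4) (q 5) (q 6) * orient (q 6) (q 0) y +
        orient (q 0) (q 5) (q 6) * orient (q 4) (q 6) y := by unfold orient; ring
    intro i
    fin_cases i
    · show 0 ≤ orient (q 0) (q 1) y
      have := mul_nonneg c3p.le t1
      linarith
    · show 0 ≤ orient (q 1) (q 2) y
      refine nonneg_of_mul_nonneg_right ?_ (pos 0 1 3 (by decide) (by decide))
      rw [id12, ← c5e, ← c3e]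
      have := add_nonneg (mul_nonneg (mul_nonneg c5p.le d234.le) t3)
        (mul_nonneg (mul_nonneg c3p.le d234.le) t5)
      linarith
    · show 0 ≤ orient (q 2) (q 3) y
      refine nonneg_of_mul_nonneg_right ?_ (pos 1 3 4 (by decide) (by decide))
      rw [id23, ← c5e]
      have := add_nonneg (mul_nonneg (mul_nonneg c5p.le d234.le) t2)
        (mul_nonneg d234.le t5)
      linarith
    · show 0 ≤ orient (q 3) (q 4) y
      linarith
    · show 0 ≤ orient (q 4) (q 5) y
      refine nonneg_of_mul_nonneg_right ?_ (pos 3 4 6 (by decide) (by decide))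
      rw [id45, ← c6e]
      have := add_nonneg (mul_nonneg (mul_nonneg c6p.le d345.le) t2)
        (mul_nonneg d345.le t6)
      linarith
    · show 0 ≤ orient (q 5) (q 6) y
      refine nonneg_of_mul_nonneg_right ?_ (pos 0 4 6 (by decide) (by decide))
      rw [id56, ← c6e, ← c4e]
      have := add_nonneg (mul_nonneg (mul_nonneg c6p.le d345.le) t4)
        (mul_nonneg (mul_nonneg c4p.le d345.le) t6)
      linarith
    · show 0 ≤ orient (q 6) (q 0) y
      have := mul_nonneg c4p.le t1
      linarith
  have hRc : Convex ℝ R := by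
    rw [hR, Set.ofPred_forall]
    exact convex_iInter fun i => (convex_Ici (0 : ℝ)).affine_preimage (s i)
  have lin : IsLinearMap ℝ (firstCoords 2 1) := ⟨fun _ _ => rfl, fun _ _ => rfl⟩
  have lift : ∀ i (h : ℝ), ![q i 0, q i 1, h] ∈ R → q i ∈ firstCoords 2 1 '' R := by
    intro i h hi
    refine ⟨_, hi, ?_⟩
    ext l; fin_cases l <;> rfl
  have fc : ∀ i (h : ℝ), firstCoords 2 1 ![q i 0, q i 1, h] = q i := by
    intro i h
    ext l; fin_cases l <;> rfl
  have h2 : ∀ i (h : ℝ), (![q i 0, q i 1, h] : Fin (2 + 1) → ℝ) 2 = h := fun i h => rfl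
  have z1 : ∀ a b : Fin 2 → ℝ, orient a b a = 0 := fun a b => by unfold orient; ring
  have z2 : ∀ a b : Fin 2 → ℝ, orient a b b = 0 := fun a b => by unfold orient; ring
  have r : ∀ i j k : Fin 7, i < j → j < k → 0 < orient (q j) (q k) (q i) := fun i j k h h' => by
    rw [orient_rotate]; exact pos i j k h h'
  have r' : ∀ i j k : Fin 7, i < j → j < k → 0 < orient (q k) (q i) (q j) := fun i j k h h' => by
    rw [← orient_rotate]; exact pos i j k h h'
  have hsup : convexHull ℝ (Set.range q) ⊆ firstCoords 2 1 '' R := by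
    refine convexHull_min ?_ (hRc.is_linear_image lin)
    rintro _ ⟨i, rfl⟩
    fin_cases i
    · refine lift 0 0 ?_
      rw [memR, fc, h2]
      simp only [z1, z2, mul_zero, sub_zero, add_zero, le_refl, true_and]
      exact ⟨(r 0 3 4 (by decide) (by decide)).le, (r 0 1 3 (by decide) (by decide)).le,
        (r 0 4 6 (by decide) (by decide)).le⟩
    · refine lift 1 0 ?_
      rw [memR, fc, h2]
      simp only [z1, z2, mul_zero, sub_zero, add_zero, le_refl, true_and]
      exact ⟨(r 1 3 4 (by decide) (by decide)).le, (r' 0 1 6 (by decide) (by decide)).le,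
        (r 1 4 6 (by decide) (by decide)).le⟩
    · refine lift 2 (orient (q 2) (q 3) (q 4)) ?_
      rw [memR, fc, h2, c3e, c5e]
      have e1 : orient (q 3) (q 4) (q 2) = orient (q 2) (q 3) (q 4) := orient_rotate _ _ _
      have e2 : orient (q 1) (q 3) (q 2) = - orient (q 1) (q 2) (q 3) := orient_swap _ _ _
      have e3 : orient (q 6) (q 0) (q 2) = orient (q 0) (q 2) (q 6) := (orient_rotate _ _ _).symm
      have := r 2 4 6 (by decide) (by decide)
      have := mul_pos c6p d234
      refine ⟨d234.le, ?_, ?_, ?_, ?_, ?_⟩ <;> linarith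
    · refine lift 3 0 ?_
      rw [memR, fc, h2]
      simp only [z1, z2, mul_zero, sub_zero, add_zero, le_refl, true_and]
      exact ⟨(pos 0 1 3 (by decide) (by decide)).le, (r' 0 3 6 (by decide) (by decide)).le,
        (r 3 4 6 (by decide) (by decide)).le⟩
    · refine lift 4 0 ?_
      rw [memR, fc, h2]
      simp only [z1, z2, mul_zero, sub_zero, add_zero, le_refl, true_and, and_true]
      exact ⟨(pos 0 1 4 (by decide) (by decide)).le, (r' 0 4 6 (by decide) (by decide)).le,
        (pos 1 3 4 (by decide) (by decide)).le⟩
    · refine lift 5 (orient (q 3) (q 4) (q 5)) ?_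
      rw [memR, fc, h2, c4e, c6e]
      have e2 : orient (q 4) (q 6) (q 5) = - orient (q 4) (q 5) (q 6) := orient_swap _ _ _
      have e3 : orient (q 6) (q 0) (q 5) = orient (q 0) (q 5) (q 6) := (orient_rotate _ _ _).symm
      have := pos 1 3 5 (by decide) (by decide)
      have := mul_pos c5p d345
      refine ⟨d345.le, ?_, ?_, ?_, ?_, ?_⟩ <;> linarith
    · refine lift 6 0 ?_
      rw [memR, fc, h2]
      simp only [z1, z2, mul_zero, sub_zero, add_zero, le_refl, true_and, and_true]
      exact ⟨(pos 3 4 6 (by decide) (by decide)).le, (pos 0 1 6 (by decide) (by decide)).le,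
        (pos 1 3 6 (by decide) (by decide)).le⟩
  have himg := hsub.antisymm hsup
  -- The projection is bounded, and the height is at most `orient (q 3) (q 4)` of the projected
  -- point.
  have hbdd : Bornology.IsBounded R := by
    have hc : IsCompact (convexHull ℝ (Set.range q)) := (Set.finite_range q).isCompact_convexHull ℝ
    obtain ⟨C, hC⟩ := hc.isBounded.exists_norm_le
    have hcont : Continuous fun y : Fin 2 → ℝ => orient (q 3) (q 4) y := by
      unfold orient; fun_prop
    obtain ⟨D, hD⟩ := (hc.image hcont).isBounded.exists_norm_le
    refine isBounded_iff_forall_norm_le.2 ⟨max C D, fun x hx => ?_⟩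
    have hy : firstCoords 2 1 x ∈ convexHull ℝ (Set.range q) := hsub ⟨x, hx, rfl⟩
    have h1 := hC _ hy
    have h2 := hD _ ⟨_, hy, rfl⟩
    rw [memR] at hx
    rw [pi_norm_le_iff_of_nonneg ((norm_nonneg _).trans (h1.trans (le_max_left _ _)))]
    have h0 : ∀ l : Fin 2, ‖x (Fin.castAdd 1 l)‖ ≤ C := fun l =>
      (norm_le_pi_norm (firstCoords 2 1 x) l).trans h1
    intro i
    fin_cases i
    · exact (h0 0).trans (le_max_left _ _)
    · exact (h0 1).trans (le_max_left _ _)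
    · refine le_trans ?_ (le_max_right _ _)
      show ‖x 2‖ ≤ D
      rw [Real.norm_of_nonneg hx.1]
      have := (le_abs_self _).trans h2
      linarith [hx.2.1]
  exact ⟨R, ⟨isPolytope_of_isBounded_inequalities s rfl hbdd, himg⟩,
    polytopeSize_le_of_inequalities s rfl⟩

/-! ### Facets separate a polytope from the other points of its affine hull -/

theorem convexHull_vertices {n : ℕ} {P : Set (Fin n → ℝ)} (hP : IsPolytope P) :
    convexHull ℝ (vertices P) = P := by
  obtain ⟨S, hS, rfl⟩ := hP
  have hfin : (vertices (convexHull ℝ S)).Finite := hS.subset extremePoints_convexHull_subset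
  have := closure_convexHull_extremePoints (hS.isCompact_convexHull ℝ) (convex_convexHull ℝ S)
  rwa [show Set.extremePoints ℝ (convexHull ℝ S) = vertices (convexHull ℝ S) from rfl,
    (hfin.isCompact_convexHull ℝ).isClosed.closure_eq] at this

theorem IsPolytope.convex {n : ℕ} {P : Set (Fin n → ℝ)} (hP : IsPolytope P) : Convex ℝ P := by
  obtain ⟨S, -, rfl⟩ := hP
  exact convex_convexHull ℝ S

theorem exists_extension_size_le_six {P : Set (Fin 2 → ℝ)} (hP : IsConvexHeptagon P) :
    ∃ R : Set (Fin (2 + 1) → ℝ), IsExtension R P ∧ polytopeSize R ≤ 6 := by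
  obtain ⟨p, -, hp, hcyc⟩ := exists_cyclicOrder hP.1.convex hP.2
  obtain ⟨s, hs⟩ := exists_shift_isGoodOrder hcyc
  have hrange : Set.range (fun i => p (s + i)) = vertices P := by
    rw [← hp]
    exact (Equiv.addLeft s).surjective.range_comp p
  have := exists_extension_of_isGoodOrder (hcyc.shift s) hs
  rwa [hrange, convexHull_vertices hP.1] at this

/-- Start from a supporting hyperplane separating `x` and rotate it about the span of its contact
set and `x` until it meets a new point of `V`. Each rotation raises the dimension of the contact set
and keeps `x` strictly cut off. -/
theorem exists_functional_of_finrank_lt {n : ℕ} {V : Set (Fin n → ℝ)} (hV : V.Finite)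
    {x : Fin n → ℝ} (hxQ : x ∉ convexHull ℝ V) (hne : V.Nonempty) (k : ℕ)
    (hk : k < Module.finrank ℝ (vectorSpan ℝ V)) :
    ∃ (f : (Fin n → ℝ) →ₗ[ℝ] ℝ) (b : ℝ), (∀ v ∈ V, f v ≤ b) ∧ b < f x ∧
      {v ∈ V | f v = b}.Nonempty ∧ k ≤ Module.finrank ℝ (vectorSpan ℝ {v ∈ V | f v = b}) := by
  induction k with
  | zero =>
    obtain ⟨f, u, hu, hfx⟩ := geometric_hahn_banach_closed_point (convex_convexHull ℝ V)
      (hV.isCompact_convexHull ℝ).isClosed hxQ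
    obtain ⟨v, hv, hmax⟩ := Set.exists_max_image V f hV hne
    exact ⟨f.toLinearMap, f v, hmax, (hu v (subset_convexHull ℝ V hv)).trans hfx, ⟨v, hv, rfl⟩,
      Nat.zero_le _⟩
  | succ k ih =>
    obtain ⟨f, b, hfb, hfx, ⟨t, ht⟩, hrank⟩ := ih (by omega)
    set T := {v ∈ V | f v = b} with hT
    by_cases hlt : k + 1 ≤ Module.finrank ℝ (vectorSpan ℝ T)
    · exact ⟨f, b, hfb, hfx, ⟨t, ht⟩, hlt⟩
    set S := vectorSpan ℝ T ⊔ Submodule.span ℝ {x - t} with hS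
    have hSle : Module.finrank ℝ S ≤ k + 1 := by
      refine (Submodule.finrank_add_le_finrank_add_finrank _ _).trans ?_
      have : Module.finrank ℝ (Submodule.span ℝ {x - t}) ≤ 1 := by
        simpa using finrank_span_le_card (R := ℝ) ({x - t} : Set (Fin n → ℝ))
      omega
    obtain ⟨u, huV, huS⟩ : ∃ u ∈ vectorSpan ℝ V, u ∉ S := by
      by_contra! h
      have := Submodule.finrank_mono (R := ℝ) (s := vectorSpan ℝ V) (t := S) h
      omega
    obtain ⟨g, hgu, hgS⟩ := Submodule.exists_dual_map_eq_bot_of_notMem huS inferInstance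
    have hgS' : ∀ y ∈ S, g y = 0 := fun y hy => by
      have : g y ∈ Submodule.map g S := ⟨y, hy, rfl⟩
      rwa [hgS, Submodule.mem_bot] at this
    have hgx : g (x - t) = 0 :=
      hgS' _ (Submodule.mem_sup_right (Submodule.mem_span_singleton_self _))
    have hgT : ∀ v ∈ T, g (v - t) = 0 := fun v hv =>
      hgS' _ (Submodule.mem_sup_left (vsub_mem_vectorSpan ℝ hv ht))
    obtain ⟨v₀, hv₀, hgv₀⟩ : ∃ v ∈ V, g (v - t) ≠ 0 := by
      by_contra! h
      apply hgu
      have : vectorSpan ℝ V ≤ LinearMap.ker g := by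
        rw [vectorSpan_eq_span_vsub_set_right ℝ ht.1, Submodule.span_le]
        rintro _ ⟨v, hv, rfl⟩
        exact h v hv
      exact this huV
    have main : ∀ g : (Fin n → ℝ) →ₗ[ℝ] ℝ, g (x - t) = 0 → (∀ v ∈ T, g (v - t) = 0) →
        0 < g (v₀ - t) → ∃ (f : (Fin n → ℝ) →ₗ[ℝ] ℝ) (b : ℝ), (∀ v ∈ V, f v ≤ b) ∧ b < f x ∧
      {v ∈ V | f v = b}.Nonempty ∧
        k + 1 ≤ Module.finrank ℝ (vectorSpan ℝ {v ∈ V | f v = b}) := by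
      intro g hgx hgT hpos
      -- The smallest ratio is the first moment at which the rotating hyperplane meets a point of
      -- `V` with `g` positive, so no point has crossed it.
      obtain ⟨w, ⟨hw, hgw⟩, hmin⟩ := Set.exists_min_image {v ∈ V | 0 < g (v - t)}
        (fun v => (b - f v) / g (v - t)) (hV.subset fun v hv => hv.1) ⟨v₀, hv₀, hpos⟩
      set τ := (b - f w) / g (w - t) with hτ
      have hτ0 : 0 ≤ τ := div_nonneg (by linarith [hfb w hw]) hgw.le
      have hval : ∀ y, (f + τ • g) y - (b + τ * g t) = f y - b + τ * g (y - t) := fun y => by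
        simp only [LinearMap.add_apply, LinearMap.smul_apply, smul_eq_mul, map_sub]; ring
      have hTsub : insert w T ⊆ {v ∈ V | (f + τ • g) v = b + τ * g t} := by
        intro v hv
        rcases hv with rfl | hv
        · refine ⟨hw, sub_eq_zero.1 ?_⟩
          rw [hval, hτ]
          field_simp
          ring
        · refine ⟨hv.1, sub_eq_zero.1 ?_⟩
          rw [hval, hgT v hv, hv.2]
          ring
      refine ⟨f + τ • g, b + τ * g t, fun v hv => ?_, ?_, ⟨w, hTsub (Set.mem_insert _ _)⟩, ?_⟩
      · rw [← sub_nonpos, hval]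
        by_cases hgv : 0 < g (v - t)
        · have := hmin v ⟨hv, hgv⟩
          rw [le_div_iff₀ hgv] at this
          linarith
        · have := mul_nonpos_of_nonneg_of_nonpos hτ0 (not_lt.1 hgv)
          linarith [hfb v hv]
      · rw [← sub_pos, hval, hgx]
        linarith
      · have hlt : vectorSpan ℝ T < vectorSpan ℝ {v ∈ V | (f + τ • g) v = b + τ * g t} := by
          refine lt_of_le_of_ne
            (vectorSpan_mono ℝ ((Set.subset_insert w T).trans hTsub)) fun h => ?_
          have h1 : w -ᵥ t ∈ vectorSpan ℝ T := by
            rw [h]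
            exact vsub_mem_vectorSpan ℝ (hTsub (Set.mem_insert _ _))
              (hTsub (Set.mem_insert_of_mem _ ht))
          have h2 : vectorSpan ℝ T ≤ LinearMap.ker g := by
            rw [vectorSpan_eq_span_vsub_set_right ℝ ht, Submodule.span_le]
            rintro _ ⟨v, hv, rfl⟩
            exact hgT v hv
          exact hgw.ne' (h2 h1)
        have := Submodule.finrank_lt_finrank_of_lt hlt
        omega
    rcases lt_or_gt_of_ne hgv₀ with h | h
    · exact main (-g) (by simp [hgx]) (fun v hv => by simp [hgT v hv]) (by
        rw [LinearMap.neg_apply]; linarith)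
    · exact main g hgx hgT h

theorem vectorSpan_convexHull {n : ℕ} (V : Set (Fin n → ℝ)) :
    vectorSpan ℝ (convexHull ℝ V) = vectorSpan ℝ V := by
  rw [← direction_affineSpan, affineSpan_convexHull, direction_affineSpan]

/-- A point of the affine hull outside a polytope is cut off by a facet. -/
theorem exists_isFacet_of_notMem {n : ℕ} {V : Set (Fin n → ℝ)} (hV : V.Finite)
    {x x₀ : Fin n → ℝ} (hxQ : x ∉ convexHull ℝ V) (hx₀ : x₀ ∈ convexHull ℝ V)
    (hx : x - x₀ ∈ vectorSpan ℝ (convexHull ℝ V)) :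
    ∃ (f : (Fin n → ℝ) →ₗ[ℝ] ℝ) (b : ℝ), (∀ v ∈ convexHull ℝ V, f v ≤ b) ∧ b < f x ∧
      IsFacet (convexHull ℝ V) {v ∈ convexHull ℝ V | f v = b} := by
  have hne : V.Nonempty := convexHull_nonempty_iff.1 ⟨x₀, hx₀⟩
  rw [vectorSpan_convexHull] at hx
  have hd : 0 < Module.finrank ℝ (vectorSpan ℝ V) := by
    rw [Nat.pos_iff_ne_zero, Ne, Submodule.finrank_eq_zero]
    intro h
    rw [h, Submodule.mem_bot, sub_eq_zero] at hx
    exact hxQ (hx ▸ hx₀)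
  obtain ⟨f, b, hfb, hfx, ⟨t, ht⟩, hrank⟩ :=
    exists_functional_of_finrank_lt hV hxQ hne (Module.finrank ℝ (vectorSpan ℝ V) - 1) (by omega)
  have hfb' : ∀ v ∈ convexHull ℝ V, f v ≤ b := fun v hv =>
    convexHull_min (t := {y | f y ≤ b}) hfb (convex_halfSpace_le f.isLinear b) hv
  refine ⟨f, b, hfb', hfx, ?_⟩
  set F := {v ∈ convexHull ℝ V | f v = b} with hF
  have htF : t ∈ F := ⟨subset_convexHull ℝ V ht.1, ht.2⟩
  refine ⟨⟨t, htF⟩, fun _ => ⟨LinearMap.toContinuousLinearMap f, ?_⟩, ?_⟩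
  · ext y
    simp only [hF, Set.mem_ofPred_eq, LinearMap.coe_toContinuousLinearMap']
    refine and_congr_right fun hy => ⟨fun h z hz => h ▸ hfb' z hz, fun h => ?_⟩
    exact le_antisymm (hfb' y hy) (ht.2 ▸ h t htF.1)
  · rw [vectorSpan_convexHull]
    have h1 : vectorSpan ℝ {v ∈ V | f v = b} ≤ vectorSpan ℝ F :=
      vectorSpan_mono ℝ fun v hv => ⟨subset_convexHull ℝ V hv.1, hv.2⟩
    -- A face of full dimension would force `f` to be constant on the affine hull, which contains
    -- `x`.
    have h2 : vectorSpan ℝ F < vectorSpan ℝ V := by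
      refine lt_of_le_of_ne ?_ fun h => ?_
      · rw [← vectorSpan_convexHull V]
        exact vectorSpan_mono ℝ fun v hv => hv.1
      · have h3 : vectorSpan ℝ F ≤ LinearMap.ker f := by
          rw [vectorSpan_eq_span_vsub_set_right ℝ htF, Submodule.span_le]
          rintro _ ⟨v, hv, rfl⟩
          simp [hv.2, ht.2]
        have h4 : x - t ∈ vectorSpan ℝ V := by
          have : x₀ - t ∈ vectorSpan ℝ V := by
            rw [← vectorSpan_convexHull V]
            exact vsub_mem_vectorSpan ℝ hx₀ htF.1
          simpa using add_mem hx this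
        rw [← h] at h4
        have h5 := h3 h4
        rw [LinearMap.mem_ker, map_sub, ht.2] at h5
        linarith
    have := Submodule.finrank_mono h1
    have := Submodule.finrank_lt_finrank_of_lt h2
    omega

/-- A polytope is cut out of its affine hull by any functionals exposing its facets. -/
theorem mem_of_forall_facet {n : ℕ} {Q : Set (Fin n → ℝ)} (hQ : IsPolytope Q)
    (l : Set (Fin n → ℝ) → (Fin n → ℝ) →ₗ[ℝ] ℝ) (b : Set (Fin n → ℝ) → ℝ)
    (hle : ∀ F, IsFacet Q F → ∀ y ∈ Q, l F y ≤ b F)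
    (hF : ∀ F, IsFacet Q F → F = {y ∈ Q | l F y = b F})
    {x x₀ : Fin n → ℝ} (hx₀ : x₀ ∈ Q) (hx : x - x₀ ∈ vectorSpan ℝ Q)
    (hxl : ∀ F, IsFacet Q F → l F x ≤ b F) : x ∈ Q := by
  obtain ⟨V, hV, rfl⟩ := hQ
  by_contra hxQ
  obtain ⟨f, c, hfc, hcx, hfac⟩ := exists_isFacet_of_notMem hV hxQ hx₀ hx
  set Q := convexHull ℝ V with hQ
  set F := {v ∈ Q | f v = c} with hFdef
  obtain ⟨t, ht⟩ := hfac.1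
  obtain ⟨y, hy, hyF⟩ : ∃ y ∈ Q, y ∉ F := by
    by_contra! h
    have : F = Q := Set.Subset.antisymm (fun v hv => hv.1) h
    have h3 := hfac.2.2
    rw [this] at h3
    omega
  have hFl : ∀ v ∈ F, l F v = b F := fun v hv => by
    rw [hF F hfac] at hv; exact hv.2
  have hyl : l F y < b F := lt_of_le_of_ne (hle F hfac y hy) fun h => hyF (by
    rw [hF F hfac]; exact ⟨hy, h⟩)
  have hyf : f y < c := lt_of_le_of_ne (hfc y hy) fun h => hyF ⟨hy, h⟩
  set D := vectorSpan ℝ Q with hD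
  -- The facet spans the whole hyperplane `f = c` of the affine hull. Hence the point where the
  -- segment from `y` to `x` crosses this level is also at level `b F` of `l F`, and `x` lies beyond
  -- it.
  have hker : vectorSpan ℝ F = D ⊓ LinearMap.ker f := by
    have hle1 : vectorSpan ℝ F ≤ D ⊓ LinearMap.ker f := by
      refine le_inf (vectorSpan_mono ℝ fun v hv => hv.1) ?_
      rw [vectorSpan_eq_span_vsub_set_right ℝ ht, Submodule.span_le]
      rintro _ ⟨v, hv, rfl⟩
      simp [hv.2, ht.2]
    refine Submodule.eq_of_le_of_finrank_le hle1 ?_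
    have hlt : D ⊓ LinearMap.ker f < D := by
      refine lt_of_le_of_ne inf_le_left fun h => ?_
      have h1 : y - t ∈ D := vsub_mem_vectorSpan ℝ hy ht.1
      rw [← h] at h1
      have h2 : f (y - t) = 0 := h1.2
      rw [map_sub, ht.2] at h2
      linarith
    have := Submodule.finrank_lt_finrank_of_lt hlt
    have : Module.finrank ℝ (vectorSpan ℝ F) + 1 = Module.finrank ℝ D := hfac.2.2
    omega
  set τ := (c - f y) / (f x - f y) with hτ
  have hxy : 0 < f x - f y := by linarith
  have hτ0 : 0 < τ := div_pos (by linarith) hxy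
  have hτ1 : τ < 1 := by rw [hτ, div_lt_one hxy]; linarith
  have hz : y + τ • (x - y) - t ∈ vectorSpan ℝ F := by
    rw [hker]
    refine ⟨?_, ?_⟩
    · have h1 : y - t ∈ D := vsub_mem_vectorSpan ℝ hy ht.1
      have h2 : x₀ - y ∈ D := vsub_mem_vectorSpan ℝ hx₀ hy
      have h3 : x - y ∈ D := by simpa using add_mem hx h2
      have := add_mem h1 (D.smul_mem τ h3)
      rwa [show y - t + τ • (x - y) = y + τ • (x - y) - t by abel] at this
    · show f _ = 0
      rw [map_sub, map_add, map_smul, map_sub, ht.2, smul_eq_mul, hτ]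
      field_simp
      ring
  have hlker : vectorSpan ℝ F ≤ LinearMap.ker (l F) := by
    rw [vectorSpan_eq_span_vsub_set_right ℝ ht, Submodule.span_le]
    rintro _ ⟨v, hv, rfl⟩
    simp [hFl v hv, hFl t ht]
  have h1 : l F (y + τ • (x - y) - t) = 0 := hlker hz
  rw [map_sub, map_add, map_smul, map_sub, hFl t ht, smul_eq_mul] at h1
  have h2 := hxl F hfac
  nlinarith

/-! ### The slack cone of an extension -/

/-- `K` with the projection `π` presents the cone over `P` as the image of the nonnegative part
of a linear subspace of `ℝᴹ`. -/
structure ConeLift {M : ℕ} (P : Set (Fin 2 → ℝ)) (K : Submodule ℝ (Fin M → ℝ))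
    (π : (Fin M → ℝ) →ₗ[ℝ] (Fin 2 → ℝ) × ℝ) : Prop where
  cone : ∀ s ∈ K, 0 ≤ s → s ≠ 0 → ∃ c : ℝ, 0 < c ∧ ∃ p ∈ P, π s = c • (p, (1 : ℝ))
  lift : ∀ v ∈ vertices P, ∃ s ∈ K, 0 ≤ s ∧ π s = (v, 1)

/-- A vector spanning an extreme ray of the nonnegative part of `K`. -/
structure IsRay {M : ℕ} (K : Submodule ℝ (Fin M → ℝ)) (s : Fin M → ℝ) : Prop where
  mem : s ∈ K
  nonneg : 0 ≤ s
  ne_zero : s ≠ 0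
  eq_smul : ∀ u ∈ K, (∀ i, s i = 0 → u i = 0) → ∃ c : ℝ, u = c • s

/-- Every extreme ray is projected onto a vertex. -/
def NoHiddenRay {M : ℕ} (P : Set (Fin 2 → ℝ)) (K : Submodule ℝ (Fin M → ℝ))
    (π : (Fin M → ℝ) →ₗ[ℝ] (Fin 2 → ℝ) × ℝ) : Prop :=
  ∀ s, IsRay K s → ∃ c : ℝ, 0 < c ∧ ∃ v ∈ vertices P, π s = c • (v, (1 : ℝ))

theorem exists_subset_range_of_encard_le {α : Type*} [Inhabited α] {A : Set α} {M : ℕ}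
    (h : A.encard ≤ M) : ∃ e : Fin M → α, A ⊆ Set.range e := by
  have hfin : A.Finite := Set.finite_of_encard_le_coe h
  have : Finite A := hfin
  have hcard : Nat.card A ≤ M := by
    have h1 : A.encard = (Nat.card A : ℕ∞) := by
      rw [Nat.card_coe_set_eq, hfin.cast_ncard_eq]
    rw [h1] at h
    exact_mod_cast h
  have f : A ≃ Fin (Nat.card A) := Finite.equivFin A
  refine ⟨fun i => if h : (i : ℕ) < Nat.card A then f.symm ⟨i, h⟩ else default, fun a ha => ?_⟩
  refine ⟨⟨f ⟨a, ha⟩, (f ⟨a, ha⟩).2.trans_le hcard⟩, ?_⟩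
  simp only [Fin.is_lt, dite_true, Fin.eta]
  rw [f.symm_apply_apply]

/-- Map the homogenised affine hull of `Q` to the vector of its facet slacks. Nonnegative slacks
characterise the cone over `Q`, boundedness makes the map injective, and rays of minimal support
come from vertices of `Q`. -/
theorem exists_coneLift {P : Set (Fin 2 → ℝ)} {k M : ℕ} {Q : Set (Fin (2 + k) → ℝ)}
    (hQ : IsExtension Q P) (hsize : polytopeSize Q ≤ M) {x₀ x₁ : Fin 2 → ℝ} (hx₀ : x₀ ∈ P)
    (hx₁ : x₁ ∈ P) (hne : x₀ ≠ x₁) :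
    ∃ (K : Submodule ℝ (Fin M → ℝ)) (π : (Fin M → ℝ) →ₗ[ℝ] (Fin 2 → ℝ) × ℝ), ConeLift P K π ∧
      ((∀ w ∈ vertices Q, firstCoords 2 k w ∈ vertices P) → NoHiddenRay P K π) := by
  classical
  obtain ⟨hQp, hQP⟩ := hQ
  have hfun : ∀ F, ∃ (l : (Fin (2 + k) → ℝ) →ₗ[ℝ] ℝ) (b : ℝ), (∀ y ∈ Q, l y ≤ b) ∧
      (IsFacet Q F → F = {y ∈ Q | l y = b}) := by
    intro F
    by_cases hF : IsFacet Q F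
    · obtain ⟨l, hl⟩ := hF.exists_functional
      obtain ⟨t, ht⟩ := hF.1
      have ht' := ht
      rw [hl] at ht'
      refine ⟨l.toLinearMap, l t, ht'.2, fun _ => ?_⟩
      rw [hl]
      ext y
      refine and_congr_right fun hy => ⟨fun h => le_antisymm (ht'.2 y hy) (h t ht'.1), ?_⟩
      intro h z hz
      exact (ht'.2 z hz).trans h.ge
    -- A set that is no facet gets a zero row; the enumeration `e` may hit such sets when there are
    -- fewer than `M` facets.
    · exact ⟨0, 0, by simp, fun h => absurd h hF⟩
  choose l b hle hface using hfun
  obtain ⟨e, he⟩ := exists_subset_range_of_encard_le hsize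
  obtain ⟨q₀, hq₀, hq₀x⟩ : x₀ ∈ firstCoords 2 k '' Q := hQP ▸ hx₀
  obtain ⟨q₁, hq₁, hq₁x⟩ : x₁ ∈ firstCoords 2 k '' Q := hQP ▸ hx₁
  have hq01 : q₁ ≠ q₀ := by rintro rfl; exact hne (hq₀x.symm.trans hq₁x)
  have hbdd : Bornology.IsBounded Q := by
    obtain ⟨V, hV, rfl⟩ := hQp
    exact (hV.isCompact_convexHull ℝ).isBounded
  set D := vectorSpan ℝ Q with hD
  -- This is the linear span of the points `(x, 1)` with `x` in the affine hull of `Q`.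
  set E : Submodule ℝ ((Fin (2 + k) → ℝ) × ℝ) := D.comap
    (LinearMap.fst ℝ _ _ - (LinearMap.snd ℝ _ _).smulRight q₀) with hE
  have memE : ∀ u t, (u, t) ∈ E ↔ u - t • q₀ ∈ D := fun u t => Iff.rfl
  set σ₀ : ((Fin (2 + k) → ℝ) × ℝ) →ₗ[ℝ] (Fin M → ℝ) :=
    LinearMap.pi fun i => b (e i) • LinearMap.snd ℝ _ _ - (l (e i)) ∘ₗ LinearMap.fst ℝ _ _ with hσ₀
  have σ₀_apply : ∀ u t i, σ₀ (u, t) i = b (e i) * t - l (e i) u := fun u t i => by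
    simp [hσ₀]
  have memQ : ∀ x, (x, (1 : ℝ)) ∈ E → 0 ≤ σ₀ (x, 1) → x ∈ Q := by
    intro x hx hs
    rw [memE, one_smul] at hx
    refine mem_of_forall_facet hQp l b (fun F _ => hle F) (fun F hF => hface F hF) hq₀ hx ?_
    intro F hF
    obtain ⟨i, rfl⟩ := he hF
    have := hs i
    rw [σ₀_apply] at this
    simp only [Pi.zero_apply, mul_one] at this
    linarith
  have hQE : ∀ x ∈ Q, (x, (1 : ℝ)) ∈ E := fun x hx => by
    rw [memE, one_smul]; exact vsub_mem_vectorSpan ℝ hx hq₀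
  have hQσ : ∀ x ∈ Q, 0 ≤ σ₀ (x, (1 : ℝ)) := fun x hx i => by
    rw [σ₀_apply, Pi.zero_apply]
    linarith [hle (e i) x hx]
  -- recession directions vanish
  have hrec : ∀ u, (u, (0 : ℝ)) ∈ E → 0 ≤ σ₀ (u, 0) → u = 0 := by
    intro u hu hs
    by_contra hu0
    obtain ⟨C, hC⟩ := hbdd.exists_norm_le
    have hray : ∀ r : ℝ, 0 ≤ r → q₀ + r • u ∈ Q := by
      intro r hr
      have heq : (q₀ + r • u, (1 : ℝ)) = (q₀, 1) + r • (u, 0) := by simp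
      refine memQ _ ?_ ?_
      · rw [heq]; exact E.add_mem (hQE q₀ hq₀) (E.smul_mem r hu)
      · rw [heq, map_add, map_smul]
        exact add_nonneg (hQσ q₀ hq₀) (smul_nonneg hr hs)
    have hpos : 0 < ‖u‖ := norm_pos_iff.2 hu0
    have hC0 : 0 ≤ C := (norm_nonneg _).trans (hC q₀ hq₀)
    have h1 := hC _ (hray ((2 * C + 1) / ‖u‖) (by positivity))
    have h2 : ‖((2 * C + 1) / ‖u‖) • u‖ = 2 * C + 1 := by
      rw [norm_smul, Real.norm_of_nonneg (by positivity)]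
      field_simp
    have h3 : ‖((2 * C + 1) / ‖u‖) • u‖ ≤ ‖q₀ + ((2 * C + 1) / ‖u‖) • u‖ + ‖q₀‖ := by
      have := norm_sub_le (q₀ + ((2 * C + 1) / ‖u‖) • u) q₀
      simpa using this
    linarith [hC q₀ hq₀]
  have hcone : ∀ u t, (u, t) ∈ E → 0 ≤ σ₀ (u, t) → (u, t) ≠ 0 → 0 < t ∧ t⁻¹ • u ∈ Q := by
    intro u t hu hs hne0
    rcases lt_trichotomy t 0 with ht | rfl | ht
    -- A negative last coordinate would make `Q` a single point; two distinct points of `P` rule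
    -- this out.
    · exfalso
      have hzero : ∀ q ∈ Q, u = t • q := by
        intro q hq
        have heq : (u - t • q, (0 : ℝ)) = (u, t) + (-t) • (q, (1 : ℝ)) := by
          simp [sub_eq_add_neg]
        refine sub_eq_zero.1 (hrec _ ?_ ?_)
        · rw [heq]; exact E.add_mem hu (E.smul_mem _ (hQE q hq))
        · rw [heq, map_add, map_smul]
          exact add_nonneg hs (smul_nonneg (by linarith) (hQσ q hq))
      have := (hzero q₀ hq₀).symm.trans (hzero q₁ hq₁)
      exact hq01 ((smul_right_injective _ ht.ne) this).symm
    · exact absurd (by rw [hrec u hu hs]; rfl) hne0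
    · refine ⟨ht, memQ _ ?_ ?_⟩
      · have : (t⁻¹ • u, (1 : ℝ)) = t⁻¹ • (u, t) := by simp [ht.ne']
        rw [this]; exact E.smul_mem _ hu
      · have : (t⁻¹ • u, (1 : ℝ)) = t⁻¹ • (u, t) := by simp [ht.ne']
        rw [this, map_smul]
        exact smul_nonneg (by positivity) hs
  set σ : E →ₗ[ℝ] (Fin M → ℝ) := σ₀ ∘ₗ E.subtype with hσ
  have hinj : LinearMap.ker σ = ⊥ := by
    rw [LinearMap.ker_eq_bot']
    rintro ⟨⟨u, t⟩, hu⟩ h0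
    have h0' : σ₀ (u, t) = 0 := h0
    by_contra hne0
    have hne1 : (u, t) ≠ 0 := fun h => hne0 (Subtype.ext h)
    have h1 := hcone u t hu h0'.ge hne1
    have h2 := hcone (-u) (-t) (E.neg_mem hu) (by
      have : ((-u, -t) : (Fin (2 + k) → ℝ) × ℝ) = -(u, t) := rfl
      rw [this, map_neg, h0', neg_zero]) (fun h => hne1 (by
        have : ((-u, -t) : (Fin (2 + k) → ℝ) × ℝ) = -(u, t) := rfl
        rw [this, neg_eq_zero] at h
        exact h))
    linarith [h1.1, h2.1]
  -- A left inverse of the slack map extends the projection to a linear map on all of ℝᴹ.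
  obtain ⟨ρ, hρ⟩ := LinearMap.exists_leftInverse_of_injective σ hinj
  have hρ' : ∀ x, ρ (σ x) = x := fun x => LinearMap.congr_fun hρ x
  set π₀ : ((Fin (2 + k) → ℝ) × ℝ) →ₗ[ℝ] (Fin 2 → ℝ) × ℝ :=
    LinearMap.prodMap (LinearMap.funLeft ℝ ℝ (Fin.castAdd k)) LinearMap.id with hπ₀
  have π₀_apply : ∀ u t, π₀ (u, t) = (firstCoords 2 k u, t) := fun u t => rfl
  have firstCoords_smul : ∀ (c : ℝ) u, firstCoords 2 k (c • u) = c • firstCoords 2 k u :=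
    fun c u => rfl
  refine ⟨LinearMap.range σ, π₀ ∘ₗ E.subtype ∘ₗ ρ, ⟨?_, ?_⟩, ?_⟩
  · rintro _ ⟨⟨⟨u, t⟩, hu⟩, rfl⟩ hs hne0
    have h := hcone u t hu hs fun h => hne0 (by
      have : (⟨(u, t), hu⟩ : E) = 0 := Subtype.ext h
      rw [this, map_zero])
    refine ⟨t, h.1, firstCoords 2 k (t⁻¹ • u), hQP ▸ ⟨_, h.2, rfl⟩, ?_⟩
    simp only [LinearMap.comp_apply, hρ']
    show π₀ (u, t) = _
    rw [π₀_apply, firstCoords_smul, Prod.smul_mk, smul_smul, mul_inv_cancel₀ h.1.ne']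
    simp
  · intro v hv
    obtain ⟨q, hq, hqv⟩ : v ∈ firstCoords 2 k '' Q := hQP ▸ hv.1
    refine ⟨σ ⟨(q, 1), hQE q hq⟩, ⟨_, rfl⟩, hQσ q hq, ?_⟩
    simp only [LinearMap.comp_apply, hρ']
    show π₀ (q, 1) = _
    rw [π₀_apply, hqv]
  · rintro hvert _ ⟨⟨⟨⟨u, t⟩, hu⟩, rfl⟩, hs, hne0, hext⟩
    have h := hcone u t hu hs fun h => hne0 (by
      have : (⟨(u, t), hu⟩ : E) = 0 := Subtype.ext h
      rw [this, map_zero])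
    have hx1 : ((t⁻¹ • u, (1 : ℝ)) : (Fin (2 + k) → ℝ) × ℝ) = t⁻¹ • (u, t) := by simp [h.1.ne']
    refine ⟨t, h.1, firstCoords 2 k (t⁻¹ • u), hvert _ ?_, ?_⟩
    · have key : ∀ y ∈ Q, ∀ z ∈ Q, t⁻¹ • u ∈ openSegment ℝ y z → y = t⁻¹ • u := by
        rintro y hy z hz ⟨c, d, hc, hd, hcd, hyz⟩
        have hsum : t⁻¹ • σ₀ (u, t) = c • σ₀ (y, 1) + d • σ₀ (z, 1) := by
          rw [← map_smul, ← hx1, ← map_smul, ← map_smul, ← map_add, ← hyz]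
          congr 1
          simp [hcd]
        -- If the point lies strictly between `y` and `z`, every facet tight at it is tight at `y`,
        -- so minimality of the support makes the slack vectors proportional.
        obtain ⟨a, ha⟩ := hext (σ ⟨(y, 1), hQE y hy⟩) ⟨_, rfl⟩ (by
          intro i hi
          have hi' : σ₀ (u, t) i = 0 := hi
          have h1 := congrFun hsum i
          simp only [Pi.smul_apply, Pi.add_apply, smul_eq_mul, hi', mul_zero] at h1
          have h2 : 0 ≤ σ₀ (y, 1) i := hQσ y hy i
          have h3 : 0 ≤ σ₀ (z, 1) i := hQσ z hz i
          show σ₀ (y, 1) i = 0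
          have h4 := mul_nonneg hc.le h2
          have h5 := mul_nonneg hd.le h3
          have : c * σ₀ (y, 1) i = 0 := by linarith
          exact (mul_eq_zero.1 this).resolve_left hc.ne')
        rw [← map_smul] at ha
        have ha' := LinearMap.ker_eq_bot.1 hinj ha
        have ha'' : (y, (1 : ℝ)) = a • (u, t) := congrArg Subtype.val ha'
        rw [Prod.smul_mk, Prod.mk.injEq] at ha''
        rw [ha''.1]
        congr 1
        exact eq_inv_of_mul_eq_one_left ha''.2.symm
      refine mem_extremePoints.2 ⟨h.2, fun y hy z hz hyz => ⟨key y hy z hz hyz, ?_⟩⟩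
      rw [openSegment_symm] at hyz
      exact key z hz y hy hyz
    · simp only [LinearMap.comp_apply, hρ']
      show π₀ (u, t) = _
      rw [π₀_apply, firstCoords_smul, Prod.smul_mk, smul_smul, mul_inv_cancel₀ h.1.ne']
      simp

theorem exists_pos_mul_le {M : ℕ} {s s' : Fin M → ℝ} (hs : 0 ≤ s)
    (h : ∀ i, s i = 0 → s' i = 0) : ∃ ε : ℝ, 0 < ε ∧ ∀ i, ε * s' i ≤ s i := by
  have hev : ∀ᶠ ε in 𝓝[>] (0 : ℝ), ∀ i, ε * s' i ≤ s i := by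
    rw [eventually_all]
    intro i
    by_cases h0 : s i = 0
    · simp [h0, h i h0]
    · have hc : Continuous fun ε : ℝ => ε * s' i := by fun_prop
      have := (hc.tendsto 0).eventually_lt_const (u := s i)
        (by simpa using lt_of_le_of_ne (hs i) (Ne.symm h0))
      exact (this.filter_mono nhdsWithin_le_nhds).mono fun δ h => le_of_lt h
  obtain ⟨ε, h1, h2⟩ := (hev.and self_mem_nhdsWithin).exists
  exact ⟨ε, h2, h1⟩

section

variable {M : ℕ} {P : Set (Fin 2 → ℝ)} {K : Submodule ℝ (Fin M → ℝ)}
  {π : (Fin M → ℝ) →ₗ[ℝ] (Fin 2 → ℝ) × ℝ}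

/-- The preimage of a vertex is a face. -/
theorem ConeLift.eq_smul_of_support_subset (hK : ConeLift P K π) {v : Fin 2 → ℝ}
    (hv : v ∈ vertices P) {s s' : Fin M → ℝ} (hs : s ∈ K) (hs0 : 0 ≤ s) {c : ℝ} (hc : 0 < c)
    (hπ : π s = c • (v, (1 : ℝ))) (hs' : s' ∈ K) (hs'0 : 0 ≤ s') (hne : s' ≠ 0)
    (hsub : ∀ i, s i = 0 → s' i = 0) : ∃ d : ℝ, 0 < d ∧ π s' = d • (v, (1 : ℝ)) := by
  obtain ⟨ε, hε, hle⟩ := exists_pos_mul_le hs0 hsub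
  obtain ⟨d, hd, p, hp, hdp⟩ := hK.cone s' hs' hs'0 hne
  by_cases hr : s - ε • s' = 0
  · refine ⟨c / ε, by positivity, ?_⟩
    rw [sub_eq_zero] at hr
    rw [hr, map_smul] at hπ
    rw [div_eq_inv_mul, mul_smul, ← hπ, smul_smul, inv_mul_cancel₀ hε.ne', one_smul]
  · obtain ⟨a, ha, q, hq, haq⟩ := hK.cone (s - ε • s') (K.sub_mem hs (K.smul_mem _ hs'))
      (fun i => by simpa using hle i) hr
    -- This writes `v` as a proper convex combination of the images of `s'` and of `s - ε • s'`;
    -- extremality then puts both over `v`.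
    have h1 : (ε * d / c) • (p, (1 : ℝ)) + (a / c) • (q, (1 : ℝ)) = (v, (1 : ℝ)) := by
      have h2 : c • (v, (1 : ℝ)) = (ε * d) • (p, (1 : ℝ)) + a • (q, (1 : ℝ)) := by
        rw [← hπ, ← haq, mul_smul, ← hdp, map_sub, map_smul]
        abel
      have h3 : (v, (1 : ℝ)) = c⁻¹ • c • (v, (1 : ℝ)) := by
        rw [smul_smul, inv_mul_cancel₀ hc.ne', one_smul]
      rw [h3, h2, smul_add, smul_smul, smul_smul]
      congr 2 <;> ring
    have h2 := (eq_of_mem_extremePoints_of_combination hv hp hq (by positivity) (by positivity)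
      h1).1
    exact ⟨d, hd, by rw [hdp, h2]⟩

/-- Among the nonnegative vectors over `v`, one of smallest support is a ray. Otherwise a second,
non-proportional vector of `K` on the same support can be subtracted until a coordinate vanishes. -/
theorem ConeLift.exists_isRay (hK : ConeLift P K π) {v : Fin 2 → ℝ} (hv : v ∈ vertices P) :
    ∃ s, IsRay K s ∧ π s = (v, 1) := by
  classical
  have key : ∀ n : ℕ, ∀ s ∈ K, 0 ≤ s → π s = (v, 1) →
      (Finset.univ.filter fun i => s i ≠ 0).card = n → ∃ s, IsRay K s ∧ π s = (v, 1) := by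
    intro n
    induction n using Nat.strong_induction_on with
    | _ n ih =>
    intro s hs hs0 hπ hn
    by_cases hray : IsRay K s
    · exact ⟨s, hray, hπ⟩
    have hne : s ≠ 0 := by
      rintro rfl
      rw [map_zero] at hπ
      exact zero_ne_one (congrArg Prod.snd hπ)
    obtain ⟨s', hs', hsub, hnot⟩ : ∃ s' ∈ K, (∀ i, s i = 0 → s' i = 0) ∧ ∀ c : ℝ, s' ≠ c • s := by
      by_contra! h
      exact hray ⟨hs, hs0, hne, h⟩
    have main : ∀ s' ∈ K, (∀ i, s i = 0 → s' i = 0) → (∀ c : ℝ, s' ≠ c • s) →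
        (∃ i, 0 < s' i) → ∃ s, IsRay K s ∧ π s = (v, 1) := by
      intro s' hs' hsub hnot ⟨i₀, hi₀⟩
      -- The smallest ratio is the largest multiple of `s'` that keeps the difference nonnegative,
      -- and it removes `j` from the support.
      obtain ⟨j, hj, hmin⟩ := Finset.exists_min_image (Finset.univ.filter fun i => 0 < s' i)
        (fun i => s i / s' i) ⟨i₀, by simpa using hi₀⟩
      have hj : 0 < s' j := by simpa using hj
      have hsj : 0 < s j := lt_of_le_of_ne (hs0 j) fun h => hj.ne' (hsub j h.symm)
      set r := s j / s' j with hr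
      have hr0 : 0 < r := div_pos hsj hj
      have h1 : s - r • s' ∈ K := K.sub_mem hs (K.smul_mem _ hs')
      have h2 : 0 ≤ s - r • s' := by
        intro i
        simp only [Pi.zero_apply, Pi.sub_apply, Pi.smul_apply, smul_eq_mul, sub_nonneg]
        by_cases hi : 0 < s' i
        · have := hmin i (by simpa using hi)
          rwa [le_div_iff₀ hi] at this
        · exact (mul_nonpos_of_nonneg_of_nonpos hr0.le (not_lt.1 hi)).trans (hs0 i)
      have h3 : s - r • s' ≠ 0 := by
        intro h
        rw [sub_eq_zero] at h
        refine hnot r⁻¹ ?_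
        rw [h, smul_smul, inv_mul_cancel₀ hr0.ne', one_smul]
      have h4 : ∀ i, s i = 0 → (s - r • s') i = 0 := fun i hi => by simp [hi, hsub i hi]
      obtain ⟨d, hd, hπd⟩ := hK.eq_smul_of_support_subset hv hs hs0 one_pos
        (by rw [one_smul]; exact hπ) h1 h2 h3 h4
      refine ih _ ?_ (d⁻¹ • (s - r • s')) (K.smul_mem _ h1)
        (smul_nonneg (by positivity) h2) (by
          rw [map_smul, hπd, smul_smul, inv_mul_cancel₀ hd.ne', one_smul]) rfl
      rw [← hn]
      apply Finset.card_lt_card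
      refine ⟨fun i hi => ?_, fun h => ?_⟩
      · simp only [Finset.mem_filter, Finset.mem_univ, true_and] at hi ⊢
        intro h0
        apply hi
        simp [hsub i h0, h0]
      · have := h (x := j) (by simpa using hsj.ne')
        simp only [Finset.mem_filter, Finset.mem_univ, true_and] at this
        apply this
        simp only [Pi.smul_apply, Pi.sub_apply, smul_eq_mul, hr]
        field_simp
        ring
    by_cases hpos : ∃ i, 0 < s' i
    · exact main s' hs' hsub hnot hpos
    · refine main (-s') (K.neg_mem hs') (fun i hi => by simp [hsub i hi])
        (fun c h => hnot (-c) (by rw [neg_smul, ← h, neg_neg])) ?_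
      push Not at hpos
      by_contra! h
      refine hnot 0 ?_
      rw [zero_smul]
      ext i
      exact le_antisymm (hpos i) (by simpa using h i)
  obtain ⟨s, hs, hs0, hπ⟩ := hK.lift v hv
  exact key _ s hs hs0 hπ rfl

/-- Rays have minimal support, so the inclusion of supports makes them proportional. -/
theorem IsRay.image_unique {s s' : Fin M → ℝ} (hs : IsRay K s) (hs' : IsRay K s')
    (h : ∀ i, s i = 0 → s' i = 0) {v v' : Fin 2 → ℝ} {c c' : ℝ} (hc' : 0 < c')
    (hv : π s = c • (v, (1 : ℝ))) (hv' : π s' = c' • (v', (1 : ℝ))) : v = v' := by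
  obtain ⟨a, ha⟩ := hs.eq_smul s' hs'.mem h
  rw [ha, map_smul, hv, smul_smul, Prod.smul_mk, Prod.smul_mk, Prod.mk.injEq] at hv'
  obtain ⟨h1, h2⟩ := hv'
  simp only [smul_eq_mul, mul_one] at h2
  rw [h2] at h1
  exact smul_right_injective _ hc'.ne' h1

end

/-! ### Forbidden incidences in the plane -/

theorem eq_zero_of_combination_eq_zero {a b c : Fin 2 → ℝ} (h : orient a b c ≠ 0) {x y z : ℝ}
    (hxyz : x • (a, (1 : ℝ)) + y • (b, (1 : ℝ)) + z • (c, (1 : ℝ)) = 0) :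
    x = 0 ∧ y = 0 ∧ z = 0 := by
  have h1 := congrArg Prod.fst hxyz
  have h2 := congrArg Prod.snd hxyz
  have h10 := congrFun h1 0
  have h11 := congrFun h1 1
  simp only [Prod.smul_mk, Prod.mk_add_mk, Pi.add_apply, Pi.smul_apply, smul_eq_mul, mul_one,
    Prod.fst_zero, Prod.snd_zero, Pi.zero_apply] at h2 h10 h11
  have hx : x * orient a b c = 0 := by
    unfold orient
    linear_combination (b 1 - c 1) * h10 + (c 0 - b 0) * h11 + (b 0 * c 1 - b 1 * c 0) * h2
  have hy : y * orient a b c = 0 := by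
    unfold orient
    linear_combination (c 1 - a 1) * h10 + (a 0 - c 0) * h11 + (c 0 * a 1 - c 1 * a 0) * h2
  have hz : z * orient a b c = 0 := by
    unfold orient
    linear_combination (a 1 - b 1) * h10 + (b 0 - a 0) * h11 + (a 0 * b 1 - a 1 * b 0) * h2
  exact ⟨(mul_eq_zero.1 hx).resolve_right h, (mul_eq_zero.1 hy).resolve_right h,
    (mul_eq_zero.1 hz).resolve_right h⟩

theorem mem_line_of_combination {a b p : Fin 2 → ℝ} {x y h : ℝ} (hh : h ≠ 0)
    (hp : x • (a, (1 : ℝ)) + y • (b, (1 : ℝ)) = h • (p, (1 : ℝ))) : p ∈ line[ℝ, a, b] := by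
  simp only [Prod.smul_mk, Prod.mk_add_mk, smul_eq_mul, mul_one, Prod.mk.injEq] at hp
  obtain ⟨h1, h2⟩ := hp
  have : p = AffineMap.lineMap a b (y / h) := by
    rw [AffineMap.lineMap_apply_module]
    have h3 : 1 - y / h = x / h := by field_simp; linarith
    rw [h3, div_eq_inv_mul, div_eq_inv_mul, mul_smul, mul_smul, ← smul_add, h1, smul_smul,
      inv_mul_cancel₀ hh, one_smul]
  rw [this]
  exact AffineMap.lineMap_mem_affineSpan_pair _ _ _

/-- A combination with last coordinate zero is a common direction of the two lines, that is, their
intersection at infinity. -/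
theorem parallel_of_combination {a b c d : Fin 2 → ℝ} {x y z t : ℝ} {w : (Fin 2 → ℝ) × ℝ}
    (hw : w ≠ 0) (hw2 : w.2 = 0) (h1 : x • (a, (1 : ℝ)) + y • (b, (1 : ℝ)) = w)
    (h2 : z • (c, (1 : ℝ)) + t • (d, (1 : ℝ)) = w) :
    line[ℝ, a, b].Parallel line[ℝ, c, d] := by
  have key : ∀ (x y : ℝ) (a b : Fin 2 → ℝ), x • (a, (1 : ℝ)) + y • (b, (1 : ℝ)) = w →
      vectorSpan ℝ {a, b} = Submodule.span ℝ {w.1} := by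
    intro x y a b h
    simp only [Prod.smul_mk, Prod.mk_add_mk, smul_eq_mul, mul_one] at h
    have hxy : y = -x := by
      have := congrArg Prod.snd h
      simp only [hw2] at this
      linarith
    have hab : w.1 = x • (a - b) := by
      rw [← h, hxy, smul_sub, neg_smul, sub_eq_add_neg]
    have hx : x ≠ 0 := by
      rintro rfl
      exact hw (Prod.ext (by simpa using hab) hw2)
    rw [vectorSpan_pair, vsub_eq_sub, hab]
    exact (Submodule.span_singleton_smul_eq (IsUnit.mk0 x hx) (a - b)).symm
  rw [AffineSubspace.affineSpan_pair_parallel_iff_vectorSpan_eq, key x y a b h1, key z t c d h2]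

theorem not_noParallelLines {P : Set (Fin 2 → ℝ)} (hpar : NoParallelLines P)
    {a b c d : Fin 2 → ℝ} (ha : a ∈ vertices P) (hb : b ∈ vertices P) (hc : c ∈ vertices P)
    (hd : d ∈ vertices P) (hinj : Function.Injective ![a, b, c, d]) {x y z t : ℝ}
    {w : (Fin 2 → ℝ) × ℝ} (hw : w ≠ 0) (h1 : x • (a, (1 : ℝ)) + y • (b, (1 : ℝ)) = w)
    (h2 : z • (c, (1 : ℝ)) + t • (d, (1 : ℝ)) = w) : w.2 ≠ 0 := by
  intro hw2
  refine hpar ⟨![a, b, c, d], hinj, ?_, parallel_of_combination hw hw2 h1 h2⟩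
  intro i
  fin_cases i <;> assumption

/-- Three pairs of vertices whose lines share a point of the projective plane consist of at most
four distinct vertices. -/
theorem false_of_concurrent_pairs {P : Set (Fin 2 → ℝ)} (hgen : InGeneralPosition P)
    (v : Fin 3 → Bool → Fin 2 → ℝ) (hv : ∀ i b, v i b ∈ vertices P) (w : (Fin 2 → ℝ) × ℝ)
    (α : Fin 3 → Bool → ℝ) (hα : ∀ i b, α i b ≠ 0)
    (hw : ∀ i, α i false • (v i false, (1 : ℝ)) + α i true • (v i true, (1 : ℝ)) = w)
    (hcard : 5 ≤ (Finset.univ.image fun x : Fin 3 × Bool => v x.1 x.2).card) : False := by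
  have hw' : ∀ i b, α i b • (v i b, (1 : ℝ)) + α i (!b) • (v i (!b), (1 : ℝ)) = w := by
    intro i b
    cases b
    · exact hw i
    · rw [add_comm]; exact hw i
  set f : Fin 3 × Bool → Fin 2 → ℝ := fun x => v x.1 x.2 with hf
  have hfv : ∀ x, f x ∈ vertices P := fun x => hv _ _
  by_cases hinj : Function.Injective f
  · have hne : ∀ i b j c, (i, b) ≠ (j, c) → v i b ≠ v j c := fun i b j c h h' => h (hinj h')
    have hinj6 : Function.Injective fun k : Fin 6 =>
        f (![(0, false), (0, true), (1, false), (1, true), (2, false), (2, true)] k) :=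
      hinj.comp (by decide)
    have hinj4 : Function.Injective ![v 0 false, v 0 true, v 1 false, v 1 true] := by
      have : ![v 0 false, v 0 true, v 1 false, v 1 true] = fun k : Fin 4 =>
        f (![(0, false), (0, true), (1, false), (1, true)] k) := by
        ext k; fin_cases k <;> rfl
      rw [this]
      exact hinj.comp (by decide)
    have hw0 : w ≠ 0 := by
      intro h0
      have h1 := hw 0
      rw [h0] at h1
      have hor := orient_ne_zero (hv 0 false) (hv 0 true) (hv 1 false) (hne _ _ _ _ (by decide))
        (hne _ _ _ _ (by decide)) (hne _ _ _ _ (by decide))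
      exact hα 0 false (eq_zero_of_combination_eq_zero hor (x := α 0 false) (y := α 0 true)
        (z := 0) (by rw [h1]; simp)).1
    have hw2 := not_noParallelLines hgen.1 (hv 0 false) (hv 0 true) (hv 1 false) (hv 1 true)
      hinj4 hw0 (hw 0) (hw 1)
    have hwp : w = w.2 • (w.2⁻¹ • w.1, (1 : ℝ)) := by
      rw [Prod.smul_mk, smul_smul, mul_inv_cancel₀ hw2, one_smul]
      simp
    refine hgen.2.1 ⟨_, hinj6, fun i => hfv _, w.2⁻¹ • w.1, ?_, ?_, ?_⟩
    · exact mem_line_of_combination hw2 ((hw 0).trans hwp)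
    · exact mem_line_of_combination hw2 ((hw 1).trans hwp)
    · exact mem_line_of_combination hw2 ((hw 2).trans hwp)
  -- With five distinct values among six, exactly one coincidence occurs.
  · unfold Function.Injective at hinj
    push Not at hinj
    obtain ⟨x, y, hxy, hne⟩ := hinj
    have himg : Finset.univ.image f = (Finset.univ.erase y).image f := by
      ext u
      simp only [Finset.mem_image, Finset.mem_univ, true_and, Finset.mem_erase, and_true]
      constructor
      · rintro ⟨z, rfl⟩
        by_cases hz : z = y
        · exact ⟨x, hne, by rw [hz, hxy]⟩
        · exact ⟨z, hz, rfl⟩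
      · rintro ⟨z, -, rfl⟩
        exact ⟨z, rfl⟩
    have hInj : Set.InjOn f (Finset.univ.erase y : Finset (Fin 3 × Bool)) := by
      rw [← Finset.card_image_iff]
      refine le_antisymm Finset.card_image_le ?_
      rw [← himg, Finset.card_erase_of_mem (Finset.mem_univ _)]
      simpa using hcard
    have hne' : ∀ z z' : Fin 3 × Bool, z ≠ y → z' ≠ y → z ≠ z' → f z ≠ f z' := by
      intro z z' hz hz' hzz h
      exact hzz (hInj (by simpa using hz) (by simpa using hz') h)
    obtain ⟨i, b⟩ := x
    obtain ⟨j, c⟩ := y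
    have hxy' : v i b = v j c := hxy
    by_cases hij : i = j
    · subst hij
      -- A coincidence within one pair makes `w` a multiple of that vertex, which then lies on the
      -- line of another pair; three vertices are never collinear.
      have hcb : c = !b := by
        revert hne; cases b <;> cases c <;> simp
      subst hcb
      obtain ⟨k, hk⟩ : ∃ k : Fin 3, k ≠ i := exists_ne i
      have e1 : v i b ≠ v k false := hne' (i, b) (k, false) (by simp) (by simp [hk])
        (by simp [hk.symm])
      have e2 : v i b ≠ v k true := hne' (i, b) (k, true) (by simp) (by simp [hk])
        (by simp [hk.symm])
      have e3 : v k false ≠ v k true := hne' (k, false) (k, true) (by simp [hk]) (by simp [hk])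
        (by simp)
      have hor := orient_ne_zero (hv i b) (hv k false) (hv k true) e1 e2 e3
      have h1 := hw' i b
      rw [← hxy', ← hw k, ← sub_eq_zero] at h1
      refine hα k false ?_
      have := (eq_zero_of_combination_eq_zero hor (x := α i b + α i (!b)) (y := -α k false)
        (z := -α k true) (by rw [← h1]; module)).2.1
      linarith
    -- Two lines through a common vertex meet only there, so the coefficient of the other end of the
    -- pair would vanish.
    · have e1 : v i b ≠ v i (!b) := hne' (i, b) (i, !b) (by simp [hij]) (by simp [hij]) (by simp)
      have e2 : v i b ≠ v j (!c) := hne' (i, b) (j, !c) (by simp [hij]) (by simp) (by simp [hij])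
      have e3 : v i (!b) ≠ v j (!c) := hne' (i, !b) (j, !c) (by simp [hij]) (by simp)
        (by simp [hij])
      have hor := orient_ne_zero (hv i b) (hv i (!b)) (hv j (!c)) e1 e2 e3
      have h1 := hw' i b
      rw [← hw' j c, ← hxy', ← sub_eq_zero] at h1
      exact hα i (!b) (eq_zero_of_combination_eq_zero hor (x := α i b - α j c) (y := α i (!b))
        (z := -α j (!c)) (by rw [← h1]; module)).2.1

/-- The planar contradiction for a projected cube: the three intersection points of opposite
edges are collinear. -/
theorem false_of_special_collinearity {P : Set (Fin 2 → ℝ)} (hgen : InGeneralPosition P)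
    (u : Fin 7 → Fin 2 → ℝ) (hinj : Function.Injective u) (hu : ∀ i, u i ∈ vertices P)
    (w : Fin 3 → (Fin 2 → ℝ) × ℝ) (hw : ∀ i, w i ≠ 0) (α β : Fin 6 → ℝ)
    (h0 : α 0 • (u 0, (1 : ℝ)) + β 0 • (u 1, (1 : ℝ)) = w 0)
    (h0' : α 1 • (u 2, (1 : ℝ)) + β 1 • (u 3, (1 : ℝ)) = w 0)
    (h1 : α 2 • (u 1, (1 : ℝ)) + β 2 • (u 4, (1 : ℝ)) = w 1)
    (h1' : α 3 • (u 3, (1 : ℝ)) + β 3 • (u 5, (1 : ℝ)) = w 1)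
    (h2 : α 4 • (u 2, (1 : ℝ)) + β 4 • (u 6, (1 : ℝ)) = w 2)
    (h2' : α 5 • (u 0, (1 : ℝ)) + β 5 • (u 4, (1 : ℝ)) = w 2)
    {x y : ℝ} (hdep : w 1 = x • w 0 + y • w 2) : False := by
  have four : ∀ a b c d : Fin 7, Function.Injective ![a, b, c, d] →
      Function.Injective ![u a, u b, u c, u d] := by
    intro a b c d h
    have : ![u a, u b, u c, u d] = u ∘ ![a, b, c, d] := by
      ext k; fin_cases k <;> rfl
    rw [this]
    exact hinj.comp h
  have n0 := not_noParallelLines hgen.1 (hu 0) (hu 1) (hu 2) (hu 3)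
    (four 0 1 2 3 (by decide)) (hw 0) h0 h0'
  have n1 := not_noParallelLines hgen.1 (hu 1) (hu 4) (hu 3) (hu 5)
    (four 1 4 3 5 (by decide)) (hw 1) h1 h1'
  have n2 := not_noParallelLines hgen.1 (hu 2) (hu 6) (hu 0) (hu 4)
    (four 2 6 0 4 (by decide)) (hw 2) h2 h2'
  have hwp : ∀ i, (w i).2 ≠ 0 → w i = (w i).2 • ((w i).2⁻¹ • (w i).1, (1 : ℝ)) := by
    intro i hi
    rw [Prod.smul_mk, smul_smul, mul_inv_cancel₀ hi, one_smul]
    simp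
  refine hgen.2.2 ⟨u, hinj, hu, (w 0).2⁻¹ • (w 0).1, (w 1).2⁻¹ • (w 1).1, (w 2).2⁻¹ • (w 2).1,
    ⟨mem_line_of_combination n0 (h0.trans (hwp 0 n0)),
      mem_line_of_combination n0 (h0'.trans (hwp 0 n0))⟩,
    ⟨mem_line_of_combination n1 (h1.trans (hwp 1 n1)),
      mem_line_of_combination n1 (h1'.trans (hwp 1 n1))⟩,
    ⟨mem_line_of_combination n2 (h2.trans (hwp 2 n2)),
      mem_line_of_combination n2 (h2'.trans (hwp 2 n2))⟩, ?_⟩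
  have hq : (w 1).2⁻¹ • (w 1).1 ∈ line[ℝ, (w 0).2⁻¹ • (w 0).1, (w 2).2⁻¹ • (w 2).1] := by
    refine mem_line_of_combination (x := x * (w 0).2) (y := y * (w 2).2) n1 ?_
    rw [← hwp 1 n1, hdep, mul_smul, mul_smul, ← hwp 0 n0, ← hwp 2 n2]
  have := collinear_insert_of_mem_affineSpan_pair hq
  rwa [Set.insert_comm] at this

/-! ### Finite classification of sign and rank patterns -/

/-- The supports of the possible extreme rays. -/
def candidateSupports : List (List (Fin 6)) :=
  [[0], [1], [2], [3], [4], [5],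
   [0, 1], [0, 2], [0, 3], [0, 4], [0, 5], [1, 2], [1, 3], [1, 4], [1, 5], [2, 3], [2, 4], [2, 5],
   [3, 4], [3, 5], [4, 5],
   [0, 1, 2], [0, 1, 3], [0, 1, 4], [0, 1, 5], [0, 2, 3], [0, 2, 4], [0, 2, 5], [0, 3, 4],
   [0, 3, 5], [0, 4, 5], [1, 2, 3], [1, 2, 4], [1, 2, 5], [1, 3, 4], [1, 3, 5], [1, 4, 5],
   [2, 3, 4], [2, 3, 5], [2, 4, 5], [3, 4, 5]]

/-- Whether a list of indices supports an extreme ray, in terms of the signs `sg` (`0` for zero,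
`1` for positive, `2` for negative) and the ranks `r` of the coefficients. -/
def isCircuit (sg r : Fin 6 → ℕ) : List (Fin 6) → Bool
  | [i] => Nat.beq (sg i) 0
  | [i, j] => Nat.beq (sg i + sg j) 3 && Nat.beq (r i) (r j)
  | [i, j, k] => Nat.beq (sg i + sg j) 3 && Nat.beq (sg j + sg k) 3 &&
      Nat.blt (r i) (r j) && Nat.blt (r j) (r k)
  | _ => false

def circuits (sg r : Fin 6 → ℕ) : List (List (Fin 6)) :=
  candidateSupports.filter (isCircuit sg r)

/-- No nonzero dependency family of dimension two is supported on `W`. -/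
def isRigid (sg r : Fin 6 → ℕ) : List (Fin 6) → Bool
  | [i, j] => !Nat.beq (sg i) 0 && !Nat.beq (sg j) 0
  | [i, j, k] => !Nat.beq (sg i) 0 && !Nat.beq (sg j) 0 && !Nat.beq (sg k) 0 &&
      (!Nat.beq (r i) (r j) || !Nat.beq (r j) (r k))
  | _ => false

/-- Membership in a list of indices. -/
def memIndices (i : Fin 6) (S : List (Fin 6)) : Bool :=
  S.any fun j => Nat.beq i.val j.val

/-- The pairs of a set `W` and three indices outside it that can form a prism. -/
def prismLabels : List (List (Fin 6) × Fin 6 × Fin 6 × Fin 6) :=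
  [([3, 4], 0, 1, 2), ([2, 4], 0, 1, 3), ([2, 3], 0, 1, 4), ([0, 1], 2, 3, 4), ([1, 4], 0, 2, 3),
   ([1, 3], 0, 2, 4), ([0, 2], 1, 3, 4), ([1, 2], 0, 3, 4), ([0, 3], 1, 2, 4), ([0, 4], 1, 2, 3),
   ([2, 4, 5], 0, 1, 3), ([1, 4, 5], 0, 2, 3), ([0, 1, 3], 2, 4, 5), ([0, 2, 5], 1, 3, 4),
   ([0, 3, 4], 1, 2, 5), ([1, 3, 4], 0, 2, 5), ([4, 5], 0, 1, 2), ([3, 5], 0, 2, 4),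
   ([2, 5], 0, 1, 3), ([1, 5], 0, 2, 3), ([0, 1, 4], 2, 3, 5), ([1, 2, 4], 0, 3, 5),
   ([1, 2, 5], 0, 3, 4), ([0, 3, 5], 1, 2, 4), ([0, 5], 1, 3, 4)]

/-- Whether two circuits through `D` lie in `W ∪ {D}`. -/
def isPrismTop (sg r : Fin 6 → ℕ) (W : List (Fin 6)) (D : Fin 6) : Bool :=
  Nat.ble 2 ((circuits sg r).filter fun C =>
    memIndices D C && C.all fun i => memIndices i (D :: W)).length

def hasPrism (sg r : Fin 6 → ℕ) : Bool :=
  prismLabels.any fun (W, D₁, D₂, D₃) => isRigid sg r W && isPrismTop sg r W D₁ &&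
    isPrismTop sg r W D₂ && isPrismTop sg r W D₃

/-- Whether the indices in `S` support an extreme ray. -/
def hasCircuit (sg r : Fin 6 → ℕ) (S : List (Fin 6)) : Bool :=
  (circuits sg r).any fun C => (C.all fun i => memIndices i S) && S.all fun i => memIndices i C

/-- Labellings of the three pairs of opposite facets of a cube. -/
def cubeLabels : List (Fin 6 × Fin 6 × Fin 6 × Fin 6 × Fin 6 × Fin 6) :=
  [(1, 0, 2, 3, 4, 5), (0, 5, 1, 2, 3, 4), (3, 5, 4, 2, 1, 0), (3, 2, 4, 5, 0, 1),
   (1, 3, 2, 0, 5, 4), (0, 2, 1, 5, 3, 4), (5, 0, 4, 3, 2, 1), (4, 0, 5, 3, 1, 2),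
   (2, 4, 3, 1, 5, 0), (3, 4, 2, 1, 0, 5)]

/-- Supports list the facets that miss a vertex. The final alternative separates a cube whose edge
in the facets `a₁`, `b₁` is contracted from a full cube. -/
def hasCube (sg r : Fin 6 → ℕ) : Bool :=
  cubeLabels.any fun (a, a₁, b, b₁, c, c₁) =>
    hasCircuit sg r [a₁, b, c] && hasCircuit sg r [a₁, b, c₁] && hasCircuit sg r [a₁, b₁, c] &&
    hasCircuit sg r [a₁, b₁, c₁] && hasCircuit sg r [a, b₁, c] && hasCircuit sg r [a, b₁, c₁] &&
    ((Nat.ble (circuits sg r).length 7 && hasCircuit sg r [a, b]) ||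
      (Nat.ble (circuits sg r).length 8 && hasCircuit sg r [a, b, c] && hasCircuit sg r [a, b, c₁]))

/-- The splittings of the six indices into two triples. -/
def tripleSplittings : List (Fin 6 × Fin 6 × Fin 6 × Fin 6 × Fin 6 × Fin 6) :=
  [(0, 1, 2, 3, 4, 5), (0, 1, 3, 2, 4, 5), (0, 1, 4, 2, 3, 5), (0, 1, 5, 2, 3, 4),
   (0, 2, 3, 1, 4, 5), (0, 2, 4, 1, 3, 5), (0, 2, 5, 1, 3, 4), (0, 3, 4, 1, 2, 5),
   (0, 3, 5, 1, 2, 4), (0, 4, 5, 1, 2, 3)]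

/-- The nine supports are those of the vertices of a product of two triangles. -/
def hasGrid (sg r : Fin 6 → ℕ) : Bool :=
  tripleSplittings.any fun (i, i', i'', j, j', j'') =>
    [i, i', i''].all fun x => [j, j', j''].all fun y => hasCircuit sg r [x, y]

/-- The first factor serves six facets. The second serves five facets, where a padded coordinate
produces a zero coefficient, sorted to the end. -/
def isClassified (sg r : Fin 6 → ℕ) : Bool :=
  (Nat.ble (circuits sg r).length 6 || (Nat.ble (circuits sg r).length 8 && hasPrism sg r) ||
    hasCube sg r || (Nat.ble (circuits sg r).length 9 && hasGrid sg r)) &&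
  (!Nat.beq (sg 5) 0 || Nat.ble (circuits sg r).length 7)

def ofEntries (x₀ x₁ x₂ x₃ x₄ x₅ : ℕ) (i : Fin 6) : ℕ :=
  match i.val with
  | 0 => x₀ | 1 => x₁ | 2 => x₂ | 3 => x₃ | 4 => x₄ | _ => x₅

/-- The possible sign and rank increment of a coefficient after one of sign `x`. -/
def nextEntries (x : ℕ) : List (ℕ × ℕ) :=
  bif Nat.beq x 0 then [(0, 0)] else [(0, 1), (1, 0), (1, 1), (2, 0), (2, 1)]

def allClassified : Bool :=
  [0, 1].all fun x₀ => (nextEntries x₀).all fun y₁ => (nextEntries y₁.1).all fun y₂ =>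
  (nextEntries y₂.1).all fun y₃ => (nextEntries y₃.1).all fun y₄ => (nextEntries y₄.1).all fun y₅ =>
    isClassified (ofEntries x₀ y₁.1 y₂.1 y₃.1 y₄.1 y₅.1)
      (ofEntries 0 y₁.2 (y₁.2 + y₂.2) (y₁.2 + y₂.2 + y₃.2) (y₁.2 + y₂.2 + y₃.2 + y₄.2)
        (y₁.2 + y₂.2 + y₃.2 + y₄.2 + y₅.2))

/-- An exhaustive evaluation over all patterns; `0` as a first sign forces every later coefficient
to vanish. -/
theorem allClassified_eq_true : allClassified = true := by
  decide +kernel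

/-! ### Extreme rays of the nonnegative dependencies -/

/-- The linear dependencies of the vectors `lam i • (1, t i)`. -/
def depSpace (lam t : Fin 6 → ℝ) : Submodule ℝ (Fin 6 → ℝ) where
  carrier := {s | ∑ i, lam i * s i = 0 ∧ ∑ i, lam i * t i * s i = 0}
  zero_mem' := by simp
  add_mem' := by
    rintro a b ⟨ha, ha'⟩ ⟨hb, hb'⟩
    simp only [Set.mem_ofPred_eq, Pi.add_apply, mul_add, Finset.sum_add_distrib, ha, ha', hb, hb',
      add_zero, and_self]
  smul_mem' := by
    rintro c a ⟨ha, ha'⟩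
    simp only [Set.mem_ofPred_eq, Pi.smul_apply, smul_eq_mul, mul_left_comm _ c, ← Finset.mul_sum,
      ha, ha', mul_zero, and_self]

theorem mem_depSpace {lam t s : Fin 6 → ℝ} :
    s ∈ depSpace lam t ↔ ∑ i, lam i * s i = 0 ∧ ∑ i, lam i * t i * s i = 0 := Iff.rfl

section depSpace

variable {lam t : Fin 6 → ℝ} {s s' : Fin 6 → ℝ}

theorem depSpace_eq_zero_of_single (hs : s ∈ depSpace lam t) {i : Fin 6} (hi : lam i ≠ 0)
    (h : ∀ l, l ≠ i → s l = 0) : s = 0 := by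
  have h1 := hs.1
  rw [Fintype.sum_eq_single i fun l hl => by rw [h l hl, mul_zero]] at h1
  ext l
  by_cases hl : l = i
  · rw [hl]; exact (mul_eq_zero.1 h1).resolve_left hi
  · exact h l hl

theorem depSpace_eq_zero_of_pair (hs : s ∈ depSpace lam t) {i j : Fin 6} (hi : lam i ≠ 0)
    (hj : lam j ≠ 0) (hij : t i ≠ t j) (h : ∀ l, l ≠ i → l ≠ j → s l = 0) : s = 0 := by
  have hne : i ≠ j := fun h => hij (by rw [h])
  have h1 := hs.1
  have h2 := hs.2
  rw [Fintype.sum_eq_add i j hne fun l hl => by rw [h l hl.1 hl.2, mul_zero]] at h1 h2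
  have h3 : (t i - t j) * (lam i * s i) = 0 := by linear_combination h2 - t j * h1
  have h4 : s i = 0 :=
    (mul_eq_zero.1 ((mul_eq_zero.1 h3).resolve_left (sub_ne_zero.2 hij))).resolve_left hi
  refine depSpace_eq_zero_of_single hs hj fun l hl => ?_
  by_cases hli : l = i
  · rw [hli, h4]
  · exact h l hli hl

/-- If vanishing at one coordinate kills every vector on the joint support, subtracting the multiple
that cancels this coordinate proves proportionality. -/
theorem eq_smul_of_apply_ne_zero {K : Submodule ℝ (Fin 6 → ℝ)} (hs : s ∈ K) (hs' : s' ∈ K)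
    {z : Fin 6} (h : ∀ u ∈ K, (∀ l, s l = 0 → s' l = 0 → u l = 0) → u z = 0 → u = 0)
    (hne : s ≠ 0) : ∃ c : ℝ, s' = c • s := by
  have hz : s z ≠ 0 := fun hz => hne (h s hs (fun l hl _ => hl) hz)
  refine ⟨s' z / s z, sub_eq_zero.1 (h _ (K.sub_mem hs' (K.smul_mem _ hs)) ?_ ?_)⟩
  · intro l hl hl'
    simp [hl, hl']
  · simp only [Pi.sub_apply, Pi.smul_apply, smul_eq_mul]
    field_simp
    ring

theorem pairDep_mem {i j : Fin 6} (hij : t i = t j) :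
    Pi.single i (lam j) - Pi.single j (lam i) ∈ depSpace lam t := by
  have e : ∀ f : Fin 6 → ℝ, ∑ l, f l * (Pi.single i (lam j) - Pi.single j (lam i) : Fin 6 → ℝ) l
      = f i * lam j - f j * lam i := by
    intro f
    simp [mul_sub, Finset.sum_sub_distrib, Pi.single_apply]
  rw [mem_depSpace, e, e, hij]
  constructor <;> ring

/-- The dependency of three of the vectors. -/
noncomputable def tripleDep (lam t : Fin 6 → ℝ) (i j k : Fin 6) : Fin 6 → ℝ :=
  Pi.single i ((t k - t j) / lam i) - Pi.single j ((t k - t i) / lam j) +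
    Pi.single k ((t j - t i) / lam k)

theorem tripleDep_mem {i j k : Fin 6} (hi : lam i ≠ 0) (hj : lam j ≠ 0) (hk : lam k ≠ 0) :
    tripleDep lam t i j k ∈ depSpace lam t := by
  have e : ∀ f : Fin 6 → ℝ, ∑ l, f l * tripleDep lam t i j k l
      = f i * ((t k - t j) / lam i) - f j * ((t k - t i) / lam j) +
        f k * ((t j - t i) / lam k) := by
    intro f
    simp [tripleDep, mul_sub, mul_add, Finset.sum_sub_distrib, Finset.sum_add_distrib,
      Pi.single_apply]
  rw [mem_depSpace, e, e]
  constructor <;> field_simp <;> ring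

theorem tripleDep_fst {i j k : Fin 6} (hij : i < j) (hjk : j < k) :
    tripleDep lam t i j k i = (t k - t j) / lam i := by
  simp [tripleDep, hij.ne, (hij.trans hjk).ne]

theorem tripleDep_snd {i j k : Fin 6} (hij : i < j) (hjk : j < k) :
    tripleDep lam t i j k j = -((t k - t i) / lam j) := by
  simp [tripleDep, hij.ne', hjk.ne]

theorem tripleDep_trd {i j k : Fin 6} (hij : i < j) (hjk : j < k) :
    tripleDep lam t i j k k = (t j - t i) / lam k := by
  simp [tripleDep, hjk.ne', (hij.trans hjk).ne']

theorem tripleDep_of_ne {i j k l : Fin 6} (hi : l ≠ i) (hj : l ≠ j) (hk : l ≠ k) :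
    tripleDep lam t i j k l = 0 := by
  simp [tripleDep, hi, hj, hk]

/-- The sets of indices supporting extreme rays of the nonnegative dependencies. -/
inductive IsCircuitSupport (lam t : Fin 6 → ℝ) : List (Fin 6) → Prop
  | single (i : Fin 6) (h : lam i = 0) : IsCircuitSupport lam t [i]
  | pair (i j : Fin 6) (hij : i < j) (h : lam i * lam j < 0) (ht : t i = t j) :
    IsCircuitSupport lam t [i, j]
  | triple (i j k : Fin 6) (hij : i < j) (hjk : j < k) (h : lam i * lam j < 0)
    (h' : lam j * lam k < 0) (ht : t i < t j) (ht' : t j < t k) :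
    IsCircuitSupport lam t [i, j, k]

/-- A ray contains in its support a zero coefficient, two equal slopes, or three distinct slopes. In
each case an explicit dependency of those vectors is proportional to the ray, which fixes the
support, and nonnegativity fixes the signs. -/
theorem IsRay.exists_isCircuitSupport (hmono : Monotone t) (hs : IsRay (depSpace lam t) s) :
    ∃ C, IsCircuitSupport lam t C ∧ ∀ i, s i ≠ 0 ↔ i ∈ C := by
  have pos : ∀ i, s i ≠ 0 → 0 < s i := fun i hi => lt_of_le_of_ne (hs.nonneg i) hi.symm
  have sub : ∀ u ∈ depSpace lam t, (∀ i, s i = 0 → u i = 0) → u ≠ 0 →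
      ∃ c : ℝ, c ≠ 0 ∧ u = c • s := by
    intro u hu hsub hne
    obtain ⟨c, hc⟩ := hs.eq_smul u hu hsub
    exact ⟨c, by rintro rfl; exact hne (by rw [hc, zero_smul]), hc⟩
  by_cases h0 : ∃ i, s i ≠ 0 ∧ lam i = 0
  · obtain ⟨i, hi, hli⟩ := h0
    obtain ⟨c, hc, hcs⟩ := sub (Pi.single i 1) (by simp [mem_depSpace, Pi.single_apply, hli])
      (fun l hl => by
        rw [Pi.single_apply, if_neg]
        rintro rfl
        exact hi hl) (by simp)
    refine ⟨[i], .single i hli, fun l => ?_⟩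
    rw [List.mem_singleton]
    refine ⟨fun hl => ?_, fun hl => hl ▸ hi⟩
    by_contra hne
    have := congrFun hcs l
    simp only [Pi.single_apply, if_neg hne, Pi.smul_apply, smul_eq_mul] at this
    exact mul_ne_zero hc hl this.symm
  push Not at h0
  by_cases h1 : ∃ i j, i < j ∧ s i ≠ 0 ∧ s j ≠ 0 ∧ t i = t j
  · obtain ⟨i, j, hij, hi, hj, ht⟩ := h1
    obtain ⟨c, hc, hcs⟩ := sub _ (pairDep_mem ht)
      (fun l hl => by
        have h1 : l ≠ i := by rintro rfl; exact hi hl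
        have h2 : l ≠ j := by rintro rfl; exact hj hl
        simp [h1, h2])
      (fun h => by
        have := congrFun h i
        simp [hij.ne, h0 j hj] at this)
    have ei : lam j = c * s i := by simpa [hij.ne] using congrFun hcs i
    have ej : -lam i = c * s j := by simpa [hij.ne'] using congrFun hcs j
    refine ⟨[i, j], .pair i j hij ?_ ht, fun l => ?_⟩
    · have : lam i * lam j = -(c ^ 2 * (s i * s j)) := by
        rw [ei, show lam i = -(c * s j) by linarith]; ring
      rw [this]
      have := mul_pos (pos i hi) (pos j hj)
      have := mul_pos (pow_pos (abs_pos.2 hc) 2) this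
      rw [sq_abs] at this
      linarith
    · simp only [List.mem_cons, List.not_mem_nil, or_false]
      refine ⟨fun hl => ?_, ?_⟩
      · by_contra! hne
        have := congrFun hcs l
        simp only [Pi.sub_apply, Pi.single_apply, if_neg hne.1, if_neg hne.2, Pi.smul_apply,
          smul_eq_mul, sub_zero] at this
        exact mul_ne_zero hc hl this.symm
      · rintro (rfl | rfl) <;> assumption
  push Not at h1
  have hdist : ∀ i j, s i ≠ 0 → s j ≠ 0 → i ≠ j → t i ≠ t j := by
    intro i j hi hj hne
    rcases lt_or_gt_of_ne hne with h | h
    · exact h1 i j h hi hj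
    · exact (h1 j i h hj hi).symm
  have main : ∀ i j k, i < j → j < k → s i ≠ 0 → s j ≠ 0 → s k ≠ 0 →
      ∃ C, IsCircuitSupport lam t C ∧ ∀ i, s i ≠ 0 ↔ i ∈ C := by
    intro i j k hij hjk hi hj hk
    have tij : t i < t j := lt_of_le_of_ne (hmono hij.le) (h1 i j hij hi hj)
    have tjk : t j < t k := lt_of_le_of_ne (hmono hjk.le) (h1 j k hjk hj hk)
    obtain ⟨c, hc, hcs⟩ := sub _ (tripleDep_mem (h0 i hi) (h0 j hj) (h0 k hk))
      (fun l hl => tripleDep_of_ne (by rintro rfl; exact hi hl) (by rintro rfl; exact hj hl)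
        (by rintro rfl; exact hk hl))
      (fun h => by
        have := congrFun h i
        rw [tripleDep_fst hij hjk, Pi.zero_apply, div_eq_zero_iff] at this
        rcases this with h | h
        · linarith
        · exact h0 i hi h)
    have ei := congrFun hcs i
    have ej := congrFun hcs j
    have ek := congrFun hcs k
    rw [tripleDep_fst hij hjk, div_eq_iff (h0 i hi)] at ei
    rw [tripleDep_snd hij hjk, ← neg_div, div_eq_iff (h0 j hj)] at ej
    rw [tripleDep_trd hij hjk, div_eq_iff (h0 k hk)] at ek
    simp only [Pi.smul_apply, smul_eq_mul] at ei ej ek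
    have qi : 0 < c * lam i := by
      refine pos_of_mul_pos_left (b := s i) ?_ (pos i hi).le
      linarith
    have qj : 0 < -(c * lam j) := by
      refine pos_of_mul_pos_left (b := s j) ?_ (pos j hj).le
      linarith
    have qk : 0 < c * lam k := by
      refine pos_of_mul_pos_left (b := s k) ?_ (pos k hk).le
      linarith
    have hc2 : 0 < c ^ 2 := by positivity
    refine ⟨[i, j, k], .triple i j k hij hjk ?_ ?_ tij tjk, fun l => ?_⟩
    · have := mul_pos qi qj
      by_contra! h
      nlinarith [mul_nonneg hc2.le h]
    · have := mul_pos qj qk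
      by_contra! h
      nlinarith [mul_nonneg hc2.le h]
    · simp only [List.mem_cons, List.not_mem_nil, or_false]
      refine ⟨fun hl => ?_, ?_⟩
      · by_contra! hne
        have := congrFun hcs l
        rw [tripleDep_of_ne hne.1 hne.2.1 hne.2.2] at this
        exact mul_ne_zero hc hl this.symm
      · rintro (rfl | rfl | rfl) <;> assumption
  obtain ⟨i, hi⟩ : ∃ i, s i ≠ 0 := by
    by_contra! h
    exact hs.ne_zero (funext h)
  obtain ⟨j, hji, hj⟩ : ∃ j, j ≠ i ∧ s j ≠ 0 := by
    by_contra! h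
    exact hs.ne_zero (depSpace_eq_zero_of_single hs.mem (h0 i hi) h)
  obtain ⟨k, hki, hkj, hk⟩ : ∃ k, k ≠ i ∧ k ≠ j ∧ s k ≠ 0 := by
    by_contra! h
    exact hs.ne_zero (depSpace_eq_zero_of_pair hs.mem (h0 i hi) (h0 j hj)
      (hdist i j hi hj hji.symm) h)
  rcases lt_or_gt_of_ne hji with h | h <;> rcases lt_or_gt_of_ne hki with h' | h' <;>
    rcases lt_or_gt_of_ne hkj with h'' | h''
  · exact main k j i h'' h hk hj hi
  · exact main j k i h'' h' hj hk hi
  · exact absurd (h''.trans h) (not_lt.2 h'.le)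
  · exact main j i k h h' hj hi hk
  · exact main k i j h' h hk hi hj
  · exact absurd (h'.trans h) (not_lt.2 h''.le)
  · exact main i k j h' h'' hi hk hj
  · exact main i j k h h'' hi hj hk

/-- The explicit dependency is nonnegative up to a global sign. It spans a ray because deleting one
index leaves independent vectors. -/
theorem IsCircuitSupport.exists_isRay {C : List (Fin 6)} (hC : IsCircuitSupport lam t C) :
    ∃ s, IsRay (depSpace lam t) s ∧ ∀ i, s i ≠ 0 ↔ i ∈ C := by
  cases hC with
  | single i h =>
    refine ⟨Pi.single i 1, ⟨by simp [mem_depSpace, Pi.single_apply, h], ?_, by simp, ?_⟩, ?_⟩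
    · intro l
      by_cases hl : l = i <;> simp [hl]
    · intro s' _ hsub
      refine ⟨s' i, ?_⟩
      ext l
      by_cases hl : l = i
      · simp [hl]
      · simp [hl, hsub l (by simp [hl])]
    · intro l
      by_cases hl : l = i <;> simp [hl]
  | pair i j hij h ht =>
    have hi : lam i ≠ 0 := by rintro h0; simp [h0] at h
    have hj : lam j ≠ 0 := by rintro h0; simp [h0] at h
    have key : ∀ s ∈ depSpace lam t, 0 ≤ s → (∀ l, s l ≠ 0 ↔ l ∈ [i, j]) →
        ∃ s, IsRay (depSpace lam t) s ∧ ∀ l, s l ≠ 0 ↔ l ∈ [i, j] := by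
      intro s hs hs0 hsupp
      have hne : s ≠ 0 := fun h0 => (hsupp i).2 (by simp) (by simp [h0])
      refine ⟨s, ⟨hs, hs0, hne, fun s' hs' hsub => ?_⟩, hsupp⟩
      refine eq_smul_of_apply_ne_zero hs hs' (z := i) ?_ hne
      intro u hu hu0 hui
      refine depSpace_eq_zero_of_single hu hj fun l hl => ?_
      by_cases hli : l = i
      · rw [hli, hui]
      · have : s l = 0 := by
          by_contra h0
          have := (hsupp l).1 h0
          simp [hli, hl] at this
        exact hu0 l this (hsub l this)
    have hmem := pairDep_mem (lam := lam) ht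
    have hsupp : ∀ l, (Pi.single i (lam j) - Pi.single j (lam i) : Fin 6 → ℝ) l ≠ 0 ↔
        l ∈ [i, j] := by
      intro l
      by_cases hli : l = i
      · subst hli
        simp [hij.ne, hj]
      · by_cases hlj : l = j
        · subst hlj
          simp [hij.ne', hi]
        · simp [hli, hlj]
    rcases lt_or_gt_of_ne hj with hj' | hj'
    · have hi' : 0 < lam i := by nlinarith
      refine key _ (neg_mem hmem) (fun l => ?_) (fun l => ?_)
      · by_cases hli : l = i
        · subst hli
          simp [hij.ne, hj'.le]
        · by_cases hlj : l = j
          · subst hlj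
            simp [hij.ne', hi'.le]
          · simp [hli, hlj]
      · rw [Pi.neg_apply, neg_ne_zero]
        exact hsupp l
    · have hi' : lam i < 0 := by nlinarith
      refine key _ hmem (fun l => ?_) hsupp
      by_cases hli : l = i
      · subst hli
        simp [hij.ne, hj'.le]
      · by_cases hlj : l = j
        · subst hlj
          simp [hij.ne', hi'.le]
        · simp [hli, hlj]
  | triple i j k hij hjk h h' ht ht' =>
    have hi : lam i ≠ 0 := by rintro h0; simp [h0] at h
    have hj : lam j ≠ 0 := by rintro h0; simp [h0] at h
    have hk : lam k ≠ 0 := by rintro h0; simp [h0] at h'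
    have key : ∀ s ∈ depSpace lam t, 0 ≤ s → (∀ l, s l ≠ 0 ↔ l ∈ [i, j, k]) →
        ∃ s, IsRay (depSpace lam t) s ∧ ∀ l, s l ≠ 0 ↔ l ∈ [i, j, k] := by
      intro s hs hs0 hsupp
      have hne : s ≠ 0 := fun h0 => (hsupp i).2 (by simp) (by simp [h0])
      refine ⟨s, ⟨hs, hs0, hne, fun s' hs' hsub => ?_⟩, hsupp⟩
      refine eq_smul_of_apply_ne_zero hs hs' (z := i) ?_ hne
      intro u hu hu0 hui
      refine depSpace_eq_zero_of_pair hu hj hk ht'.ne fun l hl hl' => ?_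
      by_cases hli : l = i
      · rw [hli, hui]
      · have : s l = 0 := by
          by_contra h0
          have := (hsupp l).1 h0
          simp [hli, hl, hl'] at this
        exact hu0 l this (hsub l this)
    have hmem := tripleDep_mem (lam := lam) (t := t) hi hj hk
    have cases3 : ∀ l, l = i ∨ l = j ∨ l = k ∨ (l ≠ i ∧ l ≠ j ∧ l ≠ k) := by
      intro l; tauto
    have hsupp : ∀ l, tripleDep lam t i j k l ≠ 0 ↔ l ∈ [i, j, k] := by
      intro l
      rcases cases3 l with rfl | rfl | rfl | ⟨h1, h2, h3⟩
      · rw [tripleDep_fst hij hjk]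
        simp [hi, sub_ne_zero, ht'.ne']
      · rw [tripleDep_snd hij hjk]
        simp [hj, sub_ne_zero, (ht.trans ht').ne']
      · rw [tripleDep_trd hij hjk]
        simp [hk, sub_ne_zero, ht.ne']
      · rw [tripleDep_of_ne h1 h2 h3]
        simp [h1, h2, h3]
    rcases lt_or_gt_of_ne hi with hi' | hi'
    · have hj' : 0 < lam j := by nlinarith
      have hk' : lam k < 0 := by nlinarith
      refine key _ (neg_mem hmem) (fun l => ?_) (fun l => ?_)
      · rw [Pi.neg_apply, Pi.zero_apply]
        rcases cases3 l with rfl | rfl | rfl | ⟨h1, h2, h3⟩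
        · rw [tripleDep_fst hij hjk, neg_nonneg]
          exact div_nonpos_of_nonneg_of_nonpos (by linarith) hi'.le
        · rw [tripleDep_snd hij hjk, neg_neg]
          exact div_nonneg (by linarith) hj'.le
        · rw [tripleDep_trd hij hjk, neg_nonneg]
          exact div_nonpos_of_nonneg_of_nonpos (by linarith) hk'.le
        · rw [tripleDep_of_ne h1 h2 h3, neg_zero]
      · rw [Pi.neg_apply, neg_ne_zero]
        exact hsupp l
    · have hj' : lam j < 0 := by nlinarith
      have hk' : 0 < lam k := by nlinarith
      refine key _ hmem (fun l => ?_) hsupp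
      rw [Pi.zero_apply]
      rcases cases3 l with rfl | rfl | rfl | ⟨h1, h2, h3⟩
      · rw [tripleDep_fst hij hjk]
        exact div_nonneg (by linarith) hi'.le
      · rw [tripleDep_snd hij hjk, neg_nonneg]
        exact div_nonpos_of_nonneg_of_nonpos (by linarith) hj'.le
      · rw [tripleDep_trd hij hjk]
        exact div_nonneg (by linarith) hk'.le
      · rw [tripleDep_of_ne h1 h2 h3]

end depSpace

/-! ### Encoding real coefficients by signs and ranks -/

noncomputable section

/-- The sign of a coefficient: `0` for zero, `1` for positive, `2` for negative. -/
def signCode (lam : Fin 6 → ℝ) (i : Fin 6) : ℕ :=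
  open Classical in if lam i = 0 then 0 else if 0 < lam i then 1 else 2

def stepCode (t : Fin 6 → ℝ) (i : Fin 5) : ℕ :=
  open Classical in if t i.castSucc < t i.succ then 1 else 0

/-- The rank of a value of a monotone sequence. -/
def rankCode (t : Fin 6 → ℝ) : Fin 6 → ℕ :=
  ofEntries 0 (stepCode t 0) (stepCode t 0 + stepCode t 1)
    (stepCode t 0 + stepCode t 1 + stepCode t 2)
    (stepCode t 0 + stepCode t 1 + stepCode t 2 + stepCode t 3)
    (stepCode t 0 + stepCode t 1 + stepCode t 2 + stepCode t 3 + stepCode t 4)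

end

/-- Coefficients in the normal form to which the classification applies. -/
structure IsSortedConfig (lam t : Fin 6 → ℝ) : Prop where
  mono : Monotone t
  nonneg : 0 ≤ lam 0
  zero_succ : ∀ i : Fin 5, lam i.castSucc = 0 → lam i.succ = 0 ∧ t i.castSucc = t i.succ
  lt_of_zero : ∀ i : Fin 5, lam i.castSucc ≠ 0 → lam i.succ = 0 → t i.castSucc < t i.succ

theorem signCode_add_eq_three {lam : Fin 6 → ℝ} {i j : Fin 6} :
    signCode lam i + signCode lam j = 3 ↔ lam i * lam j < 0 := by
  have val : ∀ k, (lam k < 0 ∧ signCode lam k = 2) ∨ (lam k = 0 ∧ signCode lam k = 0) ∨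
      (0 < lam k ∧ signCode lam k = 1) := by
    intro k
    unfold signCode
    rcases lt_trichotomy (lam k) 0 with h | h | h
    · simp [h, h.ne, h.not_gt]
    · simp [h]
    · simp [h, h.ne']
  rcases val i with ⟨hi, ei⟩ | ⟨hi, ei⟩ | ⟨hi, ei⟩ <;>
    rcases val j with ⟨hj, ej⟩ | ⟨hj, ej⟩ | ⟨hj, ej⟩ <;> rw [ei, ej]
  · simp [(mul_pos_of_neg_of_neg hi hj).le]
  · simp [hj]
  · simp [mul_neg_of_neg_of_pos hi hj]
  · simp [hi]
  · simp [hi]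
  · simp [hi]
  · simp [mul_neg_of_pos_of_neg hi hj]
  · simp [hj]
  · simp [(mul_pos hi hj).le]

theorem signCode_eq_zero {lam : Fin 6 → ℝ} {i : Fin 6} : signCode lam i = 0 ↔ lam i = 0 := by
  unfold signCode
  split_ifs <;> simp_all

theorem rankCode_spec {t : Fin 6 → ℝ} (ht : Monotone t) {i j : Fin 6} (hij : i ≤ j) :
    (t i = t j ∧ rankCode t i = rankCode t j) ∨ (t i < t j ∧ rankCode t i < rankCode t j) := by
  have step : ∀ k : Fin 5, rankCode t k.succ = rankCode t k.castSucc + stepCode t k := by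
    intro k
    fin_cases k
    · exact (Nat.zero_add _).symm
    all_goals rfl
  have step' : ∀ k : Fin 5, (t k.castSucc = t k.succ ∧ rankCode t k.castSucc = rankCode t k.succ) ∨
      (t k.castSucc < t k.succ ∧ rankCode t k.castSucc < rankCode t k.succ) := by
    intro k
    rw [step]
    unfold stepCode
    by_cases h : t k.castSucc < t k.succ
    · right; simp [h]
    · left
      simp only [h, if_false, add_zero, and_true]
      exact le_antisymm (ht (Fin.castSucc_lt_succ).le) (not_lt.1 h)
  induction j using Fin.induction with
  | zero =>
    left
    have : i = 0 := le_antisymm hij (Fin.zero_le i)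
    simp [this]
  | succ k ih =>
    rcases hij.lt_or_eq with h | h
    · have hik : i ≤ k.castSucc := Fin.le_castSucc_iff.2 h
      rcases ih hik with ⟨h1, h2⟩ | ⟨h1, h2⟩ <;> rcases step' k with ⟨h3, h4⟩ | ⟨h3, h4⟩
      · exact Or.inl ⟨h1.trans h3, h2.trans h4⟩
      · exact Or.inr ⟨h1.trans_lt h3, h2.trans_lt h4⟩
      · exact Or.inr ⟨h1.trans_eq h3, h2.trans_eq h4⟩
      · exact Or.inr ⟨h1.trans h3, h2.trans h4⟩
    · left; simp [h]

theorem rankCode_eq_iff {t : Fin 6 → ℝ} (ht : Monotone t) {i j : Fin 6} :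
    rankCode t i = rankCode t j ↔ t i = t j := by
  rcases le_total i j with h | h
  · rcases rankCode_spec ht h with h | h
    · simp [h]
    · simp [h.1.ne, h.2.ne]
  · rcases rankCode_spec ht h with h | h
    · simp [h]
    · simp [h.1.ne', h.2.ne']

theorem rankCode_lt_iff {t : Fin 6 → ℝ} (ht : Monotone t) {i j : Fin 6} (hij : i ≤ j) :
    rankCode t i < rankCode t j ↔ t i < t j := by
  rcases rankCode_spec ht hij with h | h
  · simp [h]
  · simp [h.1, h.2]

/-- In normal form each coefficient and step of `t` is an admissible successor of the previous sign,
so the pattern was among those enumerated. -/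
theorem isClassified_of_isSortedConfig {lam t : Fin 6 → ℝ} (h : IsSortedConfig lam t) :
    isClassified (signCode lam) (rankCode t) = true := by
  have hall := allClassified_eq_true
  unfold allClassified at hall
  simp only [List.all_eq_true] at hall
  have h0 : signCode lam 0 ∈ [0, 1] := by
    unfold signCode
    rcases h.nonneg.eq_or_lt with h | h
    · simp [← h]
    · simp [h, h.ne']
  have hstep : ∀ i : Fin 5,
      (signCode lam i.succ, stepCode t i) ∈ nextEntries (signCode lam i.castSucc) := by
    intro i
    by_cases h1 : lam i.castSucc = 0
    · obtain ⟨h2, h3⟩ := h.zero_succ i h1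
      simp [nextEntries, signCode, stepCode, h1, h2, h3]
    · have e1 : Nat.beq (signCode lam i.castSucc) 0 = false := by
        rw [← Bool.not_eq_true, Nat.beq_eq]
        exact fun h => h1 (signCode_eq_zero.1 h)
      unfold nextEntries
      rw [e1]
      by_cases h2 : lam i.succ = 0
      · have h3 := h.lt_of_zero i h1 h2
        simp [signCode, stepCode, h2, h3]
      · by_cases h4 : 0 < lam i.succ <;> by_cases h5 : t i.castSucc < t i.succ <;>
          simp [signCode, stepCode, h2, h4, h5]
  have := hall _ h0 _ (hstep 0) _ (hstep 1) _ (hstep 2) _ (hstep 3) _ (hstep 4)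
  convert this using 1
  congr 1
  ext i
  fin_cases i <;> rfl

theorem candidateSupports_shape : ∀ C ∈ candidateSupports, (∃ i, C = [i]) ∨
    (∃ i j, i < j ∧ C = [i, j]) ∨ (∃ i j k, i < j ∧ j < k ∧ C = [i, j, k]) := by
  decide +kernel

theorem mem_candidateSupports : (∀ i, [i] ∈ candidateSupports) ∧
    (∀ i j, i < j → [i, j] ∈ candidateSupports) ∧
    (∀ i j k, i < j → j < k → [i, j, k] ∈ candidateSupports) := by
  decide +kernel

theorem mem_circuits_iff {lam t : Fin 6 → ℝ} (ht : Monotone t) {C : List (Fin 6)} :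
    C ∈ circuits (signCode lam) (rankCode t) ↔ IsCircuitSupport lam t C := by
  unfold circuits
  rw [List.mem_filter]
  constructor
  · rintro ⟨h1, h2⟩
    rcases candidateSupports_shape C h1 with ⟨i, rfl⟩ | ⟨i, j, hij, rfl⟩ | ⟨i, j, k, hij, hjk, rfl⟩
    · simp only [isCircuit, Nat.beq_eq] at h2
      exact .single i (signCode_eq_zero.1 h2)
    · simp only [isCircuit, Bool.and_eq_true, Nat.beq_eq] at h2
      exact .pair i j hij (signCode_add_eq_three.1 h2.1) ((rankCode_eq_iff ht).1 h2.2)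
    · simp only [isCircuit, Bool.and_eq_true, Nat.beq_eq, Nat.blt_eq] at h2
      exact .triple i j k hij hjk (signCode_add_eq_three.1 h2.1.1.1)
        (signCode_add_eq_three.1 h2.1.1.2) ((rankCode_lt_iff ht hij.le).1 h2.1.2)
        ((rankCode_lt_iff ht hjk.le).1 h2.2)
  · intro h
    cases h with
    | single i h =>
      exact ⟨mem_candidateSupports.1 i, by simp [isCircuit, signCode_eq_zero.2 h]⟩
    | pair i j hij h ht' =>
      refine ⟨mem_candidateSupports.2.1 i j hij, ?_⟩
      simp [isCircuit, signCode_add_eq_three.2 h, (rankCode_eq_iff ht).2 ht']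
    | triple i j k hij hjk h h' h1 h2 =>
      refine ⟨mem_candidateSupports.2.2 i j k hij hjk, ?_⟩
      simp [isCircuit, signCode_add_eq_three.2 h, signCode_add_eq_three.2 h',
        (rankCode_lt_iff ht hij.le).2 h1, (rankCode_lt_iff ht hjk.le).2 h2, Nat.blt_eq]

/-! ### Images of the rays: prisms and products of triangles -/

/-- The extreme rays `ρ S` with supports `S ∈ L` and the vertices `φ S` they are projected to. -/
structure IsRayMap (P : Set (Fin 2 → ℝ)) (K : Submodule ℝ (Fin 6 → ℝ))
    (π : (Fin 6 → ℝ) →ₗ[ℝ] (Fin 2 → ℝ) × ℝ) (L : Finset (Finset (Fin 6)))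
    (ρ : Finset (Fin 6) → Fin 6 → ℝ) (κ : Finset (Fin 6) → ℝ)
    (φ : Finset (Fin 6) → Fin 2 → ℝ) : Prop where
  ray : ∀ S ∈ L, IsRay K (ρ S)
  supp : ∀ S ∈ L, ∀ i, ρ S i ≠ 0 ↔ i ∈ S
  pos : ∀ S ∈ L, 0 < κ S
  vert : ∀ S ∈ L, φ S ∈ vertices P
  map_ray : ∀ S ∈ L, π (ρ S) = κ S • (φ S, (1 : ℝ))
  surj : ∀ v ∈ vertices P, ∃ S ∈ L, φ S = v

section

variable {P : Set (Fin 2 → ℝ)} {K : Submodule ℝ (Fin 6 → ℝ)}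
  {π : (Fin 6 → ℝ) →ₗ[ℝ] (Fin 2 → ℝ) × ℝ} {L : Finset (Finset (Fin 6))}
  {ρ : Finset (Fin 6) → Fin 6 → ℝ} {κ : Finset (Fin 6) → ℝ} {φ : Finset (Fin 6) → Fin 2 → ℝ}

theorem IsRayMap.card_image (h : IsRayMap P K π L ρ κ φ) (h7 : (vertices P).ncard = 7) :
    (L.image φ).card = 7 := by
  rw [← h7, ← Set.ncard_coe_finset]
  congr 1
  ext v
  simp only [Finset.coe_image, Set.mem_image, SetLike.mem_coe]
  exact ⟨fun ⟨S, hS, hv⟩ => hv ▸ h.vert S hS, h.surj v⟩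

/-- The sum of the two rays lies over the same vertex, and the vectors over a vertex form a face. -/
theorem IsRayMap.eq_of_subset_union (h : IsRayMap P K π L ρ κ φ) (hK : ConeLift P K π)
    {S S' T : Finset (Fin 6)} (hS : S ∈ L) (hS' : S' ∈ L) (hT : T ∈ L) (hφ : φ S = φ S')
    (hsub : T ⊆ S ∪ S') : φ T = φ S := by
  have r := h.ray S hS
  have r' := h.ray S' hS'
  have rT := h.ray T hT
  obtain ⟨d, -, hπ⟩ := hK.eq_smul_of_support_subset (h.vert S hS) (K.add_mem r.mem r'.mem)
    (add_nonneg r.nonneg r'.nonneg) (add_pos (h.pos S hS) (h.pos S' hS'))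
    (by rw [map_add, h.map_ray S hS, h.map_ray S' hS', ← hφ, add_smul]) rT.mem rT.nonneg
    rT.ne_zero (by
      intro i hi
      by_contra hTi
      have h1 : 0 ≤ ρ S i := r.nonneg i
      have h2 : 0 ≤ ρ S' i := r'.nonneg i
      rw [Pi.add_apply] at hi
      rcases Finset.mem_union.1 (hsub ((h.supp T hT i).1 hTi)) with hm | hm
      · exact (h.supp S hS i).2 hm (by linarith)
      · exact (h.supp S' hS' i).2 hm (by linarith))
  rw [h.map_ray T hT, Prod.smul_mk, Prod.smul_mk, Prod.mk.injEq] at hπ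
  simp only [smul_eq_mul, mul_one] at hπ
  rw [← hπ.2] at hπ
  exact smul_right_injective _ (h.pos T hT).ne' hπ.1

/-- Two rays whose supports share `b` span a vector of `K` vanishing at `b`. -/
theorem IsRayMap.exists_eliminate (h : IsRayMap P K π L ρ κ φ) {S S' : Finset (Fin 6)}
    (hS : S ∈ L) (hS' : S' ∈ L) (hne : S ≠ S') {b : Fin 6} (hb : b ∈ S) (hb' : b ∈ S') :
    ∃ u ∈ K, u ≠ 0 ∧ u b = 0 ∧ (∀ l, l ∉ S → l ∉ S' → u l = 0) ∧
      ∃ α β : ℝ, α ≠ 0 ∧ β ≠ 0 ∧ α • (φ S, (1 : ℝ)) + β • (φ S', (1 : ℝ)) = π u := by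
  have r := h.ray S hS
  have r' := h.ray S' hS'
  have e := (h.supp S hS b).2 hb
  have e' := (h.supp S' hS' b).2 hb'
  refine ⟨(ρ S b)⁻¹ • ρ S - (ρ S' b)⁻¹ • ρ S', K.sub_mem (K.smul_mem _ r.mem)
    (K.smul_mem _ r'.mem), ?_, ?_, ?_, (ρ S b)⁻¹ * κ S, -((ρ S' b)⁻¹ * κ S'), ?_, ?_, ?_⟩
  · intro h0
    apply hne
    ext i
    rw [← h.supp S hS, ← h.supp S' hS']
    have h1 := congrFun h0 i
    simp only [Pi.sub_apply, Pi.smul_apply, smul_eq_mul, Pi.zero_apply, sub_eq_zero] at h1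
    have h2 : (ρ S b)⁻¹ ≠ 0 := inv_ne_zero e
    have h3 : (ρ S' b)⁻¹ ≠ 0 := inv_ne_zero e'
    refine not_congr ⟨fun hz => ?_, fun hz => ?_⟩
    · rw [hz, mul_zero] at h1
      exact (mul_eq_zero.1 h1.symm).resolve_left h3
    · rw [hz, mul_zero] at h1
      exact (mul_eq_zero.1 h1).resolve_left h2
  · simp [e, e']
  · intro l hl hl'
    have h1 : ρ S l = 0 := by
      by_contra h0; exact hl ((h.supp S hS l).1 h0)
    have h2 : ρ S' l = 0 := by
      by_contra h0; exact hl' ((h.supp S' hS' l).1 h0)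
    simp [h1, h2]
  · exact mul_ne_zero (inv_ne_zero e) (h.pos S hS).ne'
  · exact neg_ne_zero.2 (mul_ne_zero (inv_ne_zero e') (h.pos S' hS').ne')
  · rw [map_sub, map_smul, map_smul, h.map_ray S hS, h.map_ray S' hS', smul_smul, smul_smul,
      neg_smul, sub_eq_add_neg]

/-- Three pairs of rays in a prism position have at most four distinct images. -/
theorem IsRayMap.false_of_prism (h : IsRayMap P K π L ρ κ φ) (hgen : InGeneralPosition P)
    {W : Finset (Fin 6)}
    (hW : ∀ u ∈ K, ∀ u' ∈ K, (∀ l, l ∉ W → u l = 0) → (∀ l, l ∉ W → u' l = 0) → u ≠ 0 →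
      ∃ c : ℝ, u' = c • u)
    (D : Fin 3 → Fin 6) (C : Fin 3 → Bool → Finset (Fin 6)) (hC : ∀ i b, C i b ∈ L)
    (hDC : ∀ i b, D i ∈ C i b) (hCW : ∀ i b, C i b ⊆ insert (D i) W)
    (hne : ∀ i, C i false ≠ C i true)
    (hcard : 5 ≤ (Finset.univ.image fun x : Fin 3 × Bool => φ (C x.1 x.2)).card) : False := by
  choose u huK hu0 huD huS α β hα hβ hαβ using fun i =>
    h.exists_eliminate (hC i false) (hC i true) (hne i) (hDC i false) (hDC i true)
  have huW : ∀ i l, l ∉ W → u i l = 0 := by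
    intro i l hl
    by_cases hlD : l = D i
    · rw [hlD]; exact huD i
    · refine huS i l (fun h1 => ?_) (fun h1 => ?_)
      · exact (Finset.mem_insert.1 (hCW i false h1)).elim hlD hl
      · exact (Finset.mem_insert.1 (hCW i true h1)).elim hlD hl
  -- `W` carries at most one dependency up to scaling, so the three eliminated vectors give a single
  -- point of the projective plane on all three lines.
  choose k hk using fun i => hW (u i) (huK i) (u 0) (huK 0) (huW i) (huW 0) (hu0 i)
  have hk0 : ∀ i, k i ≠ 0 := fun i h0 => hu0 0 (by rw [hk i, h0, zero_smul])
  refine false_of_concurrent_pairs hgen (fun i b => φ (C i b)) (fun i b => h.vert _ (hC i b))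
    (π (u 0)) (fun i b => k i * bif b then β i else α i) ?_ ?_ hcard
  · intro i b
    cases b
    · exact mul_ne_zero (hk0 i) (hα i)
    · exact mul_ne_zero (hk0 i) (hβ i)
  · intro i
    simp only [cond_false, cond_true]
    rw [hk i, map_smul, ← hαβ, smul_add, smul_smul, smul_smul]

/-- The prism uses six distinct rays. At most two others remain, so these six already have at least
five images. -/
theorem IsRayMap.false_of_prism_of_card_le (h : IsRayMap P K π L ρ κ φ)
    (h7 : (vertices P).ncard = 7) (hL : L.card ≤ 8) (hgen : InGeneralPosition P)
    {W : Finset (Fin 6)}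
    (hW : ∀ u ∈ K, ∀ u' ∈ K, (∀ l, l ∉ W → u l = 0) → (∀ l, l ∉ W → u' l = 0) → u ≠ 0 →
      ∃ c : ℝ, u' = c • u)
    (D : Fin 3 → Fin 6) (hD : Function.Injective D) (hDW : ∀ i, D i ∉ W)
    (C : Fin 3 → Bool → Finset (Fin 6)) (hC : ∀ i b, C i b ∈ L)
    (hDC : ∀ i b, D i ∈ C i b) (hCW : ∀ i b, C i b ⊆ insert (D i) W)
    (hne : ∀ i, C i false ≠ C i true) : False := by
  refine h.false_of_prism hgen hW D C hC hDC hCW hne ?_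
  set T : Finset (Finset (Fin 6)) := Finset.univ.image fun x : Fin 3 × Bool => C x.1 x.2 with hT
  have hinj : Function.Injective fun x : Fin 3 × Bool => C x.1 x.2 := by
    rintro ⟨i, b⟩ ⟨j, c⟩ hij
    simp only at hij
    have hij' : i = j := by
      have h1 := hCW j c (hij ▸ hDC i b)
      exact hD ((Finset.mem_insert.1 h1).resolve_right (hDW i))
    subst hij'
    have := hne i
    cases b <;> cases c
    · rfl
    · exact absurd hij this
    · exact absurd hij.symm this
    · rfl
  have hT6 : T.card = 6 := by
    rw [hT, Finset.card_image_of_injective _ hinj]; rfl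
  have hTL : T ⊆ L := by
    intro S hS
    obtain ⟨x, -, rfl⟩ := Finset.mem_image.1 hS
    exact hC _ _
  have himg : (Finset.univ.image fun x : Fin 3 × Bool => φ (C x.1 x.2)) = T.image φ := by
    rw [hT, Finset.image_image]; rfl
  rw [himg]
  have h1 : L.image φ = T.image φ ∪ (L \ T).image φ := by
    rw [← Finset.image_union, Finset.union_sdiff_of_subset hTL]
  have h2 := h.card_image h7
  have h3 : ((L \ T).image φ).card ≤ 2 := by
    refine Finset.card_image_le.trans ?_
    rw [Finset.card_sdiff_of_subset hTL]
    omega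
  have h4 := Finset.card_union_le (T.image φ) ((L \ T).image φ)
  rw [← h1, h2] at h4
  omega

theorem card_filter_fst_eq (i : Fin 3) :
    (Finset.univ.filter fun x : Fin 3 × Fin 3 => x.1 = i).card = 3 := by
  revert i
  decide

/-- If the complement of every row had at most four values, every row would add three new ones. All
nine values would then be distinct, but there are seven. -/
theorem exists_four_lt_card_image {α : Type*} [DecidableEq α] (f : Fin 3 × Fin 3 → α)
    (hf7 : (Finset.univ.image f).card = 7) :
    ∃ i, 4 < ((Finset.univ.filter fun x : Fin 3 × Fin 3 => x.1 ≠ i).image f).card := by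
  by_contra! hT4
  obtain ⟨T, hT⟩ : ∃ T : Fin 3 → Finset (Fin 3 × Fin 3),
      T = fun i => Finset.univ.filter fun x => x.1 ≠ i := ⟨_, rfl⟩
  obtain ⟨R, hR⟩ : ∃ R : Fin 3 → Finset (Fin 3 × Fin 3),
      R = fun i => Finset.univ.filter fun x => x.1 = i := ⟨_, rfl⟩
  have hT4 : ∀ i, ((T i).image f).card ≤ 4 := by rw [hT]; exact hT4
  have hR3 : ∀ i, (R i).card = 3 := by rw [hR]; exact card_filter_fst_eq
  have hTR : ∀ i, T i ∪ R i = Finset.univ := by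
    intro i
    ext x
    simp only [hT, hR, Finset.mem_univ, Finset.mem_union, Finset.mem_filter, true_and, iff_true]
    exact (em (x.1 = i)).symm
  have hunion : ∀ i, Finset.univ.image f = (T i).image f ∪ ((R i).image f \ (T i).image f) := by
    intro i
    rw [Finset.union_sdiff_self_eq_union, ← Finset.image_union, hTR]
  have key : ∀ i, 3 ≤ ((R i).image f \ (T i).image f).card := by
    intro i
    have h1 := Finset.card_union_le ((T i).image f) ((R i).image f \ (T i).image f)
    rw [← hunion i, hf7] at h1
    have := hT4 i
    omega
  have hdisj : ∀ i, (R i).image f \ (T i).image f = (R i).image f := fun i =>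
    Finset.eq_of_subset_of_card_le Finset.sdiff_subset
      (Finset.card_image_le.trans ((hR3 i).le.trans (key i)))
  have hinj : Function.Injective f := by
    rintro x y hxy
    by_cases h1 : x.1 = y.1
    · have hi : Set.InjOn f (R x.1 : Finset (Fin 3 × Fin 3)) := by
        rw [← Finset.card_image_iff]
        refine le_antisymm Finset.card_image_le ?_
        rw [hR3, ← hdisj]
        exact key _
      exact hi (by simp [hR]) (by simp [hR, h1]) hxy
    · exfalso
      have hx : f x ∈ (R x.1).image f := Finset.mem_image_of_mem f (by simp [hR])
      rw [← hdisj, Finset.mem_sdiff] at hx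
      exact hx.2 (hxy ▸ Finset.mem_image_of_mem f (by simp [hT, Ne.symm h1]))
  rw [Finset.card_image_of_injective _ hinj] at hf7
  simp at hf7

/-- Deleting one index of the first triple leaves a prism; a counting argument provides a deletion
with at least five images. -/
theorem IsRayMap.false_of_grid (h : IsRayMap P K π L ρ κ φ)
    (h7 : (vertices P).ncard = 7) (hL : L.card ≤ 9) (hgen : InGeneralPosition P)
    (e : Fin 3 ⊕ Fin 3 → Fin 6) (he : Function.Injective e)
    (hW : ∀ i j : Fin 3, i ≠ j → ∀ u ∈ K, ∀ u' ∈ K,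
      (∀ l, l ∉ ({e (.inl i), e (.inl j)} : Finset (Fin 6)) → u l = 0) →
      (∀ l, l ∉ ({e (.inl i), e (.inl j)} : Finset (Fin 6)) → u' l = 0) → u ≠ 0 →
      ∃ c : ℝ, u' = c • u)
    (hC : ∀ i j : Fin 3, {e (.inl i), e (.inr j)} ∈ L) : False := by
  set C : Fin 3 × Fin 3 → Finset (Fin 6) := fun x => {e (.inl x.1), e (.inr x.2)} with hCdef
  have hne : ∀ i j, e (.inl i) ≠ e (.inr j) := fun i j h => by simpa using he h
  have hCinj : Function.Injective C := by
    rintro ⟨i, j⟩ ⟨i', j'⟩ hij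
    simp only [hCdef] at hij
    have h1 : e (.inl i) ∈ ({e (.inl i'), e (.inr j')} : Finset (Fin 6)) := by
      rw [← hij]; simp
    have h2 : e (.inr j) ∈ ({e (.inl i'), e (.inr j')} : Finset (Fin 6)) := by
      rw [← hij]; simp
    simp only [Finset.mem_insert, Finset.mem_singleton, hne i j', or_false] at h1
    simp only [Finset.mem_insert, Finset.mem_singleton, (hne i' j).symm, false_or] at h2
    have h1' := he h1
    have h2' := he h2
    simp only [Sum.inl.injEq, Sum.inr.injEq] at h1' h2'
    rw [h1', h2']
  have hCL : Finset.univ.image C = L := by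
    refine Finset.eq_of_subset_of_card_le ?_ ?_
    · intro S hS
      obtain ⟨x, -, rfl⟩ := Finset.mem_image.1 hS
      exact hC _ _
    · rw [Finset.card_image_of_injective _ hCinj]
      exact hL
  set f : Fin 3 × Fin 3 → Fin 2 → ℝ := fun x => φ (C x) with hf
  have hf7 : (Finset.univ.image f).card = 7 := by
    rw [← h.card_image h7, ← hCL, Finset.image_image]; rfl
  have compl : ∀ i : Fin 3, ∃ j k : Fin 3, j ≠ k ∧ ∀ l, l ≠ i ↔ l = j ∨ l = k := by decide
  obtain ⟨i, hcard⟩ := exists_four_lt_card_image f hf7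
  obtain ⟨j, k, hjk, hij⟩ := compl i
  refine h.false_of_prism hgen (hW j k hjk) (fun l => e (.inr l))
    (fun l b => C (bif b then k else j, l)) (fun l b => hC _ _) (fun l b => by simp [hCdef])
    (fun l b => ?_) (fun l hl => ?_) ((Nat.succ_le_of_lt hcard).trans (Finset.card_le_card ?_))
  · intro x hx
    rcases Finset.mem_insert.1 hx with hx | hx
    · cases b
      · exact Finset.mem_insert_of_mem (Finset.mem_insert.2 (Or.inl hx))
      · exact Finset.mem_insert_of_mem (Finset.mem_insert_of_mem (Finset.mem_singleton.2 hx))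
    · exact Finset.mem_insert.2 (Or.inl (Finset.mem_singleton.1 hx))
  · have := hCinj hl
    simp only [cond_true, cond_false, Prod.mk.injEq, and_true] at this
    exact hjk this
  · intro v hv
    obtain ⟨⟨a, b⟩, hx, rfl⟩ := Finset.mem_image.1 hv
    simp only [Finset.mem_filter, Finset.mem_univ, true_and, hij] at hx
    rw [Finset.mem_image]
    rcases hx with rfl | rfl
    · exact ⟨(b, false), Finset.mem_univ _, rfl⟩
    · exact ⟨(b, true), Finset.mem_univ _, rfl⟩

end

/-! ### Images of the rays: cubes -/

section

variable {P : Set (Fin 2 → ℝ)} {K : Submodule ℝ (Fin 6 → ℝ)}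
  {π : (Fin 6 → ℝ) →ₗ[ℝ] (Fin 2 → ℝ) × ℝ} {L : Finset (Finset (Fin 6))}
  {ρ : Finset (Fin 6) → Fin 6 → ℝ} {κ : Finset (Fin 6) → ℝ} {φ : Finset (Fin 6) → Fin 2 → ℝ}

/-- A common nonzero vector on two lines through images of rays. -/
theorem IsRayMap.exists_common (h : IsRayMap P K π L ρ κ φ) {W : Finset (Fin 6)}
    (hW : ∀ u ∈ K, ∀ u' ∈ K, (∀ l, l ∉ W → u l = 0) → (∀ l, l ∉ W → u' l = 0) → u ≠ 0 →
      ∃ c : ℝ, u' = c • u)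
    {S S' T T' : Finset (Fin 6)} (hS : S ∈ L) (hS' : S' ∈ L) (hT : T ∈ L) (hT' : T' ∈ L)
    {b d : Fin 6} (hb : b ∈ S) (hb' : b ∈ S') (hd : d ∈ T) (hd' : d ∈ T')
    (hSW : S ⊆ insert b W) (hSW' : S' ⊆ insert b W) (hTW : T ⊆ insert d W)
    (hTW' : T' ⊆ insert d W) (hφ : φ S ≠ φ S') (hφ' : φ T ≠ φ T') :
    ∃ w ∈ K, w ≠ 0 ∧ (∀ l, l ∉ W → w l = 0) ∧ π w ≠ 0 ∧
      (∃ α β : ℝ, α • (φ S, (1 : ℝ)) + β • (φ S', (1 : ℝ)) = π w) ∧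
      ∃ α β : ℝ, α • (φ T, (1 : ℝ)) + β • (φ T', (1 : ℝ)) = π w := by
  obtain ⟨u, huK, hu0, hub, hu, α, β, hα, -, hαβ⟩ :=
    h.exists_eliminate hS hS' (fun h => hφ (by rw [h])) hb hb'
  obtain ⟨u', huK', hu0', hub', hu', α', β', -, -, hαβ'⟩ :=
    h.exists_eliminate hT hT' (fun h => hφ' (by rw [h])) hd hd'
  have huW : ∀ l, l ∉ W → u l = 0 := by
    intro l hl
    by_cases hlb : l = b
    · rw [hlb, hub]
    · exact hu l (fun h1 => (Finset.mem_insert.1 (hSW h1)).elim hlb hl)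
        (fun h1 => (Finset.mem_insert.1 (hSW' h1)).elim hlb hl)
  have huW' : ∀ l, l ∉ W → u' l = 0 := by
    intro l hl
    by_cases hlb : l = d
    · rw [hlb, hub']
    · exact hu' l (fun h1 => (Finset.mem_insert.1 (hTW h1)).elim hlb hl)
        (fun h1 => (Finset.mem_insert.1 (hTW' h1)).elim hlb hl)
  obtain ⟨c, hc⟩ := hW u' huK' u huK huW' huW hu0'
  refine ⟨u, huK, hu0, huW, fun h0 => ?_, ⟨α, β, hαβ⟩, c * α', c * β', ?_⟩
  · rw [h0, Prod.smul_mk, Prod.smul_mk, Prod.mk_add_mk, Prod.mk_eq_zero] at hαβ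
    simp only [smul_eq_mul, mul_one] at hαβ
    rw [eq_neg_of_add_eq_zero_right hαβ.2, neg_smul, ← sub_eq_add_neg, ← smul_sub] at hαβ
    exact hφ (sub_eq_zero.1 ((smul_eq_zero.1 hαβ.1).resolve_left hα))
  · rw [hc, map_smul, ← hαβ', smul_add, smul_smul, smul_smul]

/-- Rays in the position of seven vertices of a cube, with opposite facets `e 0, e 1`, `e 2, e 3`
and `e 4, e 5`, produce the special collinearity. -/
theorem IsRayMap.false_of_cube (h : IsRayMap P K π L ρ κ φ) (hgen : InGeneralPosition P)
    (e : Fin 6 → Fin 6) (he : Function.Injective e)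
    (hpair : ∀ u ∈ K, (∀ l, l ∉ Finset.image e {1, 4} → u l = 0) → u = 0)
    (hpair' : ∀ u ∈ K, (∀ l, l ∉ Finset.image e {1, 5} → u l = 0) → u = 0)
    (h₁ : Finset.image e {1, 2, 4} ∈ L) (h₂ : Finset.image e {1, 2, 5} ∈ L)
    (h₃ : Finset.image e {1, 3, 4} ∈ L) (h₄ : Finset.image e {1, 3, 5} ∈ L)
    (h₆ : Finset.image e {0, 3, 5} ∈ L) (h₇ : Finset.image e {0, 3, 4} ∈ L)
    {V V' : Finset (Fin 6)} (hV : V ∈ L) (hV' : V' ∈ L) (h2V : e 2 ∈ V) (h2V' : e 2 ∈ V')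
    (hVs : V ⊆ Finset.image e {0, 2, 4}) (hVs' : V' ⊆ Finset.image e {0, 2, 5})
    (hVV : φ V = φ V')
    (hinj : Function.Injective ![φ (Finset.image e {1, 2, 4}), φ (Finset.image e {1, 2, 5}),
      φ (Finset.image e {1, 3, 4}), φ (Finset.image e {1, 3, 5}), φ V,
      φ (Finset.image e {0, 3, 5}), φ (Finset.image e {0, 3, 4})]) : False := by
  have zero_of : ∀ {A : Finset (Fin 6)} (i : Fin 6) (B : Finset (Fin 6)), A ⊆ insert i B →
      ∀ u : Fin 6 → ℝ, (∀ l, l ∉ Finset.image e A → u l = 0) → u (e i) = 0 →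
      ∀ l, l ∉ Finset.image e B → u l = 0 := by
    intro A i B hAB u hu hui l hl
    by_cases hli : l = e i
    · rw [hli, hui]
    · refine hu l fun hl' => ?_
      have := Finset.image_subset_image (f := e) hAB hl'
      rw [Finset.image_insert, Finset.mem_insert] at this
      exact this.elim hli hl
  have rigid : ∀ {A : Finset (Fin 6)} (i : Fin 6) (B : Finset (Fin 6)), A ⊆ insert i B →
      (∀ u ∈ K, (∀ l, l ∉ Finset.image e B → u l = 0) → u = 0) →
      ∀ u ∈ K, ∀ u' ∈ K, (∀ l, l ∉ Finset.image e A → u l = 0) →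
      (∀ l, l ∉ Finset.image e A → u' l = 0) → u ≠ 0 → ∃ c : ℝ, u' = c • u := by
    intro A i B hAB hB u hu u' hu' hA hA' hne
    refine eq_smul_of_apply_ne_zero hu hu' (z := e i) (fun x hx hx0 hxi => ?_) hne
    exact hB x hx (zero_of i B hAB x (fun l hl => hx0 l (hA l hl) (hA' l hl)) hxi)
  have sub : ∀ {A B : Finset (Fin 6)} (i : Fin 6), A ⊆ insert i B →
      Finset.image e A ⊆ insert (e i) (Finset.image e B) := by
    intro A B i hAB
    rw [← Finset.image_insert]
    exact Finset.image_subset_image hAB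
  have mem : ∀ {A : Finset (Fin 6)} {i : Fin 6}, i ∈ A → e i ∈ Finset.image e A :=
    fun hi => Finset.mem_image_of_mem e hi
  have ne : ∀ i j : Fin 7, i ≠ j → _ := fun i j hij h => hij (hinj (a₁ := i) (a₂ := j) h)
  -- The points `p`, `q`, `r` lie on the planes of the opposite facets `e 2` and `e 3`, and also on
  -- the plane of `e 0`, `e 4`, `e 5` respectively.
  obtain ⟨p, hpK, hp0, hpW, hπp, ⟨α₀, β₀, e₀⟩, α₁, β₁, e₁⟩ :=
    h.exists_common (W := Finset.image e {1, 4, 5}) (rigid 5 {1, 4} (by decide) hpair)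
      h₁ h₂ h₃ h₄ (b := e 2) (d := e 3) (mem (by decide)) (mem (by decide)) (mem (by decide))
      (mem (by decide)) (sub 2 (by decide)) (sub 2 (by decide)) (sub 3 (by decide))
      (sub 3 (by decide)) (ne 0 1 (by decide)) (ne 2 3 (by decide))
  obtain ⟨q, hqK, hq0, hqW, hπq, ⟨α₂, β₂, e₂⟩, α₃, β₃, e₃⟩ :=
    h.exists_common (W := Finset.image e {0, 1, 5}) (rigid 0 {1, 5} (by decide) hpair')
      h₂ hV' h₄ h₆ (b := e 2) (d := e 3) (mem (by decide)) h2V' (mem (by decide))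
      (mem (by decide)) (sub 2 (by decide)) (hVs'.trans (sub 2 (by decide))) (sub 3 (by decide))
      (sub 3 (by decide)) (hVV ▸ ne 1 4 (by decide)) (ne 3 5 (by decide))
  obtain ⟨r, hrK, hr0, hrW, hπr, ⟨α₄, β₄, e₄⟩, α₅, β₅, e₅⟩ :=
    h.exists_common (W := Finset.image e {0, 1, 4}) (rigid 0 {1, 4} (by decide) hpair)
      h₃ h₇ h₁ hV (b := e 3) (d := e 2) (mem (by decide)) (mem (by decide)) (mem (by decide))
      h2V (sub 3 (by decide)) (sub 3 (by decide)) (sub 2 (by decide))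
      (hVs.trans (sub 2 (by decide))) (ne 2 6 (by decide)) (ne 0 4 (by decide))
  rw [← hVV] at e₂
  have hp5 : p (e 5) ≠ 0 := fun h0 => hp0 (hpair p hpK (zero_of 5 _ (by decide) p hpW h0))
  have hr0' : r (e 0) ≠ 0 := fun h0 => hr0 (hpair r hrK (zero_of 0 _ (by decide) r hrW h0))
  have hp0' : p (e 0) = 0 := hpW _ (by rw [he.mem_finset_image]; decide)
  have hr5 : r (e 5) = 0 := hrW _ (by rw [he.mem_finset_image]; decide)
  -- The vectors of `K` vanishing at `e 2` and `e 3` are determined by their coordinates at `e 5`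
  -- and `e 0`, so `q` is a combination of `p` and `r`.
  have hdep : q = (q (e 5) / p (e 5)) • p + (q (e 0) / r (e 0)) • r := by
    rw [← sub_eq_zero]
    refine hpair _ (K.sub_mem hqK (K.add_mem (K.smul_mem _ hpK) (K.smul_mem _ hrK))) ?_
    intro l hl
    simp only [Pi.sub_apply, Pi.add_apply, Pi.smul_apply, smul_eq_mul]
    by_cases hl5 : l = e 5
    · rw [hl5, hr5, div_mul_cancel₀ _ hp5]; ring
    by_cases hl0 : l = e 0
    · rw [hl0, hp0', div_mul_cancel₀ _ hr0']; ring
    simp only [Finset.image_insert, Finset.image_singleton, Finset.mem_insert,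
      Finset.mem_singleton, not_or] at hl
    rw [hpW l (by simp [hl, hl5]), hqW l (by simp [hl, hl5, hl0]), hrW l (by simp [hl, hl0])]
    ring
  refine false_of_special_collinearity hgen _ hinj ?_ ![π p, π q, π r] ?_
    ![α₀, α₁, α₂, α₃, α₄, α₅] ![β₀, β₁, β₂, β₃, β₄, β₅] e₀ e₁ e₂ e₃ e₄ e₅
    (x := q (e 5) / p (e 5)) (y := q (e 0) / r (e 0)) ?_
  · intro i
    fin_cases i
    exacts [h.vert _ h₁, h.vert _ h₂, h.vert _ h₃, h.vert _ h₄, h.vert _ hV, h.vert _ h₆,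
      h.vert _ h₇]
  · intro i
    fin_cases i
    exacts [hπp, hπq, hπr]
  · change π q = _ • π p + _ • π r
    rw [← map_smul, ← map_smul, ← map_add, ← hdep]

theorem IsRayMap.injOn (h : IsRayMap P K π L ρ κ φ) (h7 : (vertices P).ncard = 7)
    (hL : L.card ≤ 7) : Set.InjOn φ L := by
  rw [← Finset.card_image_iff]
  exact le_antisymm Finset.card_image_le (hL.trans (h.card_image h7).ge)

theorem IsRayMap.injOn_erase (h : IsRayMap P K π L ρ κ φ) (h7 : (vertices P).ncard = 7)
    (hL : L.card ≤ 8) {X Y : Finset (Fin 6)} (hX : X ∈ L) (hY : Y ∈ L) (hne : X ≠ Y)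
    (hXY : φ X = φ Y) : Set.InjOn φ (L.erase Y : Finset (Finset (Fin 6))) := by
  rw [← Finset.card_image_iff]
  refine le_antisymm Finset.card_image_le ?_
  rw [Finset.card_erase_of_mem hY]
  have : L.image φ = (L.erase Y).image φ := by
    refine le_antisymm ?_ (Finset.image_subset_image (Finset.erase_subset _ _))
    intro v hv
    obtain ⟨S, hS, rfl⟩ := Finset.mem_image.1 hv
    by_cases hSY : S = Y
    · rw [hSY, ← hXY]
      exact Finset.mem_image_of_mem _ (Finset.mem_erase.2 ⟨hne, hX⟩)
    · exact Finset.mem_image_of_mem _ (Finset.mem_erase.2 ⟨hSY, hS⟩)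
  rw [← this, h.card_image h7]
  omega

theorem injective_image_of_injOn {A : Set (Finset (Fin 6))} (hφ : Set.InjOn φ A)
    {e : Fin 6 → Fin 6} (he : Function.Injective e) {X₁ X₂ X₃ X₄ X₅ X₆ X₇ : Finset (Fin 6)}
    (hX : Function.Injective ![X₁, X₂, X₃, X₄, X₅, X₆, X₇])
    (hA : ∀ i, Finset.image e (![X₁, X₂, X₃, X₄, X₅, X₆, X₇] i) ∈ A) :
    Function.Injective ![φ (X₁.image e), φ (X₂.image e), φ (X₃.image e), φ (X₄.image e),
      φ (X₅.image e), φ (X₆.image e), φ (X₇.image e)] := by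
  have : ![φ (X₁.image e), φ (X₂.image e), φ (X₃.image e), φ (X₄.image e),
      φ (X₅.image e), φ (X₆.image e), φ (X₇.image e)] =
      fun i => φ (Finset.image e (![X₁, X₂, X₃, X₄, X₅, X₆, X₇] i)) := by
    funext i
    fin_cases i <;> rfl
  rw [this]
  exact fun i j hij => hX (Finset.image_injective he (hφ (hA i) (hA j) hij))

/-- The ray supported on `{0, 2}` plays the role of both cube vertices `{0, 2, 4}` and `{0, 2, 5}`.
-/
theorem IsRayMap.false_of_truncated_cube (h : IsRayMap P K π L ρ κ φ)
    (h7 : (vertices P).ncard = 7) (hL : L.card ≤ 7) (hgen : InGeneralPosition P)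
    (e : Fin 6 → Fin 6) (he : Function.Injective e)
    (hpair : ∀ u ∈ K, (∀ l, l ∉ Finset.image e {1, 4} → u l = 0) → u = 0)
    (hpair' : ∀ u ∈ K, (∀ l, l ∉ Finset.image e {1, 5} → u l = 0) → u = 0)
    (h₁ : Finset.image e {1, 2, 4} ∈ L) (h₂ : Finset.image e {1, 2, 5} ∈ L)
    (h₃ : Finset.image e {1, 3, 4} ∈ L) (h₄ : Finset.image e {1, 3, 5} ∈ L)
    (h₆ : Finset.image e {0, 3, 5} ∈ L) (h₇ : Finset.image e {0, 3, 4} ∈ L)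
    (hV : Finset.image e {0, 2} ∈ L) : False := by
  refine h.false_of_cube hgen e he hpair hpair' h₁ h₂ h₃ h₄ h₆ h₇ hV hV
    (Finset.mem_image_of_mem e (by decide)) (Finset.mem_image_of_mem e (by decide))
    (Finset.image_subset_image (by decide)) (Finset.image_subset_image (by decide)) rfl
    (injective_image_of_injOn (h.injOn h7 hL) he (by decide) ?_)
  intro i
  fin_cases i <;> assumption

/-- The vertices of a cube as triples of facets. -/
def cubeCells : Finset (Finset (Fin 6)) :=
  {{0, 2, 4}, {0, 2, 5}, {0, 3, 4}, {0, 3, 5}, {1, 2, 4}, {1, 2, 5}, {1, 3, 4}, {1, 3, 5}}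

/-- Symmetries of the cube acting on its facets. -/
def cubeSymmetry (d : Fin 3) (f : Fin 3 → Bool) : Fin 6 → Fin 6 :=
  let g : Fin 3 → Bool → Fin 6 := fun k b => bif (b ^^ f k) then
    ![1, 3, 5] (k + d) else ![0, 2, 4] (k + d)
  ![g 0 false, g 0 true, g 1 false, g 1 true, g 2 false, g 2 true]

theorem cubeSymmetry_spec (d : Fin 3) (f : Fin 3 → Bool) :
    Function.Injective (cubeSymmetry d f) ∧
    (∀ X ∈ cubeCells, X.image (cubeSymmetry d f) ∈ cubeCells) ∧
    (∃ X ∈ cubeCells, Finset.image (cubeSymmetry d f) {1, 4} ⊆ X) ∧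
    (∃ X ∈ cubeCells, Finset.image (cubeSymmetry d f) {1, 5} ⊆ X) := by
  revert d f
  decide +kernel

/-- Non-adjacent vertices span a face containing a further vertex. Adjacent ones form an edge, which
a symmetry moves to a standard position. -/
theorem cubeCells_cases : ∀ X ∈ cubeCells, ∀ Y ∈ cubeCells, X ≠ Y →
    (∃ Z ∈ cubeCells, Z ≠ X ∧ Z ≠ Y ∧ Z ⊆ X ∪ Y) ∨
    ∃ d f, X = Finset.image (cubeSymmetry d f) {0, 2, 4} ∧
      Y = Finset.image (cubeSymmetry d f) {0, 2, 5} := by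
  decide +kernel

/-- Eight rays have seven images, so exactly one pair is identified. For non-adjacent rays a third
ray in their span would be identified as well. For adjacent rays the edge is contracted, and a
symmetry reduces to the standard cube. -/
theorem IsRayMap.false_of_full_cube (h : IsRayMap P K π L ρ κ φ) (hK : ConeLift P K π)
    (h7 : (vertices P).ncard = 7) (hL : L.card ≤ 8) (hgen : InGeneralPosition P)
    (e : Fin 6 → Fin 6) (he : Function.Injective e) (hC : ∀ X ∈ cubeCells, X.image e ∈ L)
    (hpair : ∀ X ∈ cubeCells, ∀ i ∈ X, ∀ j ∈ X, i ≠ j →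
      ∀ u ∈ K, (∀ l, l ∉ Finset.image e {i, j} → u l = 0) → u = 0) : False := by
  have hcard : cubeCells.card = 8 := by decide
  obtain ⟨X, hX, Y, hY, hne, hXY⟩ := Finset.exists_ne_map_eq_of_card_lt_of_maps_to
    (s := cubeCells) (t := L.image φ) (f := fun X => φ (X.image e))
    (by rw [h.card_image h7, hcard]; norm_num)
    (fun X hX => Finset.mem_image_of_mem φ (hC X hX))
  have einj := Finset.image_injective he
  have hinj := h.injOn_erase h7 hL (hC X hX) (hC Y hY) (fun h => hne (einj h)) hXY
  have hmem : ∀ Z ∈ cubeCells, Z ≠ Y → Z.image e ∈ L.erase (Y.image e) := fun Z hZ hZY =>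
    Finset.mem_erase.2 ⟨fun h => hZY (einj h), hC Z hZ⟩
  rcases cubeCells_cases X hX Y hY hne with ⟨Z, hZ, hZX, hZY, hsub⟩ | ⟨d, f, rfl, rfl⟩
  · refine hZX (einj (hinj (hmem Z hZ hZY) (hmem X hX hne) ?_))
    refine h.eq_of_subset_union hK (hC X hX) (hC Y hY) (hC Z hZ) hXY ?_
    rw [← Finset.image_union]
    exact Finset.image_subset_image hsub
  · obtain ⟨hσ, hcell, ⟨A, hA, hA'⟩, B, hB, hB'⟩ := cubeSymmetry_spec d f
    have hmem' : ∀ Z ∈ cubeCells, Z ≠ {0, 2, 5} →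
        Z.image (e ∘ cubeSymmetry d f) ∈
          L.erase (Finset.image e (Finset.image (cubeSymmetry d f) {0, 2, 5})) := by
      intro Z hZ hZY
      rw [← Finset.image_image]
      exact hmem _ (hcell Z hZ) fun h => hZY (Finset.image_injective hσ h)
    have hC' : ∀ Z ∈ cubeCells, Z.image (e ∘ cubeSymmetry d f) ∈ L := by
      intro Z hZ
      rw [← Finset.image_image]
      exact hC _ (hcell Z hZ)
    simp only [Finset.image_image] at hXY
    have hpr : ∀ {A : Finset (Fin 6)} {i j : Fin 6}, A ∈ cubeCells →
        Finset.image (cubeSymmetry d f) {i, j} ⊆ A → i ≠ j →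
        ∀ u ∈ K, (∀ l, l ∉ Finset.image (e ∘ cubeSymmetry d f) {i, j} → u l = 0) → u = 0 := by
      intro A i j hA hA' hij
      have := hpair A hA (cubeSymmetry d f i) (hA' (Finset.mem_image_of_mem _ (by simp)))
        (cubeSymmetry d f j) (hA' (Finset.mem_image_of_mem _ (by simp))) (hσ.ne hij)
      simpa only [Finset.image_insert, Finset.image_singleton, Function.comp] using this
    refine h.false_of_cube hgen _ (he.comp hσ) (hpr hA hA' (by decide)) (hpr hB hB' (by decide))
      (hC' _ (by decide)) (hC' _ (by decide)) (hC' _ (by decide)) (hC' _ (by decide))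
      (hC' _ (by decide)) (hC' _ (by decide)) (hC' _ (by decide)) (hC' _ (by decide))
      (Finset.mem_image_of_mem _ (by decide)) (Finset.mem_image_of_mem _ (by decide))
      (Finset.Subset.refl _) (Finset.Subset.refl _) hXY
      (injective_image_of_injOn hinj (he.comp hσ) (by decide) ?_)
    intro i
    refine hmem' _ ?_ ?_ <;> revert i <;> decide

end

/-! ### From the classification to a contradiction -/

theorem memIndices_iff {i : Fin 6} {S : List (Fin 6)} : memIndices i S = true ↔ i ∈ S := by
  simp [memIndices, List.any_eq_true, ← Fin.ext_iff]

/-- The supports of the extreme rays. -/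
noncomputable def circuitSets (lam t : Fin 6 → ℝ) : Finset (Finset (Fin 6)) :=
  (circuits (signCode lam) (rankCode t)).toFinset.image List.toFinset

section

variable {P : Set (Fin 2 → ℝ)} {lam t : Fin 6 → ℝ} {π : (Fin 6 → ℝ) →ₗ[ℝ] (Fin 2 → ℝ) × ℝ}

theorem card_circuitSets_le :
    (circuitSets lam t).card ≤ (circuits (signCode lam) (rankCode t)).length :=
  Finset.card_image_le.trans (List.toFinset_card_le _)

theorem mem_circuitSets (ht : Monotone t) {S : Finset (Fin 6)} :
    S ∈ circuitSets lam t ↔ ∃ C, IsCircuitSupport lam t C ∧ C.toFinset = S := by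
  simp [circuitSets, mem_circuits_iff ht]

theorem mem_circuitSets_of_hasCircuit {S : List (Fin 6)}
    (h : hasCircuit (signCode lam) (rankCode t) S = true) : S.toFinset ∈ circuitSets lam t := by
  simp only [hasCircuit, List.any_eq_true, Bool.and_eq_true, List.all_eq_true,
    memIndices_iff] at h
  obtain ⟨C, hC, h1, h2⟩ := h
  refine Finset.mem_image.2 ⟨C, List.mem_toFinset.2 hC, ?_⟩
  ext i
  rw [List.mem_toFinset, List.mem_toFinset]
  exact ⟨h1 i, h2 i⟩

/-- The absence of hidden rays sends each ray to a vertex. Every vertex is hit because it has a ray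
over it, and rays with equal supports have the same image. -/
theorem exists_isRayMap (hK : ConeLift P (depSpace lam t) π)
    (hno : NoHiddenRay P (depSpace lam t) π) (ht : Monotone t) :
    ∃ ρ κ φ, IsRayMap P (depSpace lam t) π (circuitSets lam t) ρ κ φ := by
  have hex : ∀ S, ∃ (s : Fin 6 → ℝ) (c : ℝ) (v : Fin 2 → ℝ), S ∈ circuitSets lam t →
      IsRay (depSpace lam t) s ∧ (∀ i, s i ≠ 0 ↔ i ∈ S) ∧ 0 < c ∧ v ∈ vertices P ∧
        π s = c • (v, (1 : ℝ)) := by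
    intro S
    by_cases hS : S ∈ circuitSets lam t
    · obtain ⟨C, hC, rfl⟩ := (mem_circuitSets ht).1 hS
      obtain ⟨s, hs, hsC⟩ := hC.exists_isRay
      obtain ⟨c, hc, v, hv, hπ⟩ := hno s hs
      exact ⟨s, c, v, fun _ => ⟨hs, by simpa using hsC, hc, hv, hπ⟩⟩
    · exact ⟨0, 0, 0, fun h => absurd h hS⟩
  choose ρ κ φ H using hex
  refine ⟨ρ, κ, φ, fun S hS => (H S hS).1, fun S hS => (H S hS).2.1, fun S hS => (H S hS).2.2.1,
    fun S hS => (H S hS).2.2.2.1, fun S hS => (H S hS).2.2.2.2, fun v hv => ?_⟩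
  obtain ⟨s, hs, hsv⟩ := hK.exists_isRay hv
  obtain ⟨C, hC, hsC⟩ := hs.exists_isCircuitSupport ht
  have hS : C.toFinset ∈ circuitSets lam t := (mem_circuitSets ht).2 ⟨C, hC, rfl⟩
  obtain ⟨h1, h2, h3, -, h5⟩ := H _ hS
  refine ⟨_, hS, (IsRay.image_unique hs h1 (c := 1) ?_ h3 ?_ h5).symm⟩
  · intro i hi
    by_contra h0
    exact (hsC i).2 (by simpa using (h2 i).1 h0) hi
  · rw [hsv, one_smul]

theorem IsCircuitSupport.ne_zero {C : List (Fin 6)} (hC : IsCircuitSupport lam t C) {i j : Fin 6}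
    (hi : i ∈ C) (hj : j ∈ C) (hij : i ≠ j) : lam i ≠ 0 := by
  cases hC with
  | single a h => simp_all
  | pair a b hab h ht =>
    have := left_ne_zero_of_mul h.ne
    have := right_ne_zero_of_mul h.ne
    simp only [List.mem_cons, List.not_mem_nil, or_false] at hi
    rcases hi with rfl | rfl <;> assumption
  | triple a b c hab hbc h h' ht ht' =>
    have := left_ne_zero_of_mul h.ne
    have := right_ne_zero_of_mul h.ne
    have := right_ne_zero_of_mul h'.ne
    simp only [List.mem_cons, List.not_mem_nil, or_false] at hi
    rcases hi with rfl | rfl | rfl <;> assumption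

theorem IsCircuitSupport.apply_ne {C : List (Fin 6)} (hC : IsCircuitSupport lam t C)
    {i j k : Fin 6} (hi : i ∈ C) (hj : j ∈ C) (hk : k ∈ C) (hij : i ≠ j) (hki : k ≠ i)
    (hkj : k ≠ j) : t i ≠ t j := by
  cases hC with
  | single a h => simp_all
  | pair a b hab h ht =>
    simp only [List.mem_cons, List.not_mem_nil, or_false] at hi hj hk
    rcases hi with rfl | rfl <;> rcases hj with rfl | rfl <;> rcases hk with rfl | rfl <;>
      contradiction
  | triple a b c hab hbc h h' ht ht' =>
    simp only [List.mem_cons, List.not_mem_nil, or_false] at hi hj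
    have := ht.trans ht'
    rcases hi with rfl | rfl | rfl <;> rcases hj with rfl | rfl | rfl <;>
      first | contradiction | exact this.ne | exact this.ne' | exact ht.ne | exact ht.ne' |
        exact ht'.ne | exact ht'.ne'

/-- Two members of a circuit with a third member support no dependency. -/
theorem eq_zero_of_mem_circuitSets (ht : Monotone t) {S : Finset (Fin 6)}
    (hS : S ∈ circuitSets lam t) {i j k : Fin 6} (hi : i ∈ S) (hj : j ∈ S) (hk : k ∈ S)
    (hij : i ≠ j) (hki : k ≠ i) (hkj : k ≠ j) {u : Fin 6 → ℝ} (hu : u ∈ depSpace lam t)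
    (h : ∀ l, l ∉ ({i, j} : Finset (Fin 6)) → u l = 0) : u = 0 := by
  obtain ⟨C, hC, rfl⟩ := (mem_circuitSets ht).1 hS
  rw [List.mem_toFinset] at hi hj hk
  exact depSpace_eq_zero_of_pair hu (hC.ne_zero hi hj hij) (hC.ne_zero hj hi hij.symm)
    (hC.apply_ne hi hj hk hij hki hkj) fun l h1 h2 => h l (by simp [h1, h2])

theorem depSpace_pair_rigid {i j : Fin 6} (hj : lam j ≠ 0) :
    ∀ u ∈ depSpace lam t, ∀ u' ∈ depSpace lam t,
      (∀ l, l ∉ ({i, j} : Finset (Fin 6)) → u l = 0) →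
      (∀ l, l ∉ ({i, j} : Finset (Fin 6)) → u' l = 0) → u ≠ 0 → ∃ c : ℝ, u' = c • u := by
  intro u hu u' hu' h h' hne
  refine eq_smul_of_apply_ne_zero hu hu' (z := i) (fun x hx hx0 hxi => ?_) hne
  refine depSpace_eq_zero_of_single hx hj fun l hl => ?_
  by_cases hli : l = i
  · rw [hli, hxi]
  · exact hx0 l (h l (by simp [hl, hli])) (h' l (by simp [hl, hli]))

theorem depSpace_triple_rigid {i j k : Fin 6} (hj : lam j ≠ 0) (hk : lam k ≠ 0)
    (hjk : t j ≠ t k) :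
    ∀ u ∈ depSpace lam t, ∀ u' ∈ depSpace lam t,
      (∀ l, l ∉ ({i, j, k} : Finset (Fin 6)) → u l = 0) →
      (∀ l, l ∉ ({i, j, k} : Finset (Fin 6)) → u' l = 0) → u ≠ 0 → ∃ c : ℝ, u' = c • u := by
  intro u hu u' hu' h h' hne
  refine eq_smul_of_apply_ne_zero hu hu' (z := i) (fun x hx hx0 hxi => ?_) hne
  refine depSpace_eq_zero_of_pair hx hj hk hjk fun l hl hl' => ?_
  by_cases hli : l = i
  · rw [hli, hxi]
  · exact hx0 l (h l (by simp [hl, hli, hl'])) (h' l (by simp [hl, hli, hl']))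

theorem rigid_of_isRigid (ht : Monotone t) {W : List (Fin 6)}
    (hW : isRigid (signCode lam) (rankCode t) W = true) :
    ∀ u ∈ depSpace lam t, ∀ u' ∈ depSpace lam t, (∀ l, l ∉ W.toFinset → u l = 0) →
      (∀ l, l ∉ W.toFinset → u' l = 0) → u ≠ 0 → ∃ c : ℝ, u' = c • u := by
  have beq : ∀ m n : ℕ, (!Nat.beq m n) = true ↔ m ≠ n := by
    intro m n
    rw [Bool.not_eq_true', ← Bool.not_eq_true, Nat.beq_eq]
  match W, hW with
  | [i, j], hW =>
    simp only [isRigid, Bool.and_eq_true, beq, ne_eq, signCode_eq_zero] at hW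
    simpa using depSpace_pair_rigid hW.2
  | [i, j, k], hW =>
    simp only [isRigid, Bool.and_eq_true, Bool.or_eq_true, beq, ne_eq, signCode_eq_zero,
      rankCode_eq_iff ht] at hW
    obtain ⟨⟨⟨hi, hj⟩, hk⟩, h | h⟩ := hW
    · have e : [i, j, k].toFinset = {k, i, j} := by
        ext x; simp; tauto
      rw [e]
      exact depSpace_triple_rigid hi hj h
    · simpa using depSpace_triple_rigid hj hk h

theorem candidateSupports_nodup : candidateSupports.Nodup := by decide +kernel

theorem candidateSupports_toFinset_inj : ∀ C ∈ candidateSupports, ∀ C' ∈ candidateSupports,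
    C.toFinset = C'.toFinset → C = C' := by
  decide +kernel

/-- The filtered list has no repetitions, so its first two entries give distinct supports. -/
theorem exists_pair_of_isPrismTop {W : List (Fin 6)} {D : Fin 6}
    (h : isPrismTop (signCode lam) (rankCode t) W D = true) :
    ∃ C : Bool → Finset (Fin 6), (∀ b, C b ∈ circuitSets lam t) ∧ (∀ b, D ∈ C b) ∧
      (∀ b, C b ⊆ insert D W.toFinset) ∧ C false ≠ C true := by
  obtain ⟨F, hF⟩ : ∃ F, F = (circuits (signCode lam) (rankCode t)).filter fun C =>
    memIndices D C && C.all fun i => memIndices i (D :: W) := ⟨_, rfl⟩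
  have hlen : 2 ≤ F.length := by
    rw [hF]
    exact Nat.le_of_ble_eq_true h
  have hmem : ∀ C ∈ F, C ∈ circuits (signCode lam) (rankCode t) ∧ D ∈ C ∧
      ∀ i ∈ C, i ∈ D :: W := by
    intro C hC
    simpa only [hF, List.mem_filter, Bool.and_eq_true, List.all_eq_true, memIndices_iff] using hC
  have hnodup : F.Nodup := by
    rw [hF]
    exact (candidateSupports_nodup.filter _).filter _
  match F, hlen, hmem, hnodup with
  | C :: C' :: F', _, hmem, hnodup =>
    have hC := hmem C (by simp)
    have hC' := hmem C' (by simp)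
    have sub : ∀ {A : List (Fin 6)}, (∀ i ∈ A, i ∈ D :: W) →
        A.toFinset ⊆ insert D W.toFinset := by
      intro A hA i hi
      simpa using hA i (List.mem_toFinset.1 hi)
    have mem : ∀ {A : List (Fin 6)}, A ∈ circuits (signCode lam) (rankCode t) →
        A.toFinset ∈ circuitSets lam t := fun hA =>
      Finset.mem_image_of_mem _ (List.mem_toFinset.2 hA)
    refine ⟨fun b => bif b then C'.toFinset else C.toFinset, fun b => ?_, fun b => ?_,
      fun b => ?_, fun h => ?_⟩
    · cases b
      exacts [mem hC.1, mem hC'.1]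
    · cases b
      exacts [List.mem_toFinset.2 hC.2.1, List.mem_toFinset.2 hC'.2.1]
    · cases b
      exacts [sub hC.2.2, sub hC'.2.2]
    · have := candidateSupports_toFinset_inj C (List.mem_of_mem_filter hC.1) C'
        (List.mem_of_mem_filter hC'.1) h
      simp [this] at hnodup

theorem prismLabels_spec : ∀ x ∈ prismLabels, Function.Injective ![x.2.1, x.2.2.1, x.2.2.2] ∧
    ∀ i, ![x.2.1, x.2.2.1, x.2.2.2] i ∉ x.1.toFinset := by
  decide +kernel

theorem cubeLabels_spec : ∀ x ∈ cubeLabels, Function.Injective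
    ![x.1, x.2.1, x.2.2.1, x.2.2.2.1, x.2.2.2.2.1, x.2.2.2.2.2] := by
  simp only [cubeLabels, List.mem_cons, List.not_mem_nil, or_false]
  rintro _ (rfl | rfl | rfl | rfl | rfl | rfl | rfl | rfl | rfl | rfl) <;> decide

theorem tripleSplittings_spec : ∀ x ∈ tripleSplittings, Function.Injective
    (Sum.elim ![x.1, x.2.1, x.2.2.1] ![x.2.2.2.1, x.2.2.2.2.1, x.2.2.2.2.2]) := by
  decide +kernel

theorem exists_third_mem_cubeCells : ∀ X ∈ cubeCells, ∀ i ∈ X, ∀ j ∈ X, i ≠ j →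
    ∃ k ∈ X, k ≠ i ∧ k ≠ j := by
  decide +kernel

section

variable {ρ : Finset (Fin 6) → Fin 6 → ℝ} {κ : Finset (Fin 6) → ℝ} {φ : Finset (Fin 6) → Fin 2 → ℝ}

theorem false_of_hasPrism (h : IsRayMap P (depSpace lam t) π (circuitSets lam t) ρ κ φ)
    (ht : Monotone t) (h7 : (vertices P).ncard = 7) (hgen : InGeneralPosition P)
    (hlen : (circuits (signCode lam) (rankCode t)).length ≤ 8)
    (hp : hasPrism (signCode lam) (rankCode t) = true) : False := by
  simp only [hasPrism, List.any_eq_true, Bool.and_eq_true] at hp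
  obtain ⟨x, hx, ⟨⟨hW, h0⟩, h1⟩, h2⟩ := hp
  obtain ⟨hD, hDW⟩ := prismLabels_spec x hx
  have htop : ∀ i, isPrismTop (signCode lam) (rankCode t) x.1 (![x.2.1, x.2.2.1, x.2.2.2] i) =
      true := by
    intro i
    fin_cases i
    exacts [h0, h1, h2]
  choose C hC hDC hCW hne using fun i => exists_pair_of_isPrismTop (htop i)
  exact h.false_of_prism_of_card_le h7 (card_circuitSets_le.trans hlen) hgen
    (rigid_of_isRigid ht hW) _ hD hDW C hC hDC hCW hne

theorem false_of_hasGrid (h : IsRayMap P (depSpace lam t) π (circuitSets lam t) ρ κ φ)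
    (ht : Monotone t) (h7 : (vertices P).ncard = 7) (hgen : InGeneralPosition P)
    (hlen : (circuits (signCode lam) (rankCode t)).length ≤ 9)
    (hp : hasGrid (signCode lam) (rankCode t) = true) : False := by
  simp only [hasGrid, List.any_eq_true, List.all_eq_true] at hp
  obtain ⟨x, hx, hall⟩ := hp
  have he := tripleSplittings_spec x hx
  have hC : ∀ i j : Fin 3, ({![x.1, x.2.1, x.2.2.1] i,
      ![x.2.2.2.1, x.2.2.2.2.1, x.2.2.2.2.2] j} : Finset (Fin 6)) ∈ circuitSets lam t := by
    intro i j
    have := mem_circuitSets_of_hasCircuit (hall (![x.1, x.2.1, x.2.2.1] i)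
      (by fin_cases i <;> simp) (![x.2.2.2.1, x.2.2.2.2.1, x.2.2.2.2.2] j)
      (by fin_cases j <;> simp))
    simpa using this
  refine h.false_of_grid h7 (card_circuitSets_le.trans hlen) hgen _ he (fun i j _ => ?_) hC
  obtain ⟨C, hCs, hC'⟩ := (mem_circuitSets ht).1 (hC j 0)
  refine depSpace_pair_rigid (hCs.ne_zero (j := ![x.2.2.2.1, x.2.2.2.2.1, x.2.2.2.2.2] 0) ?_ ?_ ?_)
  · rw [← List.mem_toFinset, hC']; simp
  · rw [← List.mem_toFinset, hC']; simp
  · exact fun h => by simpa using he (a₁ := Sum.inl j) (a₂ := Sum.inr 0) h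

theorem false_of_hasCube (h : IsRayMap P (depSpace lam t) π (circuitSets lam t) ρ κ φ)
    (hK : ConeLift P (depSpace lam t) π)
    (ht : Monotone t) (h7 : (vertices P).ncard = 7) (hgen : InGeneralPosition P)
    (hp : hasCube (signCode lam) (rankCode t) = true) : False := by
  simp only [hasCube, List.any_eq_true, Bool.and_eq_true, Bool.or_eq_true] at hp
  obtain ⟨x, hx, ⟨⟨⟨⟨⟨h124, h125⟩, h134⟩, h135⟩, h034⟩, h035⟩, hc⟩ := hp
  have he := cubeLabels_spec x hx
  obtain ⟨e, hedef⟩ : ∃ e, e = ![x.1, x.2.1, x.2.2.1, x.2.2.2.1, x.2.2.2.2.1, x.2.2.2.2.2] :=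
    ⟨_, rfl⟩
  rw [← hedef] at he
  have conv : ∀ {i j k : Fin 6}, hasCircuit (signCode lam) (rankCode t) [e i, e j, e k] = true →
      Finset.image e {i, j, k} ∈ circuitSets lam t := by
    intro i j k h
    simpa using mem_circuitSets_of_hasCircuit h
  have h124 : Finset.image e {1, 2, 4} ∈ circuitSets lam t := conv (by rw [hedef]; exact h124)
  have h125 : Finset.image e {1, 2, 5} ∈ circuitSets lam t := conv (by rw [hedef]; exact h125)
  have h134 : Finset.image e {1, 3, 4} ∈ circuitSets lam t := conv (by rw [hedef]; exact h134)
  have h135 : Finset.image e {1, 3, 5} ∈ circuitSets lam t := conv (by rw [hedef]; exact h135)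
  have h034 : Finset.image e {0, 3, 4} ∈ circuitSets lam t := conv (by rw [hedef]; exact h034)
  have h035 : Finset.image e {0, 3, 5} ∈ circuitSets lam t := conv (by rw [hedef]; exact h035)
  have hpair : ∀ {X : Finset (Fin 6)} {i j : Fin 6}, X.image e ∈ circuitSets lam t →
      i ∈ X → j ∈ X → i ≠ j → (∃ k ∈ X, k ≠ i ∧ k ≠ j) →
      ∀ u ∈ depSpace lam t, (∀ l, l ∉ Finset.image e {i, j} → u l = 0) → u = 0 := by
    rintro X i j hX hi hj hij ⟨k, hk, hki, hkj⟩ u hu h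
    refine eq_zero_of_mem_circuitSets ht hX (Finset.mem_image_of_mem e hi)
      (Finset.mem_image_of_mem e hj) (Finset.mem_image_of_mem e hk) (he.ne hij) (he.ne hki)
      (he.ne hkj) hu ?_
    simpa using h
  rcases hc with ⟨hlen, h02⟩ | ⟨⟨hlen, h024⟩, h025⟩
  · have h02 : Finset.image e {0, 2} ∈ circuitSets lam t := by
      have := mem_circuitSets_of_hasCircuit h02
      rw [hedef]
      simpa using this
    exact h.false_of_truncated_cube h7 (card_circuitSets_le.trans (Nat.le_of_ble_eq_true hlen))
      hgen e he (hpair h124 (by decide) (by decide) (by decide) (by decide))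
      (hpair h125 (by decide) (by decide) (by decide) (by decide)) h124 h125 h134 h135 h035 h034
      h02
  · have h024 : Finset.image e {0, 2, 4} ∈ circuitSets lam t := conv (by rw [hedef]; exact h024)
    have h025 : Finset.image e {0, 2, 5} ∈ circuitSets lam t := conv (by rw [hedef]; exact h025)
    have hcell : ∀ X ∈ cubeCells, X.image e ∈ circuitSets lam t := by
      intro X hX
      simp only [cubeCells, Finset.mem_insert, Finset.mem_singleton] at hX
      rcases hX with rfl | rfl | rfl | rfl | rfl | rfl | rfl | rfl <;> assumption
    exact h.false_of_full_cube hK h7 (card_circuitSets_le.trans (Nat.le_of_ble_eq_true hlen))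
      hgen e he hcell fun X hX i hi j hj hij =>
        hpair (hcell X hX) hi hj hij (exists_third_mem_cubeCells X hX i hi j hj hij)

end

theorem false_of_isSortedConfig (hs : IsSortedConfig lam t) (hK : ConeLift P (depSpace lam t) π)
    (hno : NoHiddenRay P (depSpace lam t) π) (h7 : (vertices P).ncard = 7)
    (hgen : InGeneralPosition P) : False := by
  obtain ⟨ρ, κ, φ, h⟩ := exists_isRayMap hK hno hs.mono
  have hcl := isClassified_of_isSortedConfig hs
  simp only [isClassified, Bool.and_eq_true, Bool.or_eq_true] at hcl
  rcases hcl.1 with ((h6 | ⟨h8, hp⟩) | hc) | ⟨h9, hg⟩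
  · have h1 := Finset.card_image_le (s := circuitSets lam t) (f := φ)
    rw [h.card_image h7] at h1
    have h2 := card_circuitSets_le (lam := lam) (t := t)
    have h3 := Nat.le_of_ble_eq_true h6
    omega
  · exact false_of_hasPrism h hs.mono h7 hgen (Nat.le_of_ble_eq_true h8) hp
  · exact false_of_hasCube h hK hs.mono h7 hgen hc
  · exact false_of_hasGrid h hs.mono h7 hgen (Nat.le_of_ble_eq_true h9) hg

theorem IsSortedConfig.eq_zero_of_le {lam t : Fin 6 → ℝ} (hs : IsSortedConfig lam t) {i j : Fin 6}
    (hi : lam i = 0) (hij : i ≤ j) : lam j = 0 := by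
  induction j using Fin.induction with
  | zero => rwa [← le_antisymm hij (Fin.zero_le i)]
  | succ k ih =>
    rcases hij.lt_or_eq with h | h
    · exact (hs.zero_succ k (ih (Fin.le_castSucc_iff.2 h))).1
    · rwa [← h]

/-- With a vanishing coefficient, at most six rays have a support other than its index. -/
theorem card_circuitSets_erase_le (hs : IsSortedConfig lam t) {z : Fin 6} (hz : lam z = 0) :
    ((circuitSets lam t).erase {z}).card ≤ 6 := by
  have hcl := isClassified_of_isSortedConfig hs
  simp only [isClassified, Bool.and_eq_true, Bool.or_eq_true] at hcl
  -- Zero coefficients are sorted to the end, so the last clause of `isClassified` applies.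
  have h5 : lam 5 = 0 := hs.eq_zero_of_le hz (Fin.le_last z)
  have hlen : (circuits (signCode lam) (rankCode t)).length ≤ 7 := by
    rcases hcl.2 with h | h
    · simp [signCode_eq_zero.2 h5] at h
    · exact Nat.le_of_ble_eq_true h
  rw [Finset.card_erase_of_mem ((mem_circuitSets hs.mono).2 ⟨[z], .single z hz, by simp⟩)]
  have := card_circuitSets_le (lam := lam) (t := t)
  omega

end

/-! ### Lower bounds for the dimension of the slack space -/

theorem orient_homogeneous_add (a b x y : Fin 2 → ℝ) (c d : ℝ) (p : Fin 2 → ℝ)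
    (h : c • (x, (1 : ℝ)) + d • (y, (1 : ℝ)) = (c + d) • (p, (1 : ℝ))) :
    (c + d) * orient a b p = c * orient a b x + d * orient a b y := by
  rw [Prod.smul_mk, Prod.smul_mk, Prod.smul_mk, Prod.mk_add_mk, Prod.mk.injEq] at h
  have h0 := congrFun h.1 0
  have h1 := congrFun h.1 1
  simp only [Pi.add_apply, Pi.smul_apply, smul_eq_mul] at h0 h1
  unfold orient
  linear_combination (b 1 - a 1) * h0 - (b 0 - a 0) * h1

theorem IsCyclicOrder.orient_edge_pos {p : Fin 7 → Fin 2 → ℝ} (hp : IsCyclicOrder p)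
    (j k : Fin 7) (h : k ≠ j) (h' : k ≠ j + 1) : 0 < orient (p j) (p (j + 1)) (p k) := by
  have := hp.shift j 0 1 (k - j) (by decide) (by revert j k; decide)
  simpa using this

theorem orient_nonneg_of_mem_convexHull {S : Set (Fin 2 → ℝ)} {a b x : Fin 2 → ℝ}
    (hS : ∀ y ∈ S, 0 ≤ orient a b y) (hx : x ∈ convexHull ℝ S) : 0 ≤ orient a b x := by
  have hconv : Convex ℝ {y | 0 ≤ orient a b y} := by
    intro y hy z hz c d hc hd hcd
    have : orient a b (c • y + d • z) = c * orient a b y + d * orient a b z := by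
      have := orient_homogeneous_add a b y z c d (c • y + d • z) (by
        simp [Prod.smul_mk, hcd])
      rwa [hcd, one_mul] at this
    simp only [Set.mem_ofPred_eq] at hy hz ⊢
    rw [this]
    positivity
  exact convexHull_min hS hconv hx

section

variable {M : ℕ} {P : Set (Fin 2 → ℝ)} {K : Submodule ℝ (Fin M → ℝ)}
  {π : (Fin M → ℝ) →ₗ[ℝ] (Fin 2 → ℝ) × ℝ}

theorem linearIndependent_of_orient_ne_zero {s : Fin 3 → Fin M → ℝ} {v : Fin 3 → Fin 2 → ℝ}
    (hπ : ∀ i, π (s i) = (v i, (1 : ℝ))) (hv : orient (v 0) (v 1) (v 2) ≠ 0) :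
    LinearIndependent ℝ s := by
  rw [Fintype.linearIndependent_iff]
  intro g hg
  have h := congrArg π hg
  rw [map_sum, map_zero, Fin.sum_univ_three, map_smul, map_smul, map_smul, hπ, hπ, hπ] at h
  obtain ⟨h0, h1, h2⟩ := eq_zero_of_combination_eq_zero hv h
  intro i
  fin_cases i <;> assumption

/-- The vertices of an edge lie on a facet inequality that is not tight at the next vertex. -/
theorem ConeLift.exists_edge_index (hK : ConeLift P K π) (hP : IsPolytope P)
    {p : Fin 7 → Fin 2 → ℝ} (hp : IsCyclicOrder p) (hrange : Set.range p = vertices P)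
    {s : Fin 7 → Fin M → ℝ} (hsK : ∀ j, s j ∈ K) (hs : ∀ j, 0 ≤ s j)
    (hπ : ∀ j, π (s j) = (p j, (1 : ℝ))) (j : Fin 7) :
    ∃ i, s j i = 0 ∧ s (j + 1) i = 0 ∧ s (j + 2) i ≠ 0 := by
  by_contra! hcon
  have h2 : 0 < orient (p j) (p (j + 1)) (p (j + 2)) :=
    have hne : ∀ i : Fin 7, i + 2 ≠ i ∧ i + 2 ≠ i + 1 := by decide
    hp.orient_edge_pos j (j + 2) (hne j).1 (hne j).2
  have hnonneg : ∀ x ∈ P, 0 ≤ orient (p j) (p (j + 1)) x := by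
    intro x hx
    rw [← convexHull_vertices hP] at hx
    refine orient_nonneg_of_mem_convexHull ?_ hx
    rw [← hrange]
    rintro _ ⟨k, rfl⟩
    by_cases h : k = j
    · simp [h, orient]
    by_cases h' : k = j + 1
    · rw [h']
      refine le_of_eq ?_
      unfold orient
      ring
    exact (hp.orient_edge_pos j k h h').le
  -- If no such index existed, `s j + s (j + 1) - ε • s (j + 2)` would be nonnegative, although its
  -- image lies strictly outside the edge.
  obtain ⟨ε, hε, hle⟩ := exists_pos_mul_le (add_nonneg (hs j) (hs (j + 1)))
    (s' := s (j + 2)) (by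
      intro i hi
      have h0 : 0 ≤ s j i := hs j i
      have h1 : 0 ≤ s (j + 1) i := hs (j + 1) i
      rw [Pi.add_apply] at hi
      exact hcon i (by linarith) (by linarith))
  set x := s j + s (j + 1) - ε • s (j + 2) with hx
  have hxK : x ∈ K := K.sub_mem (K.add_mem (hsK _) (hsK _)) (K.smul_mem _ (hsK _))
  have hx0 : 0 ≤ x := fun i => sub_nonneg.2 (hle i)
  have hπx : π x = (p j, (1 : ℝ)) + (p (j + 1), (1 : ℝ)) - ε • (p (j + 2), (1 : ℝ)) := by
    rw [hx, map_sub, map_add, map_smul, hπ, hπ, hπ]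
  obtain ⟨c, hc, q, hq, hcq⟩ : ∃ c : ℝ, 0 ≤ c ∧ ∃ q ∈ P, π x = c • (q, (1 : ℝ)) := by
    by_cases h0 : x = 0
    · refine ⟨0, le_rfl, p j, ?_, by rw [h0, map_zero, zero_smul]⟩
      have : p j ∈ vertices P := hrange ▸ ⟨j, rfl⟩
      exact this.1
    · obtain ⟨c, hc, q, hq, h⟩ := hK.cone x hxK hx0 h0
      exact ⟨c, hc.le, q, hq, h⟩
  rw [hπx, Prod.smul_mk, Prod.smul_mk, Prod.mk_add_mk, Prod.mk_sub_mk, Prod.mk.injEq] at hcq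
  have e0 := congrFun hcq.1 0
  have e1 := congrFun hcq.1 1
  have e2 := hcq.2
  simp only [Pi.add_apply, Pi.sub_apply, Pi.smul_apply, smul_eq_mul, mul_one] at e0 e1 e2
  have hneg : c * orient (p j) (p (j + 1)) q = -(ε * orient (p j) (p (j + 1)) (p (j + 2))) := by
    unfold orient
    linear_combination (p (j + 1) 1 - p j 1) * e0 - (p (j + 1) 0 - p j 0) * e1 +
      ((p (j + 1) 0 - p j 0) * p j 1 - (p (j + 1) 1 - p j 1) * p j 0) * e2
  have := mul_nonneg hc (hnonneg q hq)
  have := mul_pos hε h2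
  linarith

theorem ConeLift.exists_lifts (hK : ConeLift P K π) {p : Fin 7 → Fin 2 → ℝ}
    (hrange : Set.range p = vertices P) : ∃ s : Fin 7 → Fin M → ℝ, (∀ j, s j ∈ K) ∧
      (∀ j, 0 ≤ s j) ∧ ∀ j, π (s j) = (p j, (1 : ℝ)) := by
  choose s h1 h2 h3 using fun j => hK.lift (p j) (hrange ▸ ⟨j, rfl⟩)
  exact ⟨s, h1, h2, h3⟩

theorem ConeLift.three_le_finrank (hK : ConeLift P K π) {p : Fin 7 → Fin 2 → ℝ}
    (hp : IsCyclicOrder p) (hrange : Set.range p = vertices P) : 3 ≤ Module.finrank ℝ K := by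
  obtain ⟨s, hsK, -, hπ⟩ := hK.exists_lifts hrange
  have hli := linearIndependent_of_orient_ne_zero
    (s := fun i : Fin 3 => s (Fin.castLE (by norm_num) i))
    (v := fun i => p (Fin.castLE (by norm_num) i)) (fun i => hπ _)
    (hp _ _ _ (by decide) (by decide)).ne'
  have hli' : LinearIndependent ℝ (fun i : Fin 3 =>
      (⟨s (Fin.castLE (by norm_num) i), hsK _⟩ : K)) :=
    LinearIndependent.of_comp K.subtype hli
  simpa using hli'.fintype_card_le_finrank

/-- A plane polygon with seven edges is no intersection of six half-planes. -/
theorem ConeLift.four_le_finrank {K : Submodule ℝ (Fin 6 → ℝ)}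
    {π : (Fin 6 → ℝ) →ₗ[ℝ] (Fin 2 → ℝ) × ℝ} (hK : ConeLift P K π) (hP : IsPolytope P)
    {p : Fin 7 → Fin 2 → ℝ} (hp : IsCyclicOrder p)
    (hrange : Set.range p = vertices P) : 4 ≤ Module.finrank ℝ K := by
  have h3 := hK.three_le_finrank hp hrange
  by_contra! h4
  have hfin : Module.finrank ℝ K = 3 := by omega
  obtain ⟨s, hsK, hs, hπ⟩ := hK.exists_lifts hrange
  choose g hg0 hg1 hg2 using hK.exists_edge_index hP hp hrange hsK hs hπ
  -- Seven edges use six indices, so two share one. This coordinate then vanishes at three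
  -- noncollinear vertices, hence on the three-dimensional `K`, although it is nonzero at a further
  -- vertex.
  obtain ⟨j, j', hne, hgj⟩ := Fintype.exists_ne_map_eq_of_card_lt g (by simp)
  obtain ⟨k, hk, hkj, hkj'⟩ : ∃ k, (k = j' ∨ k = j' + 1) ∧ k ≠ j ∧ k ≠ j + 1 := by
    clear hgj
    revert j j'; decide
  have hk0 : s k (g j) = 0 := by
    rw [hgj]
    rcases hk with rfl | rfl
    · exact hg0 _
    · exact hg1 _
  have hli := linearIndependent_of_orient_ne_zero (s := ![s j, s (j + 1), s k])
    (v := ![p j, p (j + 1), p k]) (π := π) (by intro i; fin_cases i <;> exact hπ _)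
    (hp.orient_edge_pos j k hkj hkj').ne'
  have hmem : ∀ i, ![s j, s (j + 1), s k] i ∈ K := by
    intro i; fin_cases i <;> exact hsK _
  have hspan : Submodule.span ℝ (Set.range ![s j, s (j + 1), s k]) = K := by
    refine Submodule.eq_of_le_of_finrank_le (Submodule.span_le.2 ?_) ?_
    · rintro _ ⟨i, rfl⟩
      exact hmem i
    · rw [hfin, finrank_span_eq_card hli]
      simp
  have hle : K ≤ LinearMap.ker (LinearMap.proj (g j) : (Fin 6 → ℝ) →ₗ[ℝ] ℝ) := by
    rw [← hspan, Submodule.span_le]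
    rintro _ ⟨i, rfl⟩
    rw [SetLike.mem_coe, LinearMap.mem_ker]
    fin_cases i
    exacts [hg0 j, hg1 j, hk0]
  exact hg2 j (hle (hsK _))

end

/-! ### Normal form of two equations and relabelling of coordinates -/

/-- A subspace of codimension at most two is cut out by two equations. -/
theorem exists_equations {M : ℕ} (K : Submodule ℝ (Fin M → ℝ)) (hK : M ≤ Module.finrank ℝ K + 2) :
    ∃ α β : Fin M → ℝ, ∀ s, s ∈ K ↔ ∑ i, α i * s i = 0 ∧ ∑ i, β i * s i = 0 := by
  have hq : Module.finrank ℝ ((Fin M → ℝ) ⧸ K) ≤ Module.finrank ℝ (Fin 2 → ℝ) := by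
    have := K.finrank_quotient_add_finrank
    simp only [Module.finrank_fintype_fun_eq_card, Fintype.card_fin] at this ⊢
    omega
  obtain ⟨f, hf⟩ := finrank_le_iff_exists_linearMap.1 hq
  refine ⟨fun i => f (K.mkQ (Pi.single i 1)) 0, fun i => f (K.mkQ (Pi.single i 1)) 1, fun s => ?_⟩
  have e : ∀ k : Fin 2, ∑ i, f (K.mkQ (Pi.single i 1)) k * s i = f (K.mkQ s) k := by
    intro k
    have := LinearMap.pi_apply_eq_sum_univ (f ∘ₗ K.mkQ) s
    rw [LinearMap.comp_apply] at this
    rw [this, Finset.sum_apply]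
    refine Finset.sum_congr rfl fun i _ => ?_
    rw [Pi.smul_apply, smul_eq_mul, mul_comm]
    have hsingle : (Pi.single i 1 : Fin M → ℝ) = fun j => if i = j then 1 else 0 := by
      funext j
      simp [Pi.single_apply, eq_comm]
    rw [hsingle]
    rfl
  have hmem : s ∈ K ↔ f (K.mkQ s) = 0 := by
    rw [map_eq_zero_iff f hf, Submodule.mkQ_apply, Submodule.Quotient.mk_eq_zero]
  rw [e, e, hmem, funext_iff, Fin.forall_fin_two]
  rfl

/-- Two equations in six variables can be sorted into the normal form. -/
theorem exists_isSortedConfig (α β : Fin 6 → ℝ) :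
    ∃ (σ : Equiv.Perm (Fin 6)) (lam t : Fin 6 → ℝ), IsSortedConfig lam t ∧
      (∀ s, s ∈ depSpace lam t ↔
        ∑ i, α i * s (σ.symm i) = 0 ∧ ∑ i, β i * s (σ.symm i) = 0) ∧
      ∀ i, α (σ i) = 0 → β (σ i) = 0 → lam i = 0 := by
  classical
  -- A generic first equation has zero coefficients only where both equations do, so every other
  -- column has a finite slope `β i / lam₀ i`.
  obtain ⟨τ, hτ⟩ := exists_generic_combination α β
  set lam₀ : Fin 6 → ℝ := fun i => α i + τ * β i with hlam₀
  -- This value exceeds all slopes and is assigned to zero columns so that sorting puts them last.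
  set T : ℝ := 1 + ∑ i, |β i / lam₀ i| with hT
  set t₀ : Fin 6 → ℝ := fun i => if lam₀ i = 0 then T else β i / lam₀ i with ht₀
  have ht_zero : ∀ i, lam₀ i = 0 → t₀ i = T := fun i hi => if_pos hi
  have ht_lt : ∀ i, lam₀ i ≠ 0 → t₀ i < T := by
    intro i hi
    have h1 : t₀ i = β i / lam₀ i := if_neg hi
    have h2 := Finset.single_le_sum (f := fun i => |β i / lam₀ i|) (fun j _ => abs_nonneg _)
      (Finset.mem_univ i)
    have h3 := le_abs_self (β i / lam₀ i)
    rw [h1, hT]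
    linarith
  have hmul : ∀ i, lam₀ i * t₀ i = β i := by
    intro i
    by_cases hi : lam₀ i = 0
    · rw [hi, zero_mul, (hτ i hi).2]
    · rw [show t₀ i = β i / lam₀ i from if_neg hi, mul_div_cancel₀ _ hi]
  obtain ⟨σ, hσ⟩ : ∃ σ : Equiv.Perm (Fin 6), Monotone (t₀ ∘ σ) := ⟨_, Tuple.monotone_sort t₀⟩
  -- A global change of sign makes the first coefficient nonnegative without changing the solution
  -- space.
  obtain ⟨ε, hε, hε0⟩ : ∃ ε : ℝ, ε ≠ 0 ∧ 0 ≤ ε * lam₀ (σ 0) := by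
    rcases le_total 0 (lam₀ (σ 0)) with h | h
    · exact ⟨1, one_ne_zero, by linarith⟩
    · exact ⟨-1, by norm_num, by linarith⟩
  refine ⟨σ, fun i => ε * lam₀ (σ i), t₀ ∘ σ, ⟨hσ, hε0, ?_, ?_⟩, fun s => ?_, fun i h1 h2 => ?_⟩
  · intro i hi
    have hi' : lam₀ (σ i.castSucc) = 0 := (mul_eq_zero.1 hi).resolve_left hε
    have hle : t₀ (σ i.castSucc) ≤ t₀ (σ i.succ) := hσ Fin.castSucc_lt_succ.le
    rw [ht_zero _ hi'] at hle
    have h0 : lam₀ (σ i.succ) = 0 := by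
      by_contra h0
      exact absurd (ht_lt _ h0) (not_lt.2 hle)
    refine ⟨by rw [h0, mul_zero], ?_⟩
    rw [Function.comp, Function.comp, ht_zero _ hi', ht_zero _ h0]
  · intro i hi hi'
    have h0 : lam₀ (σ i.succ) = 0 := (mul_eq_zero.1 hi').resolve_left hε
    rw [Function.comp, Function.comp, ht_zero _ h0]
    exact ht_lt _ (right_ne_zero_of_mul hi)
  · have e1 : ∑ i, ε * lam₀ (σ i) * s i =
        ε * (∑ i, α i * s (σ.symm i) + τ * ∑ i, β i * s (σ.symm i)) := by
      rw [← Equiv.sum_comp σ.symm, Finset.mul_sum, ← Finset.sum_add_distrib, Finset.mul_sum]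
      refine Finset.sum_congr rfl fun i _ => ?_
      simp only [hlam₀, Equiv.apply_symm_apply]
      ring
    have e2 : ∑ i, ε * lam₀ (σ i) * (t₀ ∘ σ) i * s i = ε * ∑ i, β i * s (σ.symm i) := by
      rw [← Equiv.sum_comp σ.symm, Finset.mul_sum]
      refine Finset.sum_congr rfl fun i _ => ?_
      simp only [Function.comp, Equiv.apply_symm_apply, ← hmul]
      ring
    rw [mem_depSpace, e1, e2]
    simp only [mul_eq_zero, hε, false_or]
    constructor
    · rintro ⟨h1, h2⟩
      rw [h2, mul_zero, add_zero] at h1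
      exact ⟨h1, h2⟩
    · rintro ⟨h1, h2⟩
      rw [h1, h2, mul_zero, add_zero]
      exact ⟨rfl, rfl⟩
  · simp [hlam₀, h1, h2]

section

variable {P : Set (Fin 2 → ℝ)} {M : ℕ} {K K' : Submodule ℝ (Fin M → ℝ)}
  {π : (Fin M → ℝ) →ₗ[ℝ] (Fin 2 → ℝ) × ℝ}

theorem isRay_comp_perm_iff (σ : Equiv.Perm (Fin M)) (hK' : ∀ s, s ∈ K' ↔ s ∘ σ.symm ∈ K)
    {s : Fin M → ℝ} : IsRay K' s ↔ IsRay K (s ∘ σ.symm) := by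
  have comp_ne : s ∘ σ.symm = 0 ↔ s = 0 := by
    constructor
    · intro h
      funext i
      simpa using congrFun h (σ i)
    · rintro rfl
      rfl
  constructor
  · rintro ⟨h1, h2, h3, h4⟩
    refine ⟨(hK' s).1 h1, fun i => h2 (σ.symm i), mt comp_ne.1 h3, fun s' hs' h => ?_⟩
    obtain ⟨c, hc⟩ := h4 (s' ∘ σ) ((hK' _).2 (by simpa [Function.comp_assoc] using hs'))
      (fun i hi => h (σ i) (by simpa using hi))
    refine ⟨c, funext fun i => ?_⟩
    simpa using congrFun hc (σ.symm i)
  · rintro ⟨h1, h2, h3, h4⟩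
    refine ⟨(hK' s).2 h1, fun i => by simpa using h2 (σ i), mt comp_ne.2 h3, fun s' hs' h => ?_⟩
    obtain ⟨c, hc⟩ := h4 (s' ∘ σ.symm) ((hK' _).1 hs') (fun i hi => h _ hi)
    refine ⟨c, funext fun i => ?_⟩
    simpa using congrFun hc (σ i)

theorem ConeLift.comp_perm (hK : ConeLift P K π) (σ : Equiv.Perm (Fin M))
    (hK' : ∀ s, s ∈ K' ↔ s ∘ σ.symm ∈ K) :
    ConeLift P K' (π ∘ₗ LinearMap.funLeft ℝ ℝ σ.symm) where
  cone s hs hs0 hne := by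
    refine hK.cone (s ∘ σ.symm) ((hK' s).1 hs) (fun i => hs0 (σ.symm i)) fun h => hne ?_
    funext i
    simpa using congrFun h (σ i)
  lift v hv := by
    obtain ⟨s, hs, hs0, hπ⟩ := hK.lift v hv
    have e : (s ∘ σ) ∘ σ.symm = s := by simp [Function.comp_assoc]
    refine ⟨s ∘ σ, (hK' _).2 (by rwa [e]), fun i => hs0 (σ i), ?_⟩
    rw [LinearMap.comp_apply, ← hπ]
    exact congrArg π e

theorem NoHiddenRay.comp_perm (hno : NoHiddenRay P K π) (σ : Equiv.Perm (Fin M))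
    (hK' : ∀ s, s ∈ K' ↔ s ∘ σ.symm ∈ K) :
    NoHiddenRay P K' (π ∘ₗ LinearMap.funLeft ℝ ℝ σ.symm) := fun s hs =>
  hno (s ∘ σ.symm) ((isRay_comp_perm_iff σ hK').1 hs)

end

/-! ### Conclusion: hidden vertices and the exclusion of five facets -/

theorem not_noHiddenRay {P : Set (Fin 2 → ℝ)} (hP : IsConvexHeptagon P)
    (hgen : InGeneralPosition P) {K : Submodule ℝ (Fin 6 → ℝ)}
    {π : (Fin 6 → ℝ) →ₗ[ℝ] (Fin 2 → ℝ) × ℝ} (hK : ConeLift P K π) : ¬ NoHiddenRay P K π := by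
  intro hno
  obtain ⟨p, -, hrange, hp⟩ := exists_cyclicOrder hP.1.convex hP.2
  have hfin := hK.four_le_finrank hP.1 hp hrange
  obtain ⟨α, β, hαβ⟩ := exists_equations K (by omega)
  obtain ⟨σ, lam, t, hs, hmem, -⟩ := exists_isSortedConfig α β
  have hK' : ∀ s, s ∈ depSpace lam t ↔ s ∘ σ.symm ∈ K := fun s => by
    rw [hmem, hαβ]
    rfl
  exact false_of_isSortedConfig hs (hK.comp_perm σ hK') (hno.comp_perm σ hK') hP.2 hgen

/-- A vector with five coordinates, extended by zero. -/
def extendZero (s : Fin 5 → ℝ) : Fin 6 → ℝ := Fin.snoc s 0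

@[simp]
theorem extendZero_castSucc (s : Fin 5 → ℝ) (i : Fin 5) : extendZero s i.castSucc = s i :=
  Fin.snoc_castSucc (α := fun _ => ℝ) (0 : ℝ) s i

@[simp]
theorem extendZero_last (s : Fin 5 → ℝ) : extendZero s 5 = 0 :=
  Fin.snoc_last (α := fun _ => ℝ) (0 : ℝ) s

theorem sum_extendZero_mul (α : Fin 5 → ℝ) (s : Fin 6 → ℝ) :
    ∑ i, extendZero α i * s i = ∑ i : Fin 5, α i * s i.castSucc := by
  rw [Fin.sum_univ_castSucc]
  simp

theorem IsRay.extendZero {K : Submodule ℝ (Fin 5 → ℝ)} {K' : Submodule ℝ (Fin 6 → ℝ)}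
    (hK' : ∀ s, s ∈ K' ↔ (fun i : Fin 5 => s i.castSucc) ∈ K) {s : Fin 5 → ℝ} (hs : IsRay K s) :
    IsRay K' (extendZero s) where
  mem := by
    rw [hK']
    simpa using hs.mem
  nonneg i := by
    refine Fin.lastCases ?_ (fun i => ?_) i
    · simp
    · simpa using hs.nonneg i
  ne_zero h := hs.ne_zero (funext fun i => by simpa using congrFun h i.castSucc)
  eq_smul s' hs' h := by
    obtain ⟨c, hc⟩ := hs.eq_smul _ ((hK' s').1 hs') fun i hi => h i.castSucc (by simpa using hi)
    refine ⟨c, funext fun i => ?_⟩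
    refine Fin.lastCases ?_ (fun i => ?_) i
    · rw [h (Fin.last 5) (by simp)]
      simp
    · simpa using congrFun hc i

/-- Padding by a free sixth coordinate turns `K` into a dependency space with a zero coefficient at
`z`. The rays over the seven vertices avoid `z`, but at most six supports other than `{z}` are
available. -/
theorem not_coneLift_five {P : Set (Fin 2 → ℝ)} (hP : IsConvexHeptagon P)
    {K : Submodule ℝ (Fin 5 → ℝ)} {π : (Fin 5 → ℝ) →ₗ[ℝ] (Fin 2 → ℝ) × ℝ} :
    ¬ ConeLift P K π := by
  intro hK
  obtain ⟨p, hinj, hrange, hp⟩ := exists_cyclicOrder hP.1.convex hP.2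
  have hfin := hK.three_le_finrank hp hrange
  obtain ⟨α, β, hαβ⟩ := exists_equations K (by omega)
  obtain ⟨σ, lam, t, hs, hmem, hzero⟩ := exists_isSortedConfig
    (extendZero α) (extendZero β)
  set K' : Submodule ℝ (Fin 6 → ℝ) := K.comap (LinearMap.funLeft ℝ ℝ Fin.castSucc) with hK'def
  have hK' : ∀ s, s ∈ K' ↔ (fun i : Fin 5 => s i.castSucc) ∈ K := fun s => Iff.rfl
  have hdep : ∀ s, s ∈ depSpace lam t ↔ s ∘ σ.symm ∈ K' := fun s => by
    rw [hmem, hK', hαβ, ← sum_extendZero_mul α (s ∘ σ.symm), ← sum_extendZero_mul β (s ∘ σ.symm)]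
    rfl
  obtain ⟨z, hz⟩ : ∃ z, z = σ.symm 5 := ⟨_, rfl⟩
  have hlam : lam z = 0 := hzero z (by simp [hz]) (by simp [hz])
  choose s hs_ray hs_map using fun j => hK.exists_isRay (v := p j) (hrange ▸ ⟨j, rfl⟩)
  have hr : ∀ j, IsRay (depSpace lam t) (extendZero (s j) ∘ σ) := fun j => by
    rw [isRay_comp_perm_iff σ hdep, Function.comp_assoc]
    simpa using (hs_ray j).extendZero hK'
  choose C hC hsupp using fun j => (hr j).exists_isCircuitSupport hs.mono
  have hmaps : ∀ j ∈ (Finset.univ : Finset (Fin 7)),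
      (C j).toFinset ∈ (circuitSets lam t).erase {z} := by
    intro j _
    refine Finset.mem_erase.2 ⟨fun h => ?_, (mem_circuitSets hs.mono).2 ⟨C j, hC j, rfl⟩⟩
    have hzC : z ∈ C j := by rw [← List.mem_toFinset, h]; simp
    exact (hsupp j z).2 hzC (by simp [hz])
  -- Two vertices whose rays have the same support would coincide.
  obtain ⟨i, -, j, -, hne, hij⟩ := Finset.exists_ne_map_eq_of_card_lt_of_maps_to
    (lt_of_le_of_lt (card_circuitSets_erase_le hs hlam) (by simp)) hmaps
  refine hne (hinj (IsRay.image_unique (π := π) (c := 1) (hs_ray i) (hs_ray j) (fun k hk => ?_)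
    one_pos (by rw [hs_map, one_smul]) (by rw [hs_map, one_smul])))
  by_contra hk'
  have h1 : σ.symm k.castSucc ∈ C j := (hsupp j _).1 (by simpa using hk')
  rw [← List.mem_toFinset, ← hij, List.mem_toFinset] at h1
  exact (hsupp i _).2 h1 (by simpa using hk)

theorem mainTheorem1 (P : Set (Fin 2 → ℝ)) (hP : IsConvexHeptagon P) (hgen : InGeneralPosition P)
    (k : ℕ) (Q : Set (Fin (2 + k) → ℝ)) (hQ : IsMinimumSizeExtension Q P) :
    polytopeSize Q = 6 ∧ ∃ w ∈ vertices Q, firstCoords 2 k w ∉ vertices P := by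
  obtain ⟨R, hR, hR6⟩ := exists_extension_size_le_six hP
  have h6 : polytopeSize Q ≤ (6 : ℕ) := (hQ.2 1 R hR).trans hR6
  obtain ⟨v, hv, v', hv', hne⟩ : ∃ v ∈ vertices P, ∃ v' ∈ vertices P, v ≠ v' :=
    (Set.one_lt_ncard_iff (Set.finite_of_ncard_ne_zero (by rw [hP.2]; norm_num))).1
      (by rw [hP.2]; norm_num) |>.imp fun v h => h.elim fun v' h => ⟨h.1, v', h.2.1, h.2.2⟩
  refine ⟨le_antisymm h6 ?_, ?_⟩
  · by_contra! hlt
    have h5 : polytopeSize Q ≤ (5 : ℕ) := Order.le_of_lt_add_one hlt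
    obtain ⟨K, π, hK, -⟩ := exists_coneLift hQ.1 h5 hv.1 hv'.1 hne
    exact not_coneLift_five hP hK
  · by_contra! hall
    obtain ⟨K, π, hK, hno⟩ := exists_coneLift hQ.1 h6 hv.1 hv'.1 hne
    exact not_noHiddenRay hP hgen hK (hno hall)
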